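/- Let $\gamma>0$, $\lambda>0$ and $0<\mu<2$. Let $Q=H^1(\mathbb R^+)\oplus H^1(\mathbb R^-)$ with $\|\psi\|_Q^2=\|\psi\|_{L^2}^2+\|\psi'\|_{L^2}^2$ ($\psi'$ being the weak derivative on $\mathbb R\setminus\{0\}$), and let $H_\gamma$ be the self-adjoint operator on $L^2(\mathbb R)$ with domain $$D(H_\gamma)=\{\psi\in H^2(\mathbb R\setminus\{0\}):\ \psi'(0+)=\psi'(0-),\ \psi(0+)-\psi(0-)=-\gamma\,\psi'(0+)\},\qquad H_\gamma\psi=-\psi''\ \text{ on }\mathbb R\setminus\{0\}.$$ For $\psi_0\in Q$ and $0<T\le\infty$, a weak solution on $[0,T)$ is a function $\psi\in C^0([0,T),Q)$ with $$\psi(t)=e^{-iH_\gamma t}\psi_0+i\lambda\int_0^t e^{-iH_\gamma(t-s)}|\psi(s)|^{2\mu}\psi(s)\,ds\qquad\text{for all }t\in[0,T).$$ Then, for every $\psi_0\in Q$, all weak solutions are globally defined in time: every maximal weak solution (one that no weak solution on a longer interval extends) is defined on $[0,\infty)$. More precisely, there is a weak solution $\Psi\in C^0([0,\infty),Q)\cap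 C^1([0,\infty),Q^\star)$ on $[0,\infty)$, where $Q\subset Q^\star$ through the scalar product of $L^2(\mathbb R)$, and every weak solution on an interval $[0,T)$, $0<T\le\infty$, with the same initial datum $\psi_0$ is the restriction of $\Psi$ to $[0,T)$. -/

import Mathlib

open MeasureTheory Filter Topology Set
open scoped ENNReal ContDiff

namespace DeltaPrimeNLS

noncomputable section

/-- The Hilbert space `L²(ℝ; ℂ)`. -/
abbrev L2 : Type := Lp ℂ 2 (volume : Measure ℝ)

/-- `g` is the weak (distributional) derivative of `f` on `ℝ ∖ {0}`: the test functions are the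
smooth functions with compact support contained in `ℝ ∖ {0}`. -/
def IsWeakDeriv (f g : L2) : Prop :=
  ∀ φ : ℝ → ℝ, ContDiff ℝ ∞ φ → HasCompactSupport φ → tsupport φ ⊆ {0}ᶜ →
    ∫ x, deriv φ x • f x = -∫ x, φ x • g x

/-- `f (0+) = a`: the essential right limit of `f` at the origin is `a`, that is, the limit off a
null set.  For `f ∈ H¹(ℝ⁺)` this is the right limit of the continuous representative. -/
def HasRightTrace (f : L2) (a : ℂ) : Prop :=
  Tendsto f (𝓝[>] (0 : ℝ) ⊓ ae volume) (𝓝 a)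

/-- `f (0-) = a`: the essential left limit of `f` at the origin is `a`. -/
def HasLeftTrace (f : L2) (a : ℂ) : Prop :=
  Tendsto f (𝓝[<] (0 : ℝ) ⊓ ae volume) (𝓝 a)

theorem integrable_test {φ : ℝ → ℝ} (hφ : Continuous φ) (hc : HasCompactSupport φ) (f : L2) :
    Integrable (fun x => φ x • f x) :=
  ((Lp.memLp f).locallyIntegrable (by norm_num)).integrable_smul_left_of_hasCompactSupport hφ hc

theorem IsWeakDeriv.zero : IsWeakDeriv 0 0 := by
  intro φ _ _ _
  have h : ∀ c : ℝ → ℝ, ∫ x, c x • (0 : L2) x = 0 := fun c => by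
    simp
  rw [h, h, neg_zero]

theorem IsWeakDeriv.add {f₁ g₁ f₂ g₂ : L2} (h₁ : IsWeakDeriv f₁ g₁) (h₂ : IsWeakDeriv f₂ g₂) :
    IsWeakDeriv (f₁ + f₂) (g₁ + g₂) := by
  intro φ hφ hc hs
  have key : ∀ c : ℝ → ℝ, Continuous c → HasCompactSupport c → ∀ u v : L2,
      ∫ x, c x • (u + v) x = (∫ x, c x • u x) + ∫ x, c x • v x := by
    intro c hcont hcs u v
    rw [← integral_add (integrable_test hcont hcs u) (integrable_test hcont hcs v)]
    refine integral_congr_ae ?_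
    filter_upwards [Lp.coeFn_add u v] with x hx
    simp only [hx, Pi.add_apply, smul_add]
  rw [key _ (hφ.continuous_deriv (by simp)) hc.deriv, key _ hφ.continuous hc,
    h₁ φ hφ hc hs, h₂ φ hφ hc hs, neg_add]

theorem IsWeakDeriv.smul {f g : L2} (c : ℂ) (h : IsWeakDeriv f g) :
    IsWeakDeriv (c • f) (c • g) := by
  intro φ hφ hc hs
  have key : ∀ (d : ℝ → ℝ) (u : L2), ∫ x, d x • (c • u) x = c • ∫ x, d x • u x := by
    intro d u
    rw [← integral_smul]
    refine integral_congr_ae ?_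
    filter_upwards [Lp.coeFn_smul c u] with x hx
    simp only [hx, Pi.smul_apply]
    exact smul_comm _ _ _
  rw [key, key, h φ hφ hc hs, smul_neg]

/-- The weak derivative is unique. -/
theorem IsWeakDeriv.eq_zero {g : L2} (h : IsWeakDeriv 0 g) : g = 0 := by
  have h0 : ∀ᵐ x ∂(volume : Measure ℝ), x ∈ ({0}ᶜ : Set ℝ) → g x = 0 := by
    refine isOpen_compl_singleton.ae_eq_zero_of_integral_contDiff_smul_eq_zero
      (((Lp.memLp g).locallyIntegrable (by norm_num)).locallyIntegrableOn _) ?_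
    intro φ hφ hc hs
    have h1 := h φ hφ hc hs
    have h2 : ∫ x, deriv φ x • (0 : L2) x = 0 := by
      simp
    rw [h2] at h1
    exact neg_eq_zero.mp h1.symm
  rw [Lp.eq_zero_iff_ae_eq_zero]
  have h3 : ∀ᵐ x ∂(volume : Measure ℝ), x ≠ 0 := by
    simp [ae_iff]
  filter_upwards [h0, h3] with x hx hx0
  exact hx hx0

theorem tendsto_zero_of_le_ae {l : Filter ℝ} (hl : l ≤ ae volume) :
    Tendsto (0 : L2) l (𝓝 0) :=
  tendsto_const_nhds.congr' (((Lp.coeFn_zero ℂ 2 (volume : Measure ℝ)).symm).filter_mono hl)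

theorem tendsto_add_of_le_ae {l : Filter ℝ} (hl : l ≤ ae volume) {f g : L2} {a b : ℂ}
    (hf : Tendsto f l (𝓝 a)) (hg : Tendsto g l (𝓝 b)) :
    Tendsto (f + g : L2) l (𝓝 (a + b)) :=
  (hf.add hg).congr' (((Lp.coeFn_add f g).symm).filter_mono hl)

theorem tendsto_smul_of_le_ae {l : Filter ℝ} (hl : l ≤ ae volume) (c : ℂ) {f : L2} {a : ℂ}
    (hf : Tendsto f l (𝓝 a)) : Tendsto (c • f : L2) l (𝓝 (c * a)) :=
  (hf.const_smul c).congr' (((Lp.coeFn_smul c f).symm).filter_mono hl)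

/-! ### The energy space -/

/-- The graph of the weak derivative on `ℝ ∖ {0}`, inside the Hilbert space `L² ⊕ L²`. -/
def energySubmodule : Submodule ℂ (WithLp 2 (L2 × L2)) where
  carrier := {p | IsWeakDeriv p.fst p.snd}
  zero_mem' := IsWeakDeriv.zero
  add_mem' h₁ h₂ := IsWeakDeriv.add h₁ h₂
  smul_mem' c _ h := IsWeakDeriv.smul c h

/-- The energy space `Q = H¹(ℝ⁺) ⊕ H¹(ℝ⁻)`.  An element is a function `ψ ∈ L²(ℝ)` together with its
(unique) weak derivative `ψ' ∈ L²(ℝ)` on `ℝ ∖ {0}`; the norm is `‖ψ‖_Q² = ‖ψ‖² + ‖ψ'‖²`. -/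
abbrev Q : Type := energySubmodule

/-- The underlying `L²` function of an element of `Q`. -/
def Q.toL2 : Q →L[ℂ] L2 :=
  (WithLp.fstL 2 ℂ L2 L2).comp energySubmodule.subtypeL

/-- The embedding of `Q` into its dual `Q*`, `u ↦ (u, ·)_{L²}` (antilinear, as the scalar
product is antilinear on the left). -/
def Q.toDual (u : Q) : Q →L[ℂ] ℂ :=
  (innerSL ℂ (Q.toL2 u)).comp Q.toL2

/-! ### The Hamiltonian -/

/-- The graph of `H_γ`: pairs `(ψ, η)` with `ψ ∈ H²(ℝ ∖ {0})`, `ψ'(0+) = ψ'(0-)`,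
`ψ(0+) - ψ(0-) = -γ ψ'(0+)` and `η = -ψ''` away from the origin. -/
def hamiltonianGraph (γ : ℝ) : Submodule ℂ (L2 × L2) where
  carrier := {p | ∃ g : L2, IsWeakDeriv p.1 g ∧ IsWeakDeriv g (-p.2) ∧
    ∃ a b c : ℂ, HasRightTrace p.1 a ∧ HasLeftTrace p.1 b ∧
      HasRightTrace g c ∧ HasLeftTrace g c ∧ a - b = -(γ : ℂ) * c}
  zero_mem' :=
    ⟨0, IsWeakDeriv.zero, by simpa using IsWeakDeriv.zero, 0, 0, 0,
      tendsto_zero_of_le_ae inf_le_right, tendsto_zero_of_le_ae inf_le_right,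
      tendsto_zero_of_le_ae inf_le_right, tendsto_zero_of_le_ae inf_le_right, by simp⟩
  add_mem' := by
    rintro p q ⟨g, hg, hg', a, b, c, ha, hb, hc, hc', h⟩ ⟨k, hk, hk', a', b', d, ha', hb', hd, hd', h'⟩
    refine ⟨g + k, hg.add hk, ?_, a + a', b + b', c + d, tendsto_add_of_le_ae inf_le_right ha ha',
      tendsto_add_of_le_ae inf_le_right hb hb', tendsto_add_of_le_ae inf_le_right hc hd,
      tendsto_add_of_le_ae inf_le_right hc' hd', ?_⟩
    · have := hg'.add hk'
      rwa [← neg_add] at this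
    · linear_combination h + h'
  smul_mem' := by
    rintro z p ⟨g, hg, hg', a, b, c, ha, hb, hc, hc', h⟩
    refine ⟨z • g, hg.smul z, ?_, z * a, z * b, z * c, tendsto_smul_of_le_ae inf_le_right z ha,
      tendsto_smul_of_le_ae inf_le_right z hb, tendsto_smul_of_le_ae inf_le_right z hc,
      tendsto_smul_of_le_ae inf_le_right z hc', ?_⟩
    · have := hg'.smul z
      rwa [smul_neg] at this
    · linear_combination z * h

/-- The Hamiltonian `H_γ` with a `δ'` interaction of strength `γ` at the origin, as an unbounded
operator on `L²(ℝ)`. -/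
def hamiltonian (γ : ℝ) : L2 →ₗ.[ℂ] L2 := (hamiltonianGraph γ).toLinearPMap

/-- The operator `hamiltonian γ` does have the graph that it is defined by. -/
theorem graph_hamiltonian (γ : ℝ) : (hamiltonian γ).graph = hamiltonianGraph γ := by
  refine Submodule.toLinearPMap_graph_eq _ ?_
  rintro ⟨f, e⟩ ⟨g, hg, hg', -⟩ (rfl : f = 0)
  obtain rfl := hg.eq_zero
  exact neg_eq_zero.mp hg'.eq_zero

/-! ### The propagator -/

/-- `U` is the strongly continuous one-parameter unitary group `t ↦ e^{-iHt}` with infinitesimal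
generator `-iH`: the map `t ↦ U t x` has the derivative `y` at `0` exactly when `x ∈ D(H)` and
`y = -i H x`. -/
structure IsUnitaryGroupOf (H : L2 →ₗ.[ℂ] L2) (U : ℝ → L2 →L[ℂ] L2) : Prop where
  map_zero : U 0 = ContinuousLinearMap.id ℂ L2
  map_add : ∀ s t, U (s + t) = (U s).comp (U t)
  norm_map : ∀ t x, ‖U t x‖ = ‖x‖
  continuous : ∀ x, Continuous fun t => U t x
  generator : ∀ x y, HasDerivAt (fun t => U t x) y 0 ↔
    ∃ hx : x ∈ H.domain, y = -(Complex.I • H ⟨x, hx⟩)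

open scoped Classical in
/-- The unitary group `e^{-iHt}`.  By Stone's theorem it exists (and it is unique) for every
self-adjoint `H`; for the other operators the value is irrelevant. -/
def propagator (H : L2 →ₗ.[ℂ] L2) : ℝ → L2 →L[ℂ] L2 :=
  if h : ∃ U, IsUnitaryGroupOf H U then h.choose else 0

/-! ### Weak solutions -/

open scoped Classical in
/-- The function `|f|^{2μ} f` as an element of `L²(ℝ)`.  It does belong to `L²` when `f ∈ Q`, since
then `f` is bounded. -/
def nonlinearity (μ : ℝ) (f : L2) : L2 :=
  if h : MemLp (fun x => (‖f x‖ ^ (2 * μ) : ℝ) • f x) 2 (volume : Measure ℝ) then h.toLp _ else 0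

/-- The interval `[0, T)`, where `T` may be `∞`. -/
def timeInterval (T : EReal) : Set ℝ := {t | 0 ≤ t ∧ (t : EReal) < T}

/-- `ψ` is a weak solution on `[0, T)`, `0 < T ≤ ∞`: it belongs to `C⁰([0, T), Q)` and solves
`ψ(t) = e^{-iH_γ t} ψ₀ + iλ ∫₀ᵗ e^{-iH_γ (t-s)} |ψ(s)|^{2μ} ψ(s) ds` for every `t ∈ [0, T)`.
The values of `ψ` outside `[0, T)` are irrelevant. -/
structure IsWeakSolution (γ lam μ : ℝ) (ψ₀ : Q) (T : EReal) (ψ : ℝ → Q) : Prop where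
  pos : 0 < T
  continuousOn : ContinuousOn ψ (timeInterval T)
  duhamel : ∀ t ∈ timeInterval T,
    (ψ t).toL2 = propagator (hamiltonian γ) t ψ₀.toL2 +
      (Complex.I * lam) • ∫ s in (0 : ℝ)..t,
        propagator (hamiltonian γ) (t - s) (nonlinearity μ (ψ s).toL2)

/-- `ψ` is a maximal weak solution, with existence time `T`: it is a weak solution on `[0, T)`, and
no weak solution on a longer interval extends it. -/
structure IsMaximalWeakSolution (γ lam μ : ℝ) (ψ₀ : Q) (T : EReal) (ψ : ℝ → Q) : Prop where
  isWeakSolution : IsWeakSolution γ lam μ ψ₀ T ψ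
  maximal : ∀ (T' : EReal) (ψ' : ℝ → Q), IsWeakSolution γ lam μ ψ₀ T' ψ' →
    EqOn ψ' ψ (timeInterval T) → T' ≤ T

end

end DeltaPrimeNLS

open MeasureTheory Filter Topology Set
open scoped ENNReal ContDiff

namespace DeltaPrimeNLS

noncomputable section

/-! Truncate the nonlinearity, solve the truncated equation globally, and show that its conserved
quantities keep the solution below the truncation level, so that it solves the original equation.

Linear part. By the one-dimensional trace inequality, the form of `H_γ + m` is equivalent to the
norm of `Q` when `m` is large. A linear homeomorphism `S` of `Q` turns it into the inner product,
and `J = toL2 ∘ S⁻¹` then satisfies `J J* = (H_γ + m)⁻¹` on `L²`, while `J* J` is the corresponding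
operator on the energy space (`Q.mem_hamiltonianGraph_iff`, `exists_isGroupPair`). Both are bounded,
self-adjoint and injective, so functional calculus yields unitary groups, intertwined by `J`. Hence
the propagator exists and acts isometrically on `Q` with the energy norm.

Nonlinear part. For every `μ > 0` the truncated power is `C¹` with bounded, uniformly continuous
derivative (`exists_isTame`). It is Lipschitz on `L²`, but for small `μ` its derivative is only
Hölder continuous, so on `Q` it is Lipschitz only up to an error that is small when the arguments
are uniformly close (`IsTame.exists_norm_compQ_sub_le`). This suffices for the Picard iteration of
`w(t) = e^{iHt} ψ(t)`: the iterates converge in `L²` first, and therefore in `Q`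
(`IsWeaklyLipschitz.exists_solution`). Linear growth makes the solution global.

Conservation laws. The orbit `ψ` need not be differentiable in `Q` or in `L²`, but `J* J ψ` is `C¹`
in the energy space. This is the regularity `C¹([0,∞), Q*)`, and it is enough to differentiate the
potential energy (`IsPotentialOp.hasDerivAt_potential`). Mass and energy are conserved
(`IsPotentialOp.exists_evolution`).

A priori bound. With the mass fixed, `‖ψ‖_∞²` is at most a constant times `‖ψ‖_Q` up to lower order
terms, so the potential energy grows at most like `‖ψ‖_Q^μ`, against `‖ψ‖_Q²` in the kinetic part.
Since `μ < 2`, this bounds `ψ` uniformly, by a constant that does not depend on the truncation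
(`exists_sup_bound`); the truncation level is then set to it.

Uniqueness. Two weak solutions are bounded on a compact time interval, so both solve one truncated
equation there, and Gronwall's inequality in `L²` applies (`IsWeakSolution.eqOn`). The global
solution thus extends every weak solution, and a maximal one has `T = ∞`. -/

/-! ### Unitary groups generated by the inverse of a bounded self-adjoint operator -/

/-- A strongly continuous one-parameter group of linear isometries. -/
structure IsIsometricGroup {X : Type*} [NormedAddCommGroup X] [InnerProductSpace ℂ X]
    (U : ℝ → X →L[ℂ] X) : Prop where
  map_zero : U 0 = ContinuousLinearMap.id ℂ X
  map_add : ∀ s t, U (s + t) = (U s).comp (U t)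
  norm_map : ∀ t x, ‖U t x‖ = ‖x‖
  continuous : ∀ x, Continuous fun t => U t x

/-- The function `x ↦ x e^{-it/x}`. -/
def phaseMul (t x : ℝ) : ℂ := x * Complex.exp (Complex.I * (-(t / x) : ℝ))

theorem norm_phaseMul (t x : ℝ) : ‖phaseMul t x‖ = |x| := by
  rw [phaseMul, norm_mul, mul_comm Complex.I, Complex.norm_exp_ofReal_mul_I, mul_one,
    Complex.norm_real, Real.norm_eq_abs]

theorem continuous_phaseMul (t : ℝ) : Continuous (phaseMul t) := by
  rw [continuous_iff_continuousAt]
  intro x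
  rcases eq_or_ne x 0 with rfl | hx
  · have h0 : phaseMul t 0 = 0 := by simp [phaseMul]
    rw [ContinuousAt, h0]
    refine squeeze_zero_norm (a := fun x => |x|) (fun x => (norm_phaseMul t x).le) ?_
    simpa using (continuous_abs (G := ℝ)).tendsto 0
  · unfold phaseMul
    have : ContinuousAt (fun x : ℝ => -(t / x)) x := (continuousAt_const.div continuousAt_id hx).neg
    have h2 : ContinuousAt (fun x : ℝ => ((-(t / x) : ℝ) : ℂ)) x :=
      Complex.continuous_ofReal.continuousAt.comp this
    exact Complex.continuous_ofReal.continuousAt.mul (continuousAt_const.mul h2).cexp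

theorem phaseMul_mul (s t x : ℝ) : phaseMul s x * phaseMul t x = x * phaseMul (s + t) x := by
  unfold phaseMul
  rw [mul_mul_mul_comm, ← Complex.exp_add, mul_assoc]
  congr 3
  push_cast
  ring

theorem phaseMul_zero (x : ℝ) : phaseMul 0 x = x := by simp [phaseMul]

/-- The factor `x` absorbs the singular phase `t / x`, so the bound is uniform in `x`; it becomes an
operator norm bound under the functional calculus. -/
theorem norm_phaseMul_sub_le (t x : ℝ) : ‖phaseMul t x - x‖ ≤ |t| := by
  have : phaseMul t x - x = x * (Complex.exp (Complex.I * (-(t / x) : ℝ)) - 1) := by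
    unfold phaseMul; ring
  rw [this, norm_mul, Complex.norm_real]
  rcases eq_or_ne x 0 with rfl | hx
  · simp
  calc ‖x‖ * ‖Complex.exp (Complex.I * (-(t / x) : ℝ)) - 1‖ ≤ ‖x‖ * ‖-(t / x)‖ := by
        gcongr; exact Real.norm_exp_I_mul_ofReal_sub_one_le
    _ = |t| := by rw [norm_neg, norm_div, mul_div_cancel₀ _ (by simpa using hx), Real.norm_eq_abs]

/-- Taylor's formula covers `|y| ≤ 1`. For larger `y` the triangle inequality gives `2|y| ≤ 2y²`.
Large `y` must be included since `y = -t/x` is unbounded near the spectral value `0`. -/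
theorem norm_exp_I_mul_sub_one_sub_le (y : ℝ) :
    ‖Complex.exp (Complex.I * y) - 1 - Complex.I * y‖ ≤ 2 * y ^ 2 := by
  have hn : ‖Complex.I * (y : ℂ)‖ = |y| := by simp
  rcases le_or_gt |y| 1 with h | h
  · have := Complex.norm_exp_sub_one_sub_id_le (x := Complex.I * y) (by rwa [hn])
    rw [hn, sq_abs] at this
    nlinarith [sq_nonneg y]
  · have h1 : ‖Complex.exp (Complex.I * y) - 1‖ ≤ ‖y‖ := Real.norm_exp_I_mul_ofReal_sub_one_le
    have h2 := norm_sub_le (Complex.exp (Complex.I * y) - 1) (Complex.I * y)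
    rw [hn] at h2
    rw [Real.norm_eq_abs] at h1
    have : |y| ≤ y ^ 2 := by rw [← sq_abs]; nlinarith
    linarith

theorem norm_mul_phaseMul_sub_le (t x : ℝ) :
    ‖(phaseMul t x - x + Complex.I * t) * x‖ ≤ 2 * t ^ 2 := by
  rcases eq_or_ne x 0 with rfl | hx
  · simp; positivity
  have hxc : (x : ℂ) ≠ 0 := by exact_mod_cast hx
  have : (phaseMul t x - x + Complex.I * t) * x = (x : ℂ) ^ 2 *
      (Complex.exp (Complex.I * (-(t / x) : ℝ)) - 1 - Complex.I * (-(t / x) : ℝ)) := by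
    unfold phaseMul
    push_cast
    field_simp
    ring
  rw [this, norm_mul]
  calc ‖(x : ℂ) ^ 2‖ * _ ≤ ‖(x : ℂ) ^ 2‖ * (2 * (-(t / x)) ^ 2) := by
        gcongr; exact norm_exp_I_mul_sub_one_sub_le _
    _ = 2 * t ^ 2 := by
        rw [norm_pow, Complex.norm_real, Real.norm_eq_abs, sq_abs]; field_simp

section Group

variable {X : Type*} [NormedAddCommGroup X] [InnerProductSpace ℂ X] [CompleteSpace X]

/-- The operator `R e^{-itR⁻¹}`, for a bounded self-adjoint `R`. -/
def regGroup (R : X →L[ℂ] X) (t : ℝ) : X →L[ℂ] X := cfc (fun z : ℂ => phaseMul t z.re) R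

variable {R : X →L[ℂ] X}

theorem continuous_phaseMul_re (t : ℝ) : Continuous fun z : ℂ => phaseMul t z.re :=
  (continuous_phaseMul t).comp Complex.continuous_re

theorem continuous_ofReal_re : Continuous fun z : ℂ => (z.re : ℂ) :=
  Complex.continuous_ofReal.comp Complex.continuous_re

/-- The spectrum is real, so functions of the real part can be used in the complex functional
calculus. -/
theorem cfc_re_eq (hR : IsSelfAdjoint R) : cfc (fun z : ℂ => (z.re : ℂ)) R = R := by
  have : cfc (fun z : ℂ => (z.re : ℂ)) R = cfc (id : ℂ → ℂ) R :=
    cfc_congr fun z hz => (hR.mem_spectrum_eq_re hz).symm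
  rw [this, cfc_id ℂ R hR.isStarNormal]

theorem regGroup_zero (hR : IsSelfAdjoint R) : regGroup R 0 = R := by
  simp only [regGroup, phaseMul_zero, cfc_re_eq hR]

theorem regGroup_mul (hR : IsSelfAdjoint R) (s t : ℝ) :
    regGroup R s * regGroup R t = R * regGroup R (s + t) := by
  have := hR.isStarNormal
  conv_rhs => rw [← cfc_re_eq hR]
  rw [cfc_re_eq hR]
  conv_rhs => enter [1]; rw [← cfc_re_eq hR]
  unfold regGroup
  rw [← cfc_mul _ _ R (continuous_phaseMul_re s).continuousOn (continuous_phaseMul_re t).continuousOn,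
    ← cfc_mul _ _ R continuous_ofReal_re.continuousOn
      (continuous_phaseMul_re _).continuousOn]
  simp only [phaseMul_mul]

theorem regGroup_commute (hR : IsSelfAdjoint R) (t : ℝ) : R * regGroup R t = regGroup R t * R := by
  have h1 := regGroup_mul hR 0 t
  have h2 := regGroup_mul hR t 0
  rw [zero_add, regGroup_zero hR] at h1
  rw [add_zero, regGroup_zero hR] at h2
  rw [h2]

/-- Since `|x e^{-it/x}| = |x|`, the functional calculus gives `T*T = R*R` for `T = regGroup R t`.
-/
theorem norm_regGroup_apply (hR : IsSelfAdjoint R) (t : ℝ) (x : X) : ‖regGroup R t x‖ = ‖R x‖ := by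
  have hn := hR.isStarNormal
  have key : star (regGroup R t) * regGroup R t = star R * R := by
    have h1 : star R * R = cfc (fun z : ℂ => (z.re : ℂ)) R * cfc (fun z : ℂ => (z.re : ℂ)) R := by
      rw [cfc_re_eq hR, hR.star_eq]
    rw [h1, regGroup, ← cfc_star, ← cfc_mul _ _ R (continuous_phaseMul_re t).star.continuousOn
      (continuous_phaseMul_re t).continuousOn,
      ← cfc_mul _ _ R continuous_ofReal_re.continuousOn
        continuous_ofReal_re.continuousOn]
    congr 1
    funext z
    have : star (phaseMul t z.re) * phaseMul t z.re = ((‖phaseMul t z.re‖ ^ 2 : ℝ) : ℂ) := by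
      rw [Complex.star_def, mul_comm, Complex.mul_conj, Complex.normSq_eq_norm_sq]
    rw [this, norm_phaseMul, sq_abs]
    push_cast
    ring
  have h : ∀ T : X →L[ℂ] X, ((‖T x‖ ^ 2 : ℝ) : ℂ) = inner ℂ x ((star T * T) x) := by
    intro T
    rw [ContinuousLinearMap.star_eq_adjoint, mul_apply_eq_comp,
      ContinuousLinearMap.adjoint_inner_right, inner_self_eq_norm_sq_to_K]
    push_cast; rfl
  have h3 : ‖regGroup R t x‖ ^ 2 = ‖R x‖ ^ 2 := by
    have := (h (regGroup R t)).trans ((congrArg (fun T : X →L[ℂ] X => inner ℂ x (T x)) key).trans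
      (h R).symm)
    exact_mod_cast this
  exact (sq_eq_sq₀ (norm_nonneg _) (norm_nonneg _)).mp h3

theorem norm_regGroup_sub_le (hR : IsSelfAdjoint R) (t : ℝ) (x : X) :
    ‖regGroup R t x - R x‖ ≤ |t| * ‖x‖ := by
  have hn := hR.isStarNormal
  have : regGroup R t - R = cfc (fun z : ℂ => phaseMul t z.re - z.re) R := by
    rw [cfc_sub (hf := (continuous_phaseMul_re t).continuousOn)
      (hg := continuous_ofReal_re.continuousOn), cfc_re_eq hR, regGroup]
  rw [← sub_apply, this]
  refine ContinuousLinearMap.le_of_opNorm_le _ ?_ _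
  exact norm_cfc_le (abs_nonneg t) fun z _ => norm_phaseMul_sub_le t z.re

theorem norm_regGroup_sub_add_le (hR : IsSelfAdjoint R) (t : ℝ) (x : X) :
    ‖regGroup R t (R x) - R (R x) + (Complex.I * t) • R x‖ ≤ 2 * t ^ 2 * ‖x‖ := by
  have hn := hR.isStarNormal
  have hre := continuous_ofReal_re
  have h1 : Continuous fun z : ℂ => phaseMul t z.re - z.re := (continuous_phaseMul_re t).sub hre
  have h3 : Continuous fun z : ℂ => phaseMul t z.re - z.re + Complex.I * t :=
    h1.add continuous_const
  have : (regGroup R t - R + algebraMap ℂ _ (Complex.I * t)) * R =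
      cfc (fun z : ℂ => (phaseMul t z.re - z.re + Complex.I * t) * z.re) R := by
    rw [cfc_mul (hf := h3.continuousOn)
      (hg := hre.continuousOn), cfc_add_const (hf := h1.continuousOn),
      cfc_sub (hf := (continuous_phaseMul_re t).continuousOn) (hg := hre.continuousOn), cfc_re_eq hR, regGroup]
  have h2 : regGroup R t (R x) - R (R x) + (Complex.I * t) • R x =
      ((regGroup R t - R + algebraMap ℂ _ (Complex.I * t)) * R) x := by
    simp [Algebra.algebraMap_eq_smul_one]
  rw [h2, this]
  refine ContinuousLinearMap.le_of_opNorm_le _ ?_ _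
  exact norm_cfc_le (by positivity) fun z _ => norm_mul_phaseMul_sub_le t z.re

theorem denseRange_of_injective (hR : IsSelfAdjoint R) (hinj : Function.Injective R) :
    DenseRange R := by
  have h : (LinearMap.range R.toLinearMap).topologicalClosure = ⊤ := by
    rw [Submodule.topologicalClosure_eq_top_iff]
    have := ContinuousLinearMap.orthogonal_range R
    rw [this, ← ContinuousLinearMap.star_eq_adjoint, hR.star_eq]
    exact LinearMap.ker_eq_bot.mpr hinj
  have h2 := Submodule.dense_iff_topologicalClosure_eq_top.mpr h
  exact h2

/-- The unitary group `e^{-itR⁻¹}`, for an injective bounded self-adjoint `R`. -/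
def invGroup (R : X →L[ℂ] X) (t : ℝ) : X →L[ℂ] X :=
  (regGroup R t).toLinearMap.extendOfNorm R.toLinearMap

/-- The function `e^{-it/x}` is discontinuous at `0`, so it is not fed to the continuous functional
calculus. Instead `R x ↦ regGroup R t x` is isometric on the dense range of `R` and extends. -/
theorem invGroup_apply (hR : IsSelfAdjoint R) (hinj : Function.Injective R) (t : ℝ) (x : X) :
    invGroup R t (R x) = regGroup R t x :=
  LinearMap.extendOfNorm_eq (f := (regGroup R t).toLinearMap) (e := R.toLinearMap)
    (denseRange_of_injective hR hinj) ⟨1, fun x => by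
      simpa using (norm_regGroup_apply hR t x).le⟩ x

theorem norm_invGroup (hR : IsSelfAdjoint R) (hinj : Function.Injective R) (t : ℝ) (x : X) :
    ‖invGroup R t x‖ = ‖x‖ := by
  refine (denseRange_of_injective hR hinj).induction_on x
    (isClosed_eq (by fun_prop) (by fun_prop)) fun y => ?_
  rw [invGroup_apply hR hinj, norm_regGroup_apply hR]

theorem invGroup_commute (hR : IsSelfAdjoint R) (hinj : Function.Injective R) (t : ℝ) (x : X) :
    invGroup R t (R x) = R (invGroup R t x) := by
  refine (denseRange_of_injective hR hinj).induction_on x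
    (isClosed_eq (by fun_prop) (by fun_prop)) fun y => ?_
  rw [invGroup_apply hR hinj, invGroup_apply hR hinj]
  exact (DFunLike.congr_fun (regGroup_commute hR t) y).symm

/-- Each of the two factors uses up one `R`, so the identity is checked on the range of `R²`, which
is still dense. -/
theorem invGroup_add (hR : IsSelfAdjoint R) (hinj : Function.Injective R) (s t : ℝ) :
    invGroup R (s + t) = (invGroup R s).comp (invGroup R t) := by
  have hd := denseRange_of_injective hR hinj
  have hd2 : DenseRange (R ∘ R) := hd.comp hd R.continuous
  ext x
  refine hd2.induction_on x (isClosed_eq (by fun_prop) (by fun_prop)) fun y => ?_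
  simp only [Function.comp_apply, ContinuousLinearMap.comp_apply]
  rw [invGroup_apply hR hinj, invGroup_commute hR hinj t, invGroup_apply hR hinj,
    invGroup_apply hR hinj]
  have h := DFunLike.congr_fun (regGroup_mul hR s t) y
  have h2 := DFunLike.congr_fun (regGroup_commute hR (s + t)) y
  simp only [mul_apply_eq_comp] at h h2
  rw [h, h2]

theorem invGroup_zero (hR : IsSelfAdjoint R) (hinj : Function.Injective R) :
    invGroup R 0 = ContinuousLinearMap.id ℂ X := by
  ext x
  refine (denseRange_of_injective hR hinj).induction_on x
    (isClosed_eq (by fun_prop) (by fun_prop)) fun y => ?_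
  rw [invGroup_apply hR hinj, regGroup_zero hR]
  rfl

/-- The remainder is `O(t²)` when `x` lies in the range of `R`, and at most `2|t|‖x‖` for every `x`.
Approximating `x` by `R z` makes it `o(t)`: the error `x - R z` contributes at most `c/2 · |t|`, and
so does `R z`. -/
theorem hasDerivAt_invGroup_zero (hR : IsSelfAdjoint R) (hinj : Function.Injective R) (x : X) :
    HasDerivAt (fun t => invGroup R t (R x)) (-(Complex.I • x)) 0 := by
  rw [hasDerivAt_iff_isLittleO, Asymptotics.isLittleO_iff]
  intro c hc
  obtain ⟨z, hz⟩ := (Metric.denseRange_iff.mp (denseRange_of_injective hR hinj)) x (c / 4)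
    (by positivity)
  rw [dist_eq_norm] at hz
  have hev : ∀ᶠ t : ℝ in 𝓝 0, 2 * |t| * ‖z‖ < c / 2 := by
    have : Tendsto (fun t : ℝ => 2 * |t| * ‖z‖) (𝓝 0) (𝓝 0) := by
      have : Continuous fun t : ℝ => 2 * |t| * ‖z‖ := by fun_prop
      simpa using this.tendsto 0
    exact this.eventually (gt_mem_nhds (by positivity))
  filter_upwards [hev] with t ht
  simp only [sub_zero, invGroup_apply hR hinj, regGroup_zero hR]
  have e : regGroup R t x - R x - t • -(Complex.I • x) =
      ((regGroup R t (x - R z) - R (x - R z)) + (Complex.I * t) • (x - R z)) +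
        (regGroup R t (R z) - R (R z) + (Complex.I * t) • R z) := by
    have : t • -(Complex.I • x) = -((Complex.I * t) • x) := by
      rw [smul_neg, mul_comm, mul_smul]; rfl
    rw [this]
    simp only [map_sub, smul_sub]
    abel
  rw [e]
  have h1 := norm_regGroup_sub_le hR t (x - R z)
  have h2 := norm_regGroup_sub_add_le hR t z
  have h3 : ‖(Complex.I * t) • (x - R z)‖ = |t| * ‖x - R z‖ := by
    rw [norm_smul]; simp
  have h4 : |t| * ‖x - R z‖ ≤ |t| * (c / 4) := by gcongr
  have h5 : 2 * t ^ 2 * ‖z‖ ≤ c / 2 * |t| := by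
    rw [← sq_abs]; nlinarith [abs_nonneg t]
  refine (norm_add_le _ _).trans ?_
  have h6 := norm_add_le (regGroup R t (x - R z) - R (x - R z)) ((Complex.I * t) • (x - R z))
  rw [Real.norm_eq_abs]
  linarith

theorem isIsometricGroup_invGroup (hR : IsSelfAdjoint R) (hinj : Function.Injective R) :
    IsIsometricGroup (invGroup R) where
  map_zero := invGroup_zero hR hinj
  map_add := invGroup_add hR hinj
  norm_map := norm_invGroup hR hinj
  continuous x := by
    -- By isometry, continuity everywhere reduces to continuity at `0`, which is known on the dense
    -- range of `R`.
    have key : ∀ s t : ℝ, ‖invGroup R (s + t) x - invGroup R s x‖ = ‖invGroup R t x - x‖ := by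
      intro s t
      rw [invGroup_add hR hinj, ContinuousLinearMap.comp_apply, ← map_sub, norm_invGroup hR hinj]
    have h0 : Tendsto (fun t => ‖invGroup R t x - x‖) (𝓝 0) (𝓝 0) := by
      rw [Metric.tendsto_nhds]
      intro ε hε
      obtain ⟨z, hz⟩ := (Metric.denseRange_iff.mp (denseRange_of_injective hR hinj)) x (ε / 4)
        (by positivity)
      rw [dist_eq_norm] at hz
      have h1 : ContinuousAt (fun t => ‖invGroup R t (R z) - R z‖) 0 :=
        ((hasDerivAt_invGroup_zero hR hinj z).continuousAt.sub continuousAt_const).norm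
      have h2 : ∀ᶠ t in 𝓝 0, ‖invGroup R t (R z) - R z‖ < ε / 4 := by
        refine h1.eventually_lt continuousAt_const ?_
        simp [invGroup_zero hR hinj]; positivity
      filter_upwards [h2] with t ht
      rw [dist_zero_right, norm_norm]
      have e : invGroup R t x - x = invGroup R t (x - R z) + (invGroup R t (R z) - R z)
          - (x - R z) := by rw [map_sub]; abel
      rw [e]
      refine (norm_sub_le _ _).trans_lt ?_
      have := norm_add_le (invGroup R t (x - R z)) (invGroup R t (R z) - R z)
      rw [norm_invGroup hR hinj] at this
      linarith
    rw [continuous_iff_continuousAt]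
    intro s
    rw [ContinuousAt, tendsto_iff_norm_sub_tendsto_zero]
    have : Tendsto (fun t => t - s) (𝓝 s) (𝓝 0) := by
      have : Continuous fun t => t - s := by fun_prop
      simpa using this.tendsto s
    refine (h0.comp this).congr fun t => ?_
    rw [Function.comp_apply, ← key s, add_sub_cancel]

end Group

/-! ### Strongly continuous isometric groups: joint continuity and intertwining -/

namespace IsIsometricGroup

variable {X : Type*} [NormedAddCommGroup X] [InnerProductSpace ℂ X]
variable {U : ℝ → X →L[ℂ] X}

theorem neg_apply (hU : IsIsometricGroup U) (t : ℝ) (x : X) : U (-t) (U t x) = x := by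
  rw [← ContinuousLinearMap.comp_apply, ← hU.map_add, neg_add_cancel, hU.map_zero]
  rfl

theorem apply_neg (hU : IsIsometricGroup U) (t : ℝ) (x : X) : U t (U (-t) x) = x := by
  simpa using hU.neg_apply (-t) x

theorem inner_map (hU : IsIsometricGroup U) (t : ℝ) (x y : X) :
    inner ℂ (U t x) (U t y) = inner ℂ x y :=
  LinearIsometry.inner_map_map ⟨(U t).toLinearMap, hU.norm_map t⟩ x y

theorem continuous_apply (hU : IsIsometricGroup U) {α : Type*} [TopologicalSpace α] {a : α → ℝ}
    {f : α → X} (ha : Continuous a) (hf : Continuous f) : Continuous fun p => U (a p) (f p) := by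
  rw [continuous_iff_continuousAt]
  intro p
  rw [ContinuousAt, tendsto_iff_norm_sub_tendsto_zero]
  have h1 : Tendsto (fun q => ‖f q - f p‖ + ‖U (a q) (f p) - U (a p) (f p)‖) (𝓝 p) (𝓝 0) := by
    have : Continuous fun q => ‖f q - f p‖ + ‖U (a q) (f p) - U (a p) (f p)‖ := by
      have := (hU.continuous (f p)).comp ha
      simp only [Function.comp_def] at this
      exact (hf.sub continuous_const).norm.add (this.sub continuous_const).norm
    simpa using this.tendsto p
  refine squeeze_zero (fun _ => norm_nonneg _) (fun q => ?_) h1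
  calc ‖U (a q) (f q) - U (a p) (f p)‖
      = ‖U (a q) (f q - f p) + (U (a q) (f p) - U (a p) (f p))‖ := by rw [map_sub]; congr 1; abel
    _ ≤ _ := (norm_add_le _ _).trans (by rw [hU.norm_map])

theorem continuousOn_apply (hU : IsIsometricGroup U) {α : Type*} [TopologicalSpace α] {a : α → ℝ}
    {f : α → X} {s : Set α} (ha : ContinuousOn a s) (hf : ContinuousOn f s) :
    ContinuousOn (fun p => U (a p) (f p)) s := by
  have : Continuous fun p : ℝ × X => U p.1 p.2 := hU.continuous_apply continuous_fst continuous_snd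
  exact this.comp_continuousOn (ha.prodMk hf)

/-- Differentiability of an orbit at time `0` propagates to all times. -/
theorem hasDerivAt_of_zero (hU : IsIsometricGroup U) {x y : X}
    (h : HasDerivAt (fun t => U t x) y 0) (t : ℝ) : HasDerivAt (fun t => U t x) (U t y) t := by
  have h1 : HasDerivAt (fun s => U (s - t) x) y t :=
    HasDerivAt.comp_sub_const t t (f := fun t => U t x) (by simpa using h)
  have h2 := ((U t).restrictScalars ℝ).hasFDerivAt.comp_hasDerivAt t h1
  refine h2.congr_of_eventuallyEq (Eventually.of_forall fun s => ?_)
  simp only [Function.comp_apply, ContinuousLinearMap.coe_restrictScalars']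
  rw [← ContinuousLinearMap.comp_apply, ← hU.map_add, add_sub_cancel]

/-- If a bounded operator intertwines the generators on a dense set of vectors whose orbits are
differentiable, it intertwines the groups. -/
theorem intertwine {Y : Type*} [NormedAddCommGroup Y] [InnerProductSpace ℂ Y]
    {V : ℝ → Y →L[ℂ] Y} (hU : IsIsometricGroup U) (hV : IsIsometricGroup V) (J : X →L[ℂ] Y)
    {R B : X →L[ℂ] X} (hd : DenseRange R) (hRU : ∀ t x, U t (R x) = R (U t x))
    (hUd : ∀ x, HasDerivAt (fun t => U t (R x)) (B x) 0)
    (hVd : ∀ x, HasDerivAt (fun t => V t (J (R x))) (J (B x)) 0) (t : ℝ) (x : X) :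
    J (U t x) = V t (J x) := by
  refine hd.induction_on x (isClosed_eq (by fun_prop) (by fun_prop)) fun z => ?_
  -- This curve joins the two sides of the claim, so it must be shown constant. Pulling out the
  -- isometry `V (t - r)` reduces its increment to the difference of two orbits of the same vector,
  -- whose derivatives at time `0` agree.
  have hder : ∀ s, HasDerivAt (fun s => V (t - s) (J (U s (R z)))) 0 s := by
    intro s
    have e1 : HasDerivAt (fun h => J (U h (R (U s z)))) (J (B (U s z))) 0 :=
      (J.restrictScalars ℝ).hasFDerivAt.comp_hasDerivAt _ (hUd (U s z))
    have e2 := e1.sub (hVd (U s z))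
    rw [sub_self] at e2
    have e3 : HasDerivAt (fun r => J (U (r - s) (R (U s z))) - V (r - s) (J (R (U s z)))) 0 s :=
      HasDerivAt.comp_sub_const s s
        (f := fun h => J (U h (R (U s z))) - V h (J (R (U s z)))) (by simpa using! e2)
    rw [hasDerivAt_iff_isLittleO] at e3 ⊢
    refine Asymptotics.isLittleO_norm_left.mp
      ((Asymptotics.isLittleO_norm_left.mpr e3).congr_left fun r => ?_)
    have a1 : U r (R z) = U (r - s) (R (U s z)) := by
      rw [← hRU, ← ContinuousLinearMap.comp_apply (U (r - s)), ← hU.map_add, sub_add_cancel]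
    have a2 : V (t - s) (J (U s (R z))) = V (t - r) (V (r - s) (J (R (U s z)))) := by
      rw [← ContinuousLinearMap.comp_apply (V (t - r)), ← hV.map_add, sub_add_sub_cancel, hRU]
    rw [a1, a2, ← map_sub, smul_zero, sub_zero, sub_zero, hV.norm_map]
    simp [hU.map_zero, hV.map_zero]
  have := is_const_of_deriv_eq_zero (fun s => (hder s).differentiableAt) (fun s => (hder s).deriv) t 0
  simpa [hV.map_zero, hU.map_zero] using this

end IsIsometricGroup

/-! ### Groups with a shifted generator -/

section Shifted

variable {X : Type*} [NormedAddCommGroup X] [InnerProductSpace ℂ X] [CompleteSpace X]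

/-- The unitary group with generator `-i(R⁻¹ - m)`, for an injective bounded self-adjoint `R`. -/
def shiftGroup (m : ℝ) (R : X →L[ℂ] X) (t : ℝ) : X →L[ℂ] X :=
  Complex.exp (Complex.I * (m * t : ℝ)) • invGroup R t

variable {R : X →L[ℂ] X}

theorem isIsometricGroup_shiftGroup (m : ℝ) (hR : IsSelfAdjoint R) (hinj : Function.Injective R) :
    IsIsometricGroup (shiftGroup m R) where
  map_zero := by simp [shiftGroup, invGroup_zero hR hinj]
  map_add s t := by
    ext x
    simp only [shiftGroup, invGroup_add hR hinj, smul_apply, ContinuousLinearMap.comp_apply,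
      map_smul, smul_smul, ← Complex.exp_add]
    congr 2
    push_cast
    ring
  norm_map t x := by
    rw [shiftGroup, smul_apply, norm_smul, mul_comm Complex.I, Complex.norm_exp_ofReal_mul_I,
      one_mul, norm_invGroup hR hinj]
  continuous x := by
    have := (isIsometricGroup_invGroup hR hinj).continuous x
    simp only [shiftGroup, smul_apply]
    fun_prop

theorem shiftGroup_commute (m : ℝ) (hR : IsSelfAdjoint R) (hinj : Function.Injective R) (t : ℝ)
    (x : X) : shiftGroup m R t (R x) = R (shiftGroup m R t x) := by
  simp only [shiftGroup, smul_apply, invGroup_commute hR hinj, map_smul]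

theorem hasDerivAt_shiftGroup (m : ℝ) (hR : IsSelfAdjoint R) (hinj : Function.Injective R) (x : X) :
    HasDerivAt (fun t => shiftGroup m R t (R x))
      (-(Complex.I • (x - (m : ℂ) • R x))) 0 := by
  have h1 : HasDerivAt (fun t : ℝ => Complex.exp (Complex.I * (m * t : ℝ))) (Complex.I * m) 0 := by
    have : HasDerivAt (fun t : ℝ => Complex.I * ((m * t : ℝ) : ℂ)) (Complex.I * m) 0 := by
      have := ((hasDerivAt_id (0 : ℝ)).const_mul m).ofReal_comp.const_mul Complex.I
      simpa using this
    simpa using this.cexp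
  have h2 := h1.smul (hasDerivAt_invGroup_zero hR hinj x)
  refine h2.congr_deriv ?_
  simp only [mul_zero, Complex.ofReal_zero, Complex.exp_zero, invGroup_zero hR hinj, one_smul,
    ContinuousLinearMap.id_apply, smul_sub, smul_smul]
  abel

/-- The infinitesimal generator of the shifted group. -/
theorem hasDerivAt_shiftGroup_iff (m : ℝ) (hR : IsSelfAdjoint R) (hinj : Function.Injective R)
    (x y : X) : HasDerivAt (fun t => shiftGroup m R t x) y 0 ↔
      ∃ w, x = R w ∧ y = -(Complex.I • (w - (m : ℂ) • x)) := by
  constructor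
  · intro h
    -- The orbit of `R x` is differentiable for every `x`. Comparing its derivative with `R y` gives
    -- an equation that exhibits `x` itself as an element of the range of `R`.
    have h1 : HasDerivAt (fun t => R (shiftGroup m R t x)) (R y) 0 :=
      (R.restrictScalars ℝ).hasFDerivAt.comp_hasDerivAt _ h
    have h2 := hasDerivAt_shiftGroup m hR hinj x
    simp only [shiftGroup_commute m hR hinj] at h2
    have h3 := h1.unique h2
    have h4 : x = R (Complex.I • y + (m : ℂ) • x) := by
      rw [map_add, map_smul, map_smul, h3, smul_neg, smul_smul, Complex.I_mul_I]
      simp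
    refine ⟨_, h4, ?_⟩
    rw [add_sub_cancel_right, smul_smul, Complex.I_mul_I, neg_one_smul, neg_neg]
  · rintro ⟨w, rfl, rfl⟩
    exact hasDerivAt_shiftGroup m hR hinj w

end Shifted

/-! ### Primitives of locally integrable functions -/

theorem intervalIntegrable_of_locallyIntegrable {E : Type*} [NormedAddCommGroup E] {g : ℝ → E}
    (hg : LocallyIntegrable g) (a b : ℝ) : IntervalIntegrable g volume a b :=
  intervalIntegrable_iff.mpr ((hg.integrableOn_isCompact isCompact_uIcc).mono_set uIoc_subset_uIcc)

theorem locallyIntegrable_norm {E : Type*} [NormedAddCommGroup E] {g : ℝ → E}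
    (hg : LocallyIntegrable g) : LocallyIntegrable fun x => ‖g x‖ := by
  rw [locallyIntegrable_iff] at hg ⊢
  exact fun k hk => (hg k hk).norm

section Prim

variable {E F G : Type*} [NormedAddCommGroup E] [NormedSpace ℝ E]
  [NormedAddCommGroup F] [NormedSpace ℝ F]
  [NormedAddCommGroup G] [NormedSpace ℝ G]

/-- The primitive of `g` with the value `a` at `0`. -/
def prim (a : E) (g : ℝ → E) (x : ℝ) : E := a + ∫ t in (0 : ℝ)..x, g t

@[simp] theorem prim_zero (a : E) (g : ℝ → E) : prim a g 0 = a := by simp [prim]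

theorem prim_sub_prim {a : E} {g : ℝ → E} (hg : LocallyIntegrable g) (x y : ℝ) :
    prim a g x - prim a g y = ∫ t in y..x, g t := by
  rw [prim, prim, add_sub_add_left_eq_sub,
    intervalIntegral.integral_interval_sub_left 
      (intervalIntegrable_of_locallyIntegrable hg _ _) (intervalIntegrable_of_locallyIntegrable hg _ _)]

theorem continuous_prim (a : E) {g : ℝ → E} (hg : LocallyIntegrable g) : Continuous (prim a g) :=
  continuous_const.add (intervalIntegral.continuous_primitive 
    (fun _ _ => intervalIntegrable_of_locallyIntegrable hg _ _) 0)

theorem absolutelyContinuousOnInterval_of_dist_le {X Y : Type*} [PseudoMetricSpace X]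
    [PseudoMetricSpace Y] {f : ℝ → X} {h : ℝ → Y} {a b C : ℝ}
    (hh : AbsolutelyContinuousOnInterval h a b)
    (hd : ∀ x ∈ uIcc a b, ∀ y ∈ uIcc a b, dist (f x) (f y) ≤ C * dist (h x) (h y)) :
    AbsolutelyContinuousOnInterval f a b := by
  have h1 := Filter.Tendsto.const_mul C hh
  rw [mul_zero] at h1
  refine squeeze_zero' ?_ ?_ h1
  · exact Eventually.of_forall fun _ => Finset.sum_nonneg fun _ _ => dist_nonneg
  · have : ∀ᶠ e : ℕ × (ℕ → ℝ × ℝ) in AbsolutelyContinuousOnInterval.totalLengthFilter ⊓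
        𝓟 (AbsolutelyContinuousOnInterval.disjWithin a b),
        e ∈ AbsolutelyContinuousOnInterval.disjWithin a b :=
      eventually_inf_principal.mpr (by simp)
    filter_upwards [this] with e he
    rw [Finset.mul_sum]
    exact Finset.sum_le_sum fun i hi => hd _ (he.1 i hi).1 _ (he.1 i hi).2

/-- The increments are dominated by those of the scalar primitive of `‖g‖`. -/
theorem absolutelyContinuousOnInterval_prim (a : E) {g : ℝ → E} (hg : LocallyIntegrable g)
    (p q : ℝ) : AbsolutelyContinuousOnInterval (prim a g) p q := by
  have h1 : AbsolutelyContinuousOnInterval (fun x => ∫ t in p..x, ‖g t‖) p q :=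
    (intervalIntegrable_of_locallyIntegrable (locallyIntegrable_norm hg) _ _).absolutelyContinuousOnInterval_intervalIntegral left_mem_uIcc
  refine absolutelyContinuousOnInterval_of_dist_le (C := 1) h1 fun x _ y _ => ?_
  rw [one_mul, dist_eq_norm, prim_sub_prim hg, dist_eq_norm,
    intervalIntegral.integral_interval_sub_left
      (intervalIntegrable_of_locallyIntegrable (locallyIntegrable_norm hg) _ _)
      (intervalIntegrable_of_locallyIntegrable (locallyIntegrable_norm hg) _ _)]
  exact intervalIntegral.norm_integral_le_abs_integral_norm

theorem ae_hasDerivAt_prim [CompleteSpace E] (a : E) {g : ℝ → E} (hg : LocallyIntegrable g) :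
    ∀ᵐ x, HasDerivAt (prim a g) (g x) x := by
  filter_upwards [LocallyIntegrable.ae_hasDerivAt_integral hg] with x hx
  exact (hx 0).const_add a

theorem locallyIntegrable_fderiv_prim {Φ : E → F} (hΦ : ContDiff ℝ 1 Φ) (a : E) {g : ℝ → E}
    (hg : LocallyIntegrable g) : LocallyIntegrable fun x => fderiv ℝ Φ (prim a g x) (g x) := by
  have hc : Continuous fun x => fderiv ℝ Φ (prim a g x) :=
    (hΦ.continuous_fderiv one_ne_zero).comp (continuous_prim a hg)
  rw [locallyIntegrable_iff]
  intro k hk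
  obtain ⟨C, hC⟩ := (hk.image hc).isBounded.exists_norm_le
  refine Integrable.mono' (((hg.integrableOn_isCompact hk).norm).const_mul C) ?_ ?_
  · exact (ContinuousLinearMap.id ℝ (E →L[ℝ] F)).aestronglyMeasurable_comp₂
      hc.aestronglyMeasurable (hg.integrableOn_isCompact hk).aestronglyMeasurable
  · refine (ae_restrict_iff' hk.measurableSet).mpr (Eventually.of_forall fun x hx => ?_)
    exact ContinuousLinearMap.le_of_opNorm_le _ (hC _ (mem_image_of_mem _ hx)) _

/-- The chain rule for primitives of locally integrable functions. -/
theorem comp_prim [FiniteDimensional ℝ E] [CompleteSpace F] {Φ : E → F} (hΦ : ContDiff ℝ 1 Φ)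
    (a : E) {g : ℝ → E} (hg : LocallyIntegrable g) (x : ℝ) :
    Φ (prim a g x) = prim (Φ a) (fun t => fderiv ℝ Φ (prim a g t) (g t)) x := by
  have : CompleteSpace E := FiniteDimensional.complete ℝ E
  have : ProperSpace E := FiniteDimensional.proper_real E
  have hl := locallyIntegrable_fderiv_prim hΦ a hg
  set D := prim (Φ a) (fun t => fderiv ℝ Φ (prim a g t) (g t)) with hD
  have hcont := continuous_prim a hg
  obtain ⟨M, hM⟩ := (isCompact_uIcc.image hcont : IsCompact (prim a g '' uIcc 0 x)).isBounded.subset_closedBall 0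
  obtain ⟨C, hC⟩ := ((isCompact_closedBall (0 : E) M).image
    (hΦ.continuous_fderiv one_ne_zero)).isBounded.exists_norm_le
  -- `Φ` is Lipschitz on a ball that contains the compact image. The difference of the two sides is
  -- then absolutely continuous with derivative zero almost everywhere, hence constant, and it
  -- vanishes at `0`.
  have hac : AbsolutelyContinuousOnInterval (fun t => Φ (prim a g t)) 0 x := by
    refine absolutelyContinuousOnInterval_of_dist_le (C := C)
      (absolutelyContinuousOnInterval_prim a hg 0 x) fun s hs t ht => ?_
    rw [dist_eq_norm, dist_eq_norm]
    exact (convex_closedBall (0 : E) M).norm_image_sub_le_of_norm_fderiv_le (𝕜 := ℝ)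
      (fun z _ => (hΦ.differentiable one_ne_zero) z) (fun z hz => hC _ (mem_image_of_mem _ hz))
      (hM (mem_image_of_mem _ ht)) (hM (mem_image_of_mem _ hs))
  have h1 : AbsolutelyContinuousOnInterval (fun t => Φ (prim a g t) - D t) 0 x :=
    hac.sub (absolutelyContinuousOnInterval_prim _ hl 0 x)
  obtain ⟨c, hc⟩ := h1.const_of_ae_hasDerivAt_zero (by
    filter_upwards [ae_hasDerivAt_prim a hg, ae_hasDerivAt_prim (Φ a) hl] with t h1 h2 _
    have h3 := ((hΦ.differentiable one_ne_zero) (prim a g t)).hasFDerivAt.comp_hasDerivAt t h1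
    simpa using! h3.sub h2)
  have e0 := hc 0 left_mem_uIcc
  have e1 := hc x right_mem_uIcc
  simp only [hD, prim_zero, sub_self] at e0
  rw [← e0, sub_eq_zero] at e1
  exact e1

theorem locallyIntegrable_bilin_left (B : E →L[ℝ] F →L[ℝ] G) {g : ℝ → E} {v : ℝ → F}
    (hg : LocallyIntegrable g) (hv : Continuous v) : LocallyIntegrable fun x => B (g x) (v x) := by
  rw [locallyIntegrable_iff]
  intro k hk
  obtain ⟨C, hC⟩ := (hk.image hv).isBounded.exists_norm_le
  refine Integrable.mono' (((hg.integrableOn_isCompact hk).norm).const_mul (‖B‖ * C)) ?_ ?_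
  · exact B.aestronglyMeasurable_comp₂ (hg.integrableOn_isCompact hk).aestronglyMeasurable
      hv.aestronglyMeasurable
  · refine (ae_restrict_iff' hk.measurableSet).mpr (Eventually.of_forall fun x hx => ?_)
    refine (B.le_opNorm₂ _ _).trans ?_
    have := hC _ (mem_image_of_mem _ hx)
    calc ‖B‖ * ‖g x‖ * ‖v x‖ ≤ ‖B‖ * ‖g x‖ * C := by gcongr
      _ = _ := by ring

theorem locallyIntegrable_bilin_right (B : E →L[ℝ] F →L[ℝ] G) {u : ℝ → E} {h : ℝ → F}
    (hu : Continuous u) (hh : LocallyIntegrable h) : LocallyIntegrable fun x => B (u x) (h x) :=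
  locallyIntegrable_bilin_left B.flip hh hu

/-- The product rule for primitives of locally integrable functions. -/
theorem bilin_prim [FiniteDimensional ℝ E] [FiniteDimensional ℝ F] [CompleteSpace G]
    (B : E →L[ℝ] F →L[ℝ] G) (a : E) (b : F) {g : ℝ → E} {h : ℝ → F} (hg : LocallyIntegrable g)
    (hh : LocallyIntegrable h) (x : ℝ) :
    B (prim a g x) (prim b h x) =
      B a b + ∫ t in (0 : ℝ)..x, (B (prim a g t) (h t) + B (g t) (prim b h t)) := by
  -- The product rule is the chain rule for the bilinear map `B`, applied to the primitive of the
  -- pair `(g, h)`.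
  have hgh : LocallyIntegrable fun t => (g t, h t) := by
    rw [locallyIntegrable_iff] at hg hh ⊢
    exact fun k hk => (hg k hk).prodMk (hh k hk)
  have hp : ∀ t, prim (a, b) (fun t => (g t, h t)) t = (prim a g t, prim b h t) := by
    have : CompleteSpace E := FiniteDimensional.complete ℝ E
    have : CompleteSpace F := FiniteDimensional.complete ℝ F
    intro t
    have h1 := (ContinuousLinearMap.fst ℝ E F).intervalIntegral_comp_comm
      (intervalIntegrable_of_locallyIntegrable hgh 0 t)
    have h2 := (ContinuousLinearMap.snd ℝ E F).intervalIntegral_comp_comm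
      (intervalIntegrable_of_locallyIntegrable hgh 0 t)
    ext
    · simpa [prim] using h1.symm
    · simpa [prim] using h2.symm
  have := comp_prim (B.isBoundedBilinearMap.contDiff (n := 1)) (a, b) hgh x
  simp only [hp, B.isBoundedBilinearMap.fderiv] at this
  simpa [prim] using this

end Prim

/-! ### Functions with a weak derivative on `ℝ ∖ {0}` -/

/-- The lemma of du Bois-Reymond. A test function minus its integral times a fixed normalised bump
`ρ` has mean zero, so it is the derivative of a test function; the constant is `∫ ρ h`.
Order-connectedness keeps the support of that primitive inside `U`. -/
theorem ae_const_of_integral_deriv_eq_zero {U : Set ℝ} (hU : IsOpen U) (hoc : U.OrdConnected)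
    {h : ℝ → ℂ} (hh : LocallyIntegrable h)
    (H : ∀ φ : ℝ → ℝ, ContDiff ℝ ∞ φ → HasCompactSupport φ → tsupport φ ⊆ U →
      ∫ x, deriv φ x • h x = 0) : ∃ c, ∀ᵐ x, x ∈ U → h x = c := by
  rcases U.eq_empty_or_nonempty with rfl | ⟨p, hp⟩
  · exact ⟨0, by simp⟩
  obtain ⟨r, hr, hrU⟩ := Metric.nhds_basis_closedBall.mem_iff.mp (hU.mem_nhds hp)
  let b : ContDiffBump p := ⟨r / 2, r, by positivity, by linarith⟩
  set ρ := b.normed (volume : Measure ℝ) with hρ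
  have hρs : ContDiff ℝ ∞ ρ := b.contDiff_normed
  have hρc : HasCompactSupport ρ := b.hasCompactSupport_normed
  have hint : ∀ φ : ℝ → ℝ, Continuous φ → HasCompactSupport φ → Integrable fun x => φ x • h x :=
    fun φ h1 h2 => hh.integrable_smul_left_of_hasCompactSupport h1 h2
  refine ⟨∫ x, ρ x • h x, ?_⟩
  set c := ∫ x, ρ x • h x with hc
  have key : ∀ φ : ℝ → ℝ, ContDiff ℝ ∞ φ → HasCompactSupport φ → tsupport φ ⊆ U →
      ∫ x, φ x • (h x - c) = 0 := by
    intro φ hφ hφc hφU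
    set I := ∫ x, φ x with hI
    have hφi : Integrable φ := hφ.continuous.integrable_of_hasCompactSupport hφc
    let θ : ℝ → ℝ := fun x => φ x - I * ρ x
    have hθs : ContDiff ℝ ∞ θ := hφ.sub (contDiff_const.mul hρs)
    have hθ0 : ∫ x, θ x = 0 := by
      simp only [θ]
      rw [integral_sub hφi (b.integrable_normed.const_mul I), integral_const_mul, b.integral_normed]
      simp [hI]
    let K := tsupport φ ∪ Metric.closedBall p r
    have hK : IsCompact K := hφc.isCompact.union (isCompact_closedBall p r)
    have hKU : K ⊆ U := union_subset hφU hrU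
    have hKne : K.Nonempty := ⟨p, Or.inr (Metric.mem_closedBall_self hr.le)⟩
    have hθK : ∀ x, x ∉ K → θ x = 0 := by
      intro x hx
      have h1 : φ x = 0 := image_eq_zero_of_notMem_tsupport fun h => hx (Or.inl h)
      have h2 : ρ x = 0 := image_eq_zero_of_notMem_tsupport fun h => hx (Or.inr (by
        rwa [hρ, b.tsupport_normed_eq] at h))
      simp [θ, h1, h2]
    have hKlo : ∀ x ∈ K, sInf K ≤ x := fun x hx => csInf_le hK.bddBelow hx
    have hKhi : ∀ x ∈ K, x ≤ sSup K := fun x hx => le_csSup hK.bddAbove hx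
    have hIccU : Icc (sInf K) (sSup K) ⊆ U :=
      hoc.out (hKU (hK.sInf_mem hKne)) (hKU (hK.sSup_mem hKne))
    -- Starting one unit to the left puts the support of `θ` inside a half-open interval `(sInf K -
    -- 1, x]` for `x` beyond `sSup K`.
    let Θ : ℝ → ℝ := fun x => ∫ t in (sInf K - 1)..x, θ t
    have hΘd : ∀ x, HasDerivAt Θ (θ x) x := fun x =>
      hθs.continuous.integral_hasStrictDerivAt _ _ |>.hasDerivAt
    have hΘs : ContDiff ℝ ∞ Θ := by
      rw [contDiff_infty_iff_deriv]
      exact ⟨fun x => (hΘd x).differentiableAt, by rwa [funext fun x => (hΘd x).deriv]⟩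
    have hΘsupp : ∀ x, x ∉ Icc (sInf K) (sSup K) → Θ x = 0 := by
      intro x hx
      rw [mem_Icc, not_and_or, not_le, not_le] at hx
      rcases hx with hx | hx
      · refine (intervalIntegral.integral_congr (g := fun _ => 0) fun t ht => ?_).trans (by simp)
        refine hθK t fun htK => ?_
        have h1 := hKlo t htK
        have h2 : t ≤ max (sInf K - 1) x := ht.2
        have h3 : max (sInf K - 1) x < sInf K := max_lt (by linarith) hx
        linarith
      · have : Θ x = ∫ t, θ t := by
          refine intervalIntegral.integral_eq_integral_of_support_subset fun t ht => ?_
          have htK : t ∈ K := by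
            by_contra hcon
            exact ht (hθK t hcon)
          exact ⟨by linarith [hKlo t htK], by linarith [hKhi t htK]⟩
        rw [this, hθ0]
    have hΘc : HasCompactSupport Θ := HasCompactSupport.intro isCompact_Icc hΘsupp
    have hΘt : tsupport Θ ⊆ U := by
      refine (closure_minimal ?_ isClosed_Icc).trans hIccU
      intro x hx
      by_contra hcon
      exact hx (hΘsupp x hcon)
    have h1 := H Θ hΘs hΘc hΘt
    have hint2 : Integrable fun x => I • ρ x • h x := (hint ρ hρs.continuous hρc).smul I
    simp only [(hΘd _).deriv, θ, sub_smul, mul_smul] at h1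
    rw [integral_sub (hint φ hφ.continuous hφc) hint2,
      integral_smul, ← hc] at h1
    simp only [smul_sub]
    rw [integral_sub (hint φ hφ.continuous hφc) (hφi.smul_const c), integral_smul_const]
    exact h1
  have := hU.ae_eq_zero_of_integral_contDiff_smul_eq_zero
    ((hh.sub (locallyIntegrable_const c)).locallyIntegrableOn U) key
  filter_upwards [this] with x hx hxU
  exact sub_eq_zero.mp (hx hxU)

theorem L2.locallyIntegrable (f : L2) : LocallyIntegrable f :=
  (Lp.memLp f).locallyIntegrable (by norm_num)

/-- `f` is the primitive of `g` on both half-lines, with the boundary values `a` at `0+` and `b`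
at `0-`. -/
def HasPrim (f g : L2) (a b : ℂ) : Prop :=
  (∀ᵐ x : ℝ, 0 < x → f x = prim a g x) ∧ ∀ᵐ x : ℝ, x < 0 → f x = prim b g x

theorem smul_prim_sub {φ : ℝ → ℝ} (hφ : ContDiff ℝ 1 φ) (a : ℂ) {g : ℝ → ℂ}
    (hg : LocallyIntegrable g) (x y : ℝ) :
    φ x • prim a g x - φ y • prim a g y = ∫ t in y..x, (φ t • g t + deriv φ t • prim a g t) := by
  have hd : Continuous (deriv φ) := hφ.continuous_deriv_one
  have hφp : ∀ t, prim (φ 0) (deriv φ) t = φ t := by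
    intro t
    rw [prim, intervalIntegral.integral_eq_sub_of_hasDerivAt (f := φ)
      (fun s _ => ((hφ.differentiable one_ne_zero) s).hasDerivAt) (hd.intervalIntegrable _ _)]
    ring
  let B : ℝ →L[ℝ] ℂ →L[ℝ] ℂ := ContinuousLinearMap.lsmul ℝ ℝ
  have key : ∀ t, φ t • prim a g t = B (φ 0) a +
      ∫ t in (0 : ℝ)..t, (φ t • g t + deriv φ t • prim a g t) := by
    intro t
    have := bilin_prim B (φ 0) a hd.locallyIntegrable hg t
    simp only [hφp] at this
    exact this
  have hl : LocallyIntegrable fun t => φ t • g t + deriv φ t • prim a g t :=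
    (locallyIntegrable_bilin_right B hφ.continuous hg).add
      (hd.smul (continuous_prim a hg)).locallyIntegrable
  rw [key, key, add_sub_add_left_eq_sub, intervalIntegral.integral_interval_sub_left
    (intervalIntegrable_of_locallyIntegrable hl _ _) (intervalIntegrable_of_locallyIntegrable hl _ _)]

/-- Splitting the integral of a function with compact support at the origin. -/
theorem exists_integral_eq_add {k : ℝ → ℂ} (hk : Integrable k) {K : Set ℝ} (hK : IsCompact K)
    (hs : ∀ x, x ∉ K → k x = 0) : ∃ L, 0 < L ∧ (∀ x ∈ K, |x| < L) ∧
      ∫ x, k x = (∫ x in -L..0, k x) + ∫ x in (0 : ℝ)..L, k x := by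
  obtain ⟨M, hM⟩ := hK.isBounded.exists_norm_le
  have hM' : ∀ x ∈ K, |x| < max M 0 + 1 := fun x hx =>
    ((hM x hx).trans (le_max_left _ _)).trans_lt (lt_add_one _)
  refine ⟨max M 0 + 1, by positivity, hM', ?_⟩
  rw [intervalIntegral.integral_add_adjacent_intervals hk.intervalIntegrable hk.intervalIntegrable]
  refine (intervalIntegral.integral_eq_integral_of_support_subset fun x hx => ?_).symm
  have hxK : x ∈ K := by
    by_contra hcon
    exact hx (hs x hcon)
  have := abs_lt.mp (hM' x hxK)
  exact ⟨this.1, this.2.le⟩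

/-- A test function supported off the origin vanishes at `0` and at `±L`, so integration by parts on
each half-line leaves no boundary term, whatever `a` and `b` are. -/
theorem HasPrim.isWeakDeriv {f g : L2} {a b : ℂ} (h : HasPrim f g a b) : IsWeakDeriv f g := by
  intro φ hφ hc hs
  have hφ1 : ContDiff ℝ 1 φ := hφ.of_le (by simp)
  have hd : Continuous (deriv φ) := hφ1.continuous_deriv_one
  have i1 := integrable_test hd hc.deriv f
  have i2 := integrable_test hφ.continuous hc g
  have h0 : φ 0 = 0 := image_eq_zero_of_notMem_tsupport fun h => hs h rfl
  obtain ⟨L, hL, hLK, hsplit⟩ := exists_integral_eq_add (i2.add i1) hc.isCompact (fun x hx => by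
    have e1 := image_eq_zero_of_notMem_tsupport hx
    have e2 : deriv φ x = 0 := image_eq_zero_of_notMem_tsupport fun h => hx (tsupport_deriv_subset h)
    simp [e1, e2])
  have hφL : φ L = 0 := by
    by_contra hcon
    have := hLK L (subset_tsupport _ hcon)
    rw [abs_of_pos hL] at this
    exact lt_irrefl _ this
  have hφL' : φ (-L) = 0 := by
    by_contra hcon
    have := hLK (-L) (subset_tsupport _ hcon)
    rw [abs_neg, abs_of_pos hL] at this
    exact lt_irrefl _ this
  have e1 : ∫ x in (0 : ℝ)..L, ((fun x => φ x • g x) + fun x => deriv φ x • f x) x = 0 := by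
    have := smul_prim_sub hφ1 a (L2.locallyIntegrable g) L 0
    rw [hφL, h0, zero_smul, zero_smul, sub_zero] at this
    rw [this]
    refine intervalIntegral.integral_congr_ae ?_
    filter_upwards [h.1] with x hx hxL
    rw [uIoc_of_le hL.le] at hxL
    simp [hx hxL.1]
  have e2 : ∫ x in (-L)..(0 : ℝ), ((fun x => φ x • g x) + fun x => deriv φ x • f x) x = 0 := by
    have := smul_prim_sub hφ1 b (L2.locallyIntegrable g) 0 (-L)
    rw [hφL', h0, zero_smul, zero_smul, sub_zero] at this
    rw [this]
    refine intervalIntegral.integral_congr_ae ?_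
    have h3 : ∀ᵐ x : ℝ, x ≠ 0 := by simp [ae_iff]
    filter_upwards [h.2, h3] with x hx hx0 hxL
    rw [uIoc_of_le (by linarith)] at hxL
    simp [hx (lt_of_le_of_ne hxL.2 hx0)]
  rw [e1, e2, add_zero] at hsplit
  have : (∫ x, φ x • g x) + ∫ x, deriv φ x • f x = 0 := by
    rw [← integral_add i2 i1]; exact hsplit
  rw [add_comm] at this
  exact eq_neg_of_add_eq_zero_left this

theorem integral_deriv_smul_prim {φ : ℝ → ℝ} (hφ : ContDiff ℝ 1 φ) (hc : HasCompactSupport φ)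
    (a : ℂ) {g : ℝ → ℂ} (hg : LocallyIntegrable g) :
    ∫ x, deriv φ x • prim a g x = -∫ x, φ x • g x := by
  have hd : Continuous (deriv φ) := hφ.continuous_deriv_one
  have i1 : Integrable fun x => deriv φ x • prim a g x :=
    (continuous_prim a hg).locallyIntegrable.integrable_smul_left_of_hasCompactSupport hd hc.deriv
  have i2 : Integrable fun x => φ x • g x :=
    hg.integrable_smul_left_of_hasCompactSupport hφ.continuous hc
  obtain ⟨L, hL, hLK, hsplit⟩ := exists_integral_eq_add (i2.add i1) hc.isCompact (fun x hx => by
    have e1 := image_eq_zero_of_notMem_tsupport hx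
    have e2 : deriv φ x = 0 := image_eq_zero_of_notMem_tsupport fun h => hx (tsupport_deriv_subset h)
    simp [e1, e2])
  have hφL : ∀ y, |y| = L → φ y = 0 := by
    intro y hy
    by_contra hcon
    have := hLK y (subset_tsupport _ hcon)
    rw [hy] at this
    exact lt_irrefl _ this
  rw [intervalIntegral.integral_add_adjacent_intervals (i2.add i1).intervalIntegrable
    (i2.add i1).intervalIntegrable] at hsplit
  have e := smul_prim_sub hφ a hg L (-L)
  rw [hφL L (abs_of_pos hL), hφL (-L) (by rw [abs_neg, abs_of_pos hL]), zero_smul, zero_smul,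
    sub_zero] at e
  have : (∫ x, φ x • g x) + ∫ x, deriv φ x • prim a g x = 0 := by
    rw [← integral_add i2 i1]; exact hsplit.trans e.symm
  rw [add_comm] at this
  exact eq_neg_of_add_eq_zero_left this

/-- On each half-line `f - prim 0 g` has weak derivative zero, so it is constant there; the two
constants are the traces. -/
theorem IsWeakDeriv.exists_hasPrim {f g : L2} (h : IsWeakDeriv f g) : ∃ a b, HasPrim f g a b := by
  have hf := L2.locallyIntegrable f
  have hg := L2.locallyIntegrable g
  have key : ∀ U : Set ℝ, IsOpen U → U.OrdConnected → U ⊆ {0}ᶜ →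
      ∃ a, ∀ᵐ x, x ∈ U → f x = prim a g x := by
    intro U hU hoc hU0
    obtain ⟨c, hc⟩ := ae_const_of_integral_deriv_eq_zero hU hoc
      (hf.sub (continuous_prim 0 hg).locallyIntegrable) (fun φ hφ hφc hs => by
        have hφ1 : ContDiff ℝ 1 φ := hφ.of_le (by simp)
        have hd : Continuous (deriv φ) := hφ1.continuous_deriv_one
        simp only [Pi.sub_apply, smul_sub]
        rw [integral_sub (integrable_test hd hφc.deriv f)
          ((continuous_prim 0 hg).locallyIntegrable.integrable_smul_left_of_hasCompactSupport hd
            hφc.deriv), h φ hφ hφc (hs.trans hU0), integral_deriv_smul_prim hφ1 hφc 0 hg, sub_self])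
    refine ⟨c, ?_⟩
    filter_upwards [hc] with x hx hxU
    have := hx hxU
    rw [Pi.sub_apply, sub_eq_iff_eq_add] at this
    rw [this]
    simp [prim]
  obtain ⟨a, ha⟩ := key (Ioi 0) isOpen_Ioi ordConnected_Ioi (fun x hx => (ne_of_gt hx))
  obtain ⟨b, hb⟩ := key (Iio 0) isOpen_Iio ordConnected_Iio (fun x hx => (ne_of_lt hx))
  exact ⟨a, b, ha, hb⟩

/-! ### Traces -/

/-- Intervals `(0, u)` have positive measure. This is what makes essential one-sided limits unique.
-/
instance neBot_right : (𝓝[>] (0 : ℝ) ⊓ ae volume).NeBot := by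
  rw [inf_neBot_iff]
  intro s hs t ht
  obtain ⟨u, hu, hus⟩ := mem_nhdsGT_iff_exists_Ioo_subset.mp hs
  by_contra hcon
  have h1 : Ioo 0 u ⊆ tᶜ := fun x hx hxt => hcon ⟨x, hus hx, hxt⟩
  have h2 : volume (Ioo 0 u) = 0 := measure_mono_null h1 (mem_ae_iff.mp ht)
  simp only [Real.volume_Ioo, sub_zero, ENNReal.ofReal_eq_zero] at h2
  exact absurd hu (not_lt.mpr h2)

instance neBot_left : (𝓝[<] (0 : ℝ) ⊓ ae volume).NeBot := by
  rw [inf_neBot_iff]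
  intro s hs t ht
  obtain ⟨u, hu, hus⟩ := mem_nhdsLT_iff_exists_Ioo_subset.mp hs
  by_contra hcon
  have h1 : Ioo u 0 ⊆ tᶜ := fun x hx hxt => hcon ⟨x, hus hx, hxt⟩
  have h2 : volume (Ioo u 0) = 0 := measure_mono_null h1 (mem_ae_iff.mp ht)
  simp only [Real.volume_Ioo, ENNReal.ofReal_eq_zero] at h2
  have : u < 0 := hu
  linarith

theorem HasPrim.hasRightTrace {f g : L2} {a b : ℂ} (h : HasPrim f g a b) : HasRightTrace f a := by
  have h1 : Tendsto (prim a g) (𝓝 0) (𝓝 a) := by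
    have := (continuous_prim a (L2.locallyIntegrable g)).tendsto 0
    rwa [prim_zero] at this
  refine (h1.mono_left (inf_le_left.trans nhdsWithin_le_nhds)).congr' ?_
  filter_upwards [mem_inf_of_right h.1, mem_inf_of_left self_mem_nhdsWithin] with x hx hx0
  exact (hx hx0).symm

theorem HasPrim.hasLeftTrace {f g : L2} {a b : ℂ} (h : HasPrim f g a b) : HasLeftTrace f b := by
  have h1 : Tendsto (prim b g) (𝓝 0) (𝓝 b) := by
    have := (continuous_prim b (L2.locallyIntegrable g)).tendsto 0
    rwa [prim_zero] at this
  refine (h1.mono_left (inf_le_left.trans nhdsWithin_le_nhds)).congr' ?_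
  filter_upwards [mem_inf_of_right h.2, mem_inf_of_left self_mem_nhdsWithin] with x hx hx0
  exact (hx hx0).symm

theorem HasRightTrace.unique {f : L2} {a b : ℂ} (ha : HasRightTrace f a) (hb : HasRightTrace f b) :
    a = b := tendsto_nhds_unique ha hb

theorem HasLeftTrace.unique {f : L2} {a b : ℂ} (ha : HasLeftTrace f a) (hb : HasLeftTrace f b) :
    a = b := tendsto_nhds_unique ha hb

/-! ### The supremum bound -/

/-- Cauchy–Schwarz against the indicator of an interval of length `s²`, whose `L²` norm is `s`. -/
theorem integral_norm_le (f : L2) (x : ℝ) {s : ℝ} (hs : 0 < s) :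
    ∫ t in x..(x + s ^ 2), ‖f t‖ ≤ s * ‖f‖ := by
  have hm := (Lp.memLp f).norm
  let F : Lp ℝ 2 (volume : Measure ℝ) := hm.toLp _
  have hF : ‖F‖ = ‖f‖ := by rw [Lp.norm_toLp, eLpNorm_norm, Lp.norm_def]
  have hfin : volume (Ioc x (x + s ^ 2)) ≠ ⊤ := by simp
  have h1 := L2.inner_indicatorConstLp_one (𝕜 := ℝ) measurableSet_Ioc hfin F
  have h2 : ∫ t in Ioc x (x + s ^ 2), F t = ∫ t in x..(x + s ^ 2), ‖f t‖ := by
    rw [intervalIntegral.integral_of_le (by nlinarith)]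
    refine setIntegral_congr_ae measurableSet_Ioc ?_
    filter_upwards [hm.coeFn_toLp] with t ht _ using ht
  rw [← h2, ← h1]
  refine (real_inner_le_norm _ _).trans ?_
  rw [norm_indicatorConstLp (by norm_num) (by norm_num), hF]
  simp only [norm_one, one_mul, measureReal_def, Real.volume_Ioc, add_sub_cancel_left]
  rw [ENNReal.toReal_ofReal (by positivity), ENNReal.toReal_ofNat, ← Real.sqrt_eq_rpow,
    Real.sqrt_sq hs.le]

/-- Average `|p(y)| ≤ |p(t)| + ∫ |g|` over `t` in an interval of length `s²` that contains `y`. The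
free parameter `s` is what later gives the trace inequality with small constant and the
Gagliardo–Nirenberg inequality. -/
theorem norm_prim_le_aux (g : L2) (a : ℂ) (f : L2) {s : ℝ} (hs : 0 < s) (x y : ℝ)
    (hf : ∀ᵐ t, t ∈ Ioc x (x + s ^ 2) → f t = prim a g t) (hy : y ∈ Icc x (x + s ^ 2)) :
    ‖prim a g y‖ ≤ s⁻¹ * ‖f‖ + s * ‖g‖ := by
  have hg := L2.locallyIntegrable g
  have hle : x ≤ x + s ^ 2 := by nlinarith
  have hb : ∀ t ∈ Icc x (x + s ^ 2), ‖prim a g y‖ ≤ ‖prim a g t‖ + s * ‖g‖ := by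
    intro t ht
    have h1 : ‖prim a g y - prim a g t‖ ≤ s * ‖g‖ := by
      rw [prim_sub_prim hg]
      refine (intervalIntegral.norm_integral_le_integral_norm_uIoc).trans ?_
      refine le_trans ?_ (integral_norm_le g x hs)
      rw [intervalIntegral.integral_of_le hle]
      have hi := (intervalIntegrable_of_locallyIntegrable (locallyIntegrable_norm hg) x (x + s ^ 2)).1
      refine setIntegral_mono_set hi (Eventually.of_forall fun _ => norm_nonneg _) ?_
      refine Eventually.of_forall fun r hr => ?_
      have hr' : r ∈ uIoc t y := hr
      rw [uIoc, mem_Ioc] at hr'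
      exact ⟨lt_of_le_of_lt (le_min ht.1 hy.1) hr'.1, hr'.2.trans (max_le ht.2 hy.2)⟩
    have := norm_le_norm_add_norm_sub' (prim a g y) (prim a g t)
    linarith
  have hint : ∫ _ in x..(x + s ^ 2), ‖prim a g y‖ ≤
      ∫ t in x..(x + s ^ 2), (‖prim a g t‖ + s * ‖g‖) := by
    refine intervalIntegral.integral_mono_on hle (by simp) ?_ fun t ht => hb t ht
    exact ((continuous_prim a hg).norm.add continuous_const).intervalIntegrable _ _
  rw [intervalIntegral.integral_add ((continuous_prim a hg).norm.intervalIntegrable _ _)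
    (by simp)] at hint
  have h3 : ∫ t in x..(x + s ^ 2), ‖prim a g t‖ = ∫ t in x..(x + s ^ 2), ‖f t‖ := by
    refine intervalIntegral.integral_congr_ae ?_
    filter_upwards [hf] with t ht hts
    rw [uIoc_of_le hle] at hts
    rw [ht hts]
  rw [h3] at hint
  simp only [intervalIntegral.integral_const, add_sub_cancel_left, smul_eq_mul] at hint
  have h4 := integral_norm_le f x hs
  have h5 : s ^ 2 * ‖prim a g y‖ ≤ s ^ 2 * (s⁻¹ * ‖f‖ + s * ‖g‖) := by
    have : s ^ 2 * (s⁻¹ * ‖f‖ + s * ‖g‖) = s * ‖f‖ + s ^ 2 * (s * ‖g‖) := by field_simp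
    linarith
  exact le_of_mul_le_mul_left h5 (by positivity)

theorem HasPrim.norm_right_le {f g : L2} {a b : ℂ} (h : HasPrim f g a b) {s : ℝ} (hs : 0 < s)
    {x : ℝ} (hx : 0 ≤ x) : ‖prim a g x‖ ≤ s⁻¹ * ‖f‖ + s * ‖g‖ := by
  refine norm_prim_le_aux g a f hs x x ?_ ⟨le_rfl, by nlinarith⟩
  filter_upwards [h.1] with t ht htx
  exact ht (hx.trans_lt htx.1)

theorem HasPrim.norm_left_le {f g : L2} {a b : ℂ} (h : HasPrim f g a b) {s : ℝ} (hs : 0 < s)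
    {x : ℝ} (hx : x ≤ 0) : ‖prim b g x‖ ≤ s⁻¹ * ‖f‖ + s * ‖g‖ := by
  have h3 : ∀ᵐ x : ℝ, x ≠ 0 := by simp [ae_iff]
  refine norm_prim_le_aux g b f hs (x - s ^ 2) x ?_ ⟨by nlinarith, by linarith⟩
  filter_upwards [h.2, h3] with t ht ht0 htx
  exact ht (lt_of_le_of_ne (by linarith [htx.2]) ht0)

theorem HasPrim.ae_norm_le {f g : L2} {a b : ℂ} (h : HasPrim f g a b) {s : ℝ} (hs : 0 < s) :
    ∀ᵐ x, ‖f x‖ ≤ s⁻¹ * ‖f‖ + s * ‖g‖ := by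
  have h3 : ∀ᵐ x : ℝ, x ≠ 0 := by simp [ae_iff]
  filter_upwards [h.1, h.2, h3] with x h1 h2 hx
  rcases lt_or_gt_of_ne hx with hx | hx
  · rw [h2 hx]; exact h.norm_left_le hs hx.le
  · rw [h1 hx]; exact h.norm_right_le hs hx.le

/-! ### Green's identity -/

theorem integrable_conj_mul (f g : L2) : Integrable fun x => (starRingEnd ℂ) (f x) * g x := by
  have := L2.integrable_inner (𝕜 := ℂ) f g
  simpa only [RCLike.inner_apply, mul_comm] using this

theorem L2.inner_eq (f g : L2) : inner ℂ f g = ∫ x, (starRingEnd ℂ) (f x) * g x := by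
  rw [L2.inner_def]
  simp only [RCLike.inner_apply, mul_comm]

theorem conj_prim_mul_prim (a c : ℂ) (g k : L2) (x : ℝ) :
    (starRingEnd ℂ) (prim a g x) * prim c k x = (starRingEnd ℂ) a * c + ∫ t in (0 : ℝ)..x,
      ((starRingEnd ℂ) (prim a g t) * k t + (starRingEnd ℂ) (g t) * prim c k t) :=
  bilin_prim ((ContinuousLinearMap.mul ℝ ℂ).comp (Complex.conjCLE : ℂ →L[ℝ] ℂ)) a c
    (L2.locallyIntegrable g) (L2.locallyIntegrable k) x

/-- On a half-line the product of the conjugate of `f` with `h` has an integrable derivative, hence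
a limit at infinity. The product is integrable too, so this limit is `0` and only the boundary terms
at the origin survive. -/
theorem HasPrim.green {f g h k : L2} {a b c d : ℂ} (hf : HasPrim f g a b) (hh : HasPrim h k c d) :
    inner ℂ f k + inner ℂ g h = (starRingEnd ℂ) b * d - (starRingEnd ℂ) a * c := by
  have hi : Integrable fun x => (starRingEnd ℂ) (f x) * k x + (starRingEnd ℂ) (g x) * h x :=
    (integrable_conj_mul f k).add (integrable_conj_mul g h)
  have h3 : ∀ᵐ x : ℝ, x ≠ 0 := by simp [ae_iff]
  have right : ∫ x in Ioi (0 : ℝ), ((starRingEnd ℂ) (f x) * k x + (starRingEnd ℂ) (g x) * h x) =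
      -((starRingEnd ℂ) a * c) := by
    have h1 := (intervalIntegral_tendsto_integral_Ioi 0 hi.integrableOn tendsto_id).const_add
      ((starRingEnd ℂ) a * c)
    have h2 : Tendsto (fun x => (starRingEnd ℂ) (prim a g x) * prim c k x) atTop
        (𝓝 ((starRingEnd ℂ) a * c + ∫ x in Ioi (0 : ℝ), ((starRingEnd ℂ) (f x) * k x +
          (starRingEnd ℂ) (g x) * h x))) := by
      refine h1.congr' ?_
      filter_upwards [eventually_ge_atTop 0] with x hx
      rw [conj_prim_mul_prim]
      congr 1
      refine intervalIntegral.integral_congr_ae ?_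
      filter_upwards [hf.1, hh.1] with t e1 e2 ht
      rw [id, uIoc_of_le hx] at ht
      rw [e1 ht.1, e2 ht.1]
    have h4 : IntegrableAtFilter (fun x => (starRingEnd ℂ) (prim a g x) * prim c k x) atTop := by
      refine ⟨Ioi 0, Ioi_mem_atTop 0, ?_⟩
      refine ((integrable_conj_mul f h).integrableOn (s := Ioi 0)).congr_fun_ae ?_
      refine (ae_restrict_iff' measurableSet_Ioi).mpr ?_
      filter_upwards [hf.1, hh.1] with t e1 e2 ht
      rw [e1 ht, e2 ht]
    have h5 := h4.eq_zero_of_tendsto (fun s hs => by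
      obtain ⟨y, hy⟩ := mem_atTop_sets.mp hs
      exact measure_mono_top (fun x hx => hy x hx) (Real.volume_Ici (a := y))) h2
    exact eq_neg_of_add_eq_zero_right h5
  have left : ∫ x in Iic (0 : ℝ), ((starRingEnd ℂ) (f x) * k x + (starRingEnd ℂ) (g x) * h x) =
      (starRingEnd ℂ) b * d := by
    have h1 := (intervalIntegral_tendsto_integral_Iic 0 hi.integrableOn tendsto_id).const_sub
      ((starRingEnd ℂ) b * d)
    have h2 : Tendsto (fun x => (starRingEnd ℂ) (prim b g x) * prim d k x) atBot
        (𝓝 ((starRingEnd ℂ) b * d - ∫ x in Iic (0 : ℝ), ((starRingEnd ℂ) (f x) * k x +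
          (starRingEnd ℂ) (g x) * h x))) := by
      refine h1.congr' ?_
      filter_upwards [eventually_le_atBot 0] with x hx
      rw [conj_prim_mul_prim, intervalIntegral.integral_symm x 0, ← sub_eq_add_neg]
      congr 1
      refine intervalIntegral.integral_congr_ae ?_
      filter_upwards [hf.2, hh.2, h3] with t e1 e2 h3 ht
      rw [id, uIoc_of_le hx] at ht
      rw [e1 (lt_of_le_of_ne ht.2 h3), e2 (lt_of_le_of_ne ht.2 h3)]
    have h4 : IntegrableAtFilter (fun x => (starRingEnd ℂ) (prim b g x) * prim d k x) atBot := by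
      refine ⟨Iio 0, Iio_mem_atBot 0, ?_⟩
      refine ((integrable_conj_mul f h).integrableOn (s := Iio 0)).congr_fun_ae ?_
      refine (ae_restrict_iff' measurableSet_Iio).mpr ?_
      filter_upwards [hf.2, hh.2] with t e1 e2 ht
      rw [e1 ht, e2 ht]
    have h5 := h4.eq_zero_of_tendsto (fun s hs => by
      obtain ⟨y, hy⟩ := mem_atBot_sets.mp hs
      exact measure_mono_top (fun x hx => hy x hx) (Real.volume_Iic (a := y))) h2
    exact (sub_eq_zero.mp h5).symm
  rw [L2.inner_eq, L2.inner_eq, ← integral_add (integrable_conj_mul f k) (integrable_conj_mul g h),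
    ← intervalIntegral.integral_Iic_add_Ioi hi.integrableOn hi.integrableOn, left, right]
  ring

/-- A bounded, symmetric and coercive sesquilinear form is the pull-back of the inner product under
a linear homeomorphism. -/
theorem exists_equiv_inner_eq {X : Type*} [NormedAddCommGroup X] [InnerProductSpace ℂ X]
    [CompleteSpace X] (A : X →L[ℂ] X) (hA : ∀ u v, inner ℂ (A u) v = inner ℂ u (A v)) {c : ℝ}
    (hc : 0 < c) (hcA : ∀ u, c * ‖u‖ ^ 2 ≤ (inner ℂ (A u) u : ℂ).re) :
    ∃ S : X ≃L[ℂ] X, ∀ u v, inner ℂ (S u) (S v) = inner ℂ u (A v) := by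
  have hle : algebraMap ℝ (X →L[ℂ] X) c ≤ A := by
    rw [ContinuousLinearMap.le_def, ContinuousLinearMap.isPositive_def]
    have hinn : ∀ u v : X, inner ℂ ((A - algebraMap ℝ (X →L[ℂ] X) c) u) v =
        inner ℂ (A u) v - c * inner ℂ u v := by
      intro u v
      rw [sub_apply, inner_sub_left, Algebra.algebraMap_eq_smul_one, smul_apply,
        one_apply_eq_self, ← Complex.coe_smul, inner_smul_left, Complex.conj_ofReal]
    refine ⟨fun u v => ?_, fun u => ?_⟩
    · have h1 := hinn u v
      have h2 := congrArg (starRingEnd ℂ) (hinn v u)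
      rw [inner_conj_symm, map_sub, map_mul, Complex.conj_ofReal, inner_conj_symm,
        inner_conj_symm] at h2
      simp only [ContinuousLinearMap.coe_coe]
      rw [h1, h2, hA]
    · rw [ContinuousLinearMap.reApplyInnerSelf_apply, hinn, inner_self_eq_norm_sq_to_K]
      have := hcA u
      simp only [RCLike.re_to_complex, Complex.sub_re]
      have h2 : ((c : ℂ) * ((‖u‖ : ℝ) : ℂ) ^ 2).re = c * ‖u‖ ^ 2 := by
        rw [← Complex.ofReal_pow, ← Complex.ofReal_mul, Complex.ofReal_re]
      have h3 : ((c : ℂ) * ((‖u‖ : ℝ) : ℂ) ^ 2).re ≤ (inner ℂ (A u) u : ℂ).re := by rw [h2]; exact this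
      exact sub_nonneg.mpr h3
  have hnn : (0 : X →L[ℂ] X) ≤ A := by
    rw [ContinuousLinearMap.nonneg_iff_isPositive, ContinuousLinearMap.isPositive_def]
    refine ⟨fun u v => hA u v, fun u => ?_⟩
    rw [ContinuousLinearMap.reApplyInnerSelf_apply]
    exact le_trans (by positivity) (hcA u)
  -- Coercivity makes `A` invertible, so its positive square root is an invertible self-adjoint
  -- operator and serves as `S`.
  have hunit : IsUnit A := CStarAlgebra.isUnit_of_le _ hle (isStrictlyPositive_algebraMap hc)
  have hS : IsUnit (CFC.sqrt A) := (CFC.isUnit_sqrt_iff A hnn).mpr hunit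
  refine ⟨ContinuousLinearEquiv.unitsEquiv ℂ X hS.unit, fun u v => ?_⟩
  have hsa : IsSelfAdjoint (CFC.sqrt A) := IsSelfAdjoint.of_nonneg (CFC.sqrt_nonneg A)
  change inner ℂ (CFC.sqrt A u) (CFC.sqrt A v) = _
  rw [← ContinuousLinearMap.adjoint_inner_right, ← ContinuousLinearMap.star_eq_adjoint, hsa.star_eq,
    ← mul_apply_eq_comp, CFC.sqrt_mul_sqrt_self A hnn]

/-! ### Test functions as elements of `L²` -/

/-- A continuous function with compact support, as an element of `L²`. -/
def ofTest (φ : ℝ → ℝ) (hφ : Continuous φ) (hc : HasCompactSupport φ) : L2 :=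
  ((Complex.continuous_ofReal.comp hφ).memLp_of_hasCompactSupport
    (hc.comp_left Complex.ofReal_zero)).toLp _

theorem coeFn_ofTest {φ : ℝ → ℝ} (hφ : Continuous φ) (hc : HasCompactSupport φ) :
    ofTest φ hφ hc =ᵐ[volume] fun x => (φ x : ℂ) := MemLp.coeFn_toLp _

theorem inner_ofTest {φ : ℝ → ℝ} (hφ : Continuous φ) (hc : HasCompactSupport φ) (f : L2) :
    inner ℂ (ofTest φ hφ hc) f = ∫ x, φ x • f x := by
  rw [L2.inner_eq]
  refine integral_congr_ae ?_
  filter_upwards [coeFn_ofTest hφ hc] with x hx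
  rw [hx, Complex.conj_ofReal]
  rfl

theorem isWeakDeriv_iff_inner {f g : L2} : IsWeakDeriv f g ↔
    ∀ (φ : ℝ → ℝ) (hφ : ContDiff ℝ ∞ φ) (hc : HasCompactSupport φ), tsupport φ ⊆ {0}ᶜ →
      inner ℂ (ofTest (deriv φ) (hφ.continuous_deriv (by simp)) hc.deriv) f =
        -inner ℂ (ofTest φ hφ.continuous hc) g := by
  simp only [inner_ofTest]
  rfl

theorem isClosed_energySubmodule : IsClosed (energySubmodule : Set (WithLp 2 (L2 × L2))) := by
  have : (energySubmodule : Set (WithLp 2 (L2 × L2))) =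
      {p | IsWeakDeriv (WithLp.fstL 2 ℂ L2 L2 p) (WithLp.sndL 2 ℂ L2 L2 p)} := rfl
  rw [this]
  simp only [isWeakDeriv_iff_inner, Set.ofPred_forall]
  refine isClosed_iInter fun φ => isClosed_iInter fun hφ => isClosed_iInter fun hc =>
    isClosed_iInter fun _ => isClosed_eq (by fun_prop) (by fun_prop)

instance : CompleteSpace Q := isClosed_energySubmodule.completeSpace_coe

theorem hasPrim_ofTest {φ : ℝ → ℝ} (hφ : ContDiff ℝ 1 φ) (hc : HasCompactSupport φ) :
    HasPrim (ofTest φ hφ.continuous hc) (ofTest (deriv φ) hφ.continuous_deriv_one hc.deriv)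
      (φ 0) (φ 0) := by
  have hp : ∀ x, prim (φ 0 : ℂ) (ofTest (deriv φ) hφ.continuous_deriv_one hc.deriv) x = φ x := by
    intro x
    have h1 : ∫ t in (0 : ℝ)..x, ofTest (deriv φ) hφ.continuous_deriv_one hc.deriv t =
        ∫ t in (0 : ℝ)..x, ((deriv φ t : ℝ) : ℂ) := by
      refine intervalIntegral.integral_congr_ae ?_
      filter_upwards [coeFn_ofTest hφ.continuous_deriv_one hc.deriv] with t ht _ using ht
    rw [prim, h1, intervalIntegral.integral_ofReal, intervalIntegral.integral_eq_sub_of_hasDerivAt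
      (f := φ) (fun s _ => ((hφ.differentiable one_ne_zero) s).hasDerivAt)
      (hφ.continuous_deriv_one.intervalIntegrable _ _)]
    push_cast
    ring
  constructor
  · filter_upwards [coeFn_ofTest hφ.continuous hc] with x hx _
    rw [hx, hp]
  · filter_upwards [coeFn_ofTest hφ.continuous hc] with x hx _
    rw [hx, hp]

/-- The restriction of an `L²` function to `(0, ∞)`, extended by zero. -/
def restrictRight (f : L2) : L2 := ((Lp.memLp f).indicator (measurableSet_Ioi (a := (0 : ℝ)))).toLp _

theorem coeFn_restrictRight (f : L2) :
    restrictRight f =ᵐ[volume] (Ioi (0 : ℝ)).indicator f := MemLp.coeFn_toLp _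

/-- Cutting at the origin costs no regularity in `Q`. It supplies an element with a jump, so that
the two traces can be prescribed independently. -/
theorem HasPrim.restrictRight {f g : L2} {a b : ℂ} (h : HasPrim f g a b) :
    HasPrim (restrictRight f) (restrictRight g) a 0 := by
  constructor
  · filter_upwards [h.1, coeFn_restrictRight f] with x hx h2 hx0
    rw [h2, indicator_of_mem (show x ∈ Ioi (0 : ℝ) from hx0), hx hx0, prim, prim]
    congr 1
    refine intervalIntegral.integral_congr_ae ?_
    filter_upwards [coeFn_restrictRight g] with t ht hts
    rw [uIoc_of_le hx0.le] at hts
    rw [ht, indicator_of_mem (show t ∈ Ioi (0 : ℝ) from hts.1)]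
  · filter_upwards [coeFn_restrictRight f] with x h2 hx0
    rw [h2, indicator_of_notMem (by simpa using hx0.le), prim, zero_add]
    symm
    refine (intervalIntegral.integral_congr_ae (g := fun _ => 0) ?_).trans (by simp)
    filter_upwards [coeFn_restrictRight g] with t ht hts
    rw [uIoc_comm, uIoc_of_le hx0.le] at hts
    rw [ht, indicator_of_notMem (by simpa using hts.2)]

/-! ### The energy space as a Hilbert space of functions -/

namespace Q

/-- The weak derivative of an element of `Q`. -/
def der : Q →L[ℂ] L2 := (WithLp.sndL 2 ℂ L2 L2).comp energySubmodule.subtypeL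

theorem isWeakDeriv (u : Q) : IsWeakDeriv u.toL2 (der u) := u.2

/-- The element of `Q` with a given function and a given weak derivative. -/
def mk {f g : L2} (h : IsWeakDeriv f g) : Q := ⟨WithLp.toLp 2 (f, g), h⟩

@[simp] theorem toL2_mk {f g : L2} (h : IsWeakDeriv f g) : (mk h).toL2 = f := rfl

@[simp] theorem der_mk {f g : L2} (h : IsWeakDeriv f g) : der (mk h) = g := rfl

theorem norm_sq_eq (u : Q) : ‖u‖ ^ 2 = ‖u.toL2‖ ^ 2 + ‖der u‖ ^ 2 :=
  WithLp.prod_norm_sq_eq_of_L2 (u : WithLp 2 (L2 × L2))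

theorem norm_toL2_le (u : Q) : ‖u.toL2‖ ≤ ‖u‖ := by
  have := norm_sq_eq u
  nlinarith [norm_nonneg u, norm_nonneg u.toL2, sq_nonneg ‖der u‖]

theorem norm_der_le (u : Q) : ‖der u‖ ≤ ‖u‖ := by
  have := norm_sq_eq u
  nlinarith [norm_nonneg u, norm_nonneg (der u), sq_nonneg ‖u.toL2‖]

theorem toL2_injective : Function.Injective toL2 := by
  intro u v h
  have h1 := isWeakDeriv (u - v)
  rw [map_sub, h, sub_self] at h1
  have h2 := h1.eq_zero
  rw [map_sub, sub_eq_zero] at h2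
  exact Subtype.ext (WithLp.ofLp_injective 2 (Prod.ext h h2))

theorem exists_hasPrim (u : Q) : ∃ p : ℂ × ℂ, HasPrim u.toL2 (der u) p.1 p.2 := by
  obtain ⟨a, b, h⟩ := (isWeakDeriv u).exists_hasPrim
  exact ⟨(a, b), h⟩

/-- The pair of traces `(u(0+), u(0-))`. -/
def traces (u : Q) : ℂ × ℂ := (exists_hasPrim u).choose

theorem hasPrim (u : Q) : HasPrim u.toL2 (der u) (traces u).1 (traces u).2 :=
  (exists_hasPrim u).choose_spec

theorem traces_eq {u : Q} {a b : ℂ} (h : HasPrim u.toL2 (der u) a b) : traces u = (a, b) :=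
  Prod.ext ((hasPrim u).hasRightTrace.unique h.hasRightTrace)
    ((hasPrim u).hasLeftTrace.unique h.hasLeftTrace)

theorem norm_sup_le (u : Q) {s : ℝ} (hs : 0 < s) :
    s⁻¹ * ‖u.toL2‖ + s * ‖der u‖ ≤ s⁻¹ * ‖u.toL2‖ + s * ‖u‖ := by
  gcongr
  exact norm_der_le u

theorem norm_traces_le (u : Q) {s : ℝ} (hs : 0 < s) :
    ‖(traces u).1‖ ≤ s⁻¹ * ‖u.toL2‖ + s * ‖u‖ ∧ ‖(traces u).2‖ ≤ s⁻¹ * ‖u.toL2‖ + s * ‖u‖ := by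
  have h1 := (hasPrim u).norm_right_le hs le_rfl
  have h2 := (hasPrim u).norm_left_le hs le_rfl
  rw [prim_zero] at h1 h2
  exact ⟨h1.trans (norm_sup_le u hs), h2.trans (norm_sup_le u hs)⟩

/-- The jump `u(0+) - u(0-)` at the origin. -/
def jump : Q →L[ℂ] ℂ :=
  LinearMap.mkContinuous
    { toFun := fun u => (traces u).1 - (traces u).2
      map_add' := fun u v => by
        have h1 : (traces (u + v)).1 = (traces u).1 + (traces v).1 :=
          (hasPrim (u + v)).hasRightTrace.unique <| by
            rw [map_add]
            exact tendsto_add_of_le_ae inf_le_right (hasPrim u).hasRightTrace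
              (hasPrim v).hasRightTrace
        have h2 : (traces (u + v)).2 = (traces u).2 + (traces v).2 :=
          (hasPrim (u + v)).hasLeftTrace.unique <| by
            rw [map_add]
            exact tendsto_add_of_le_ae inf_le_right (hasPrim u).hasLeftTrace
              (hasPrim v).hasLeftTrace
        rw [h1, h2]
        ring
      map_smul' := fun c u => by
        have h1 : (traces (c • u)).1 = c * (traces u).1 :=
          (hasPrim (c • u)).hasRightTrace.unique <| by
            rw [map_smul]
            exact tendsto_smul_of_le_ae inf_le_right c (hasPrim u).hasRightTrace
        have h2 : (traces (c • u)).2 = c * (traces u).2 :=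
          (hasPrim (c • u)).hasLeftTrace.unique <| by
            rw [map_smul]
            exact tendsto_smul_of_le_ae inf_le_right c (hasPrim u).hasLeftTrace
        rw [h1, h2, RingHom.id_apply, smul_eq_mul]
        ring } 4
    (fun u => by
      obtain ⟨h1, h2⟩ := norm_traces_le u one_pos
      have h3 := norm_sub_le (traces u).1 (traces u).2
      have h4 := norm_toL2_le u
      rw [inv_one, one_mul, one_mul] at h1 h2
      change ‖(traces u).1 - (traces u).2‖ ≤ _
      linarith)

theorem jump_apply (u : Q) : jump u = (traces u).1 - (traces u).2 := rfl

theorem norm_jump_le (u : Q) {s : ℝ} (hs : 0 < s) :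
    ‖jump u‖ ≤ 2 * (s⁻¹ * ‖u.toL2‖ + s * ‖u‖) := by
  obtain ⟨h1, h2⟩ := norm_traces_le u hs
  have h3 := norm_sub_le (traces u).1 (traces u).2
  rw [jump_apply]
  linarith

/-- The quadratic form of the Hamiltonian, shifted by `m`. -/
def form (γ m : ℝ) (u v : Q) : ℂ :=
  inner ℂ (der u) (der v) + m * inner ℂ u.toL2 v.toL2 -
    (γ⁻¹ : ℝ) * ((starRingEnd ℂ) (jump u) * jump v)

theorem form_self (γ m : ℝ) (u : Q) :
    form γ m u u = ((‖der u‖ ^ 2 + m * ‖u.toL2‖ ^ 2 - γ⁻¹ * ‖jump u‖ ^ 2 : ℝ) : ℂ) := by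
  rw [form, inner_self_eq_norm_sq_to_K, inner_self_eq_norm_sq_to_K, mul_comm _ (jump u),
    Complex.mul_conj, Complex.normSq_eq_norm_sq]
  push_cast
  rfl

theorem conj_form (γ m : ℝ) (u v : Q) : (starRingEnd ℂ) (form γ m u v) = form γ m v u := by
  simp only [form, map_sub, map_add, map_mul, inner_conj_symm, Complex.conj_ofReal,
    Complex.conj_conj]
  ring

theorem inv_mul_norm_jump_sq_le {γ : ℝ} (hγ : 0 < γ) (u : Q) :
    γ⁻¹ * ‖jump u‖ ^ 2 ≤ 128 * γ⁻¹ ^ 2 * ‖u.toL2‖ ^ 2 + 1 / 2 * ‖u‖ ^ 2 := by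
  -- The bound on the jump carries the factor `8 s² / γ` in front of `‖u‖²`; the choice `s² = γ /
  -- 16` makes it `1 / 2`.
  have hs : 0 < Real.sqrt (γ / 16) := Real.sqrt_pos.mpr (by positivity)
  have h := norm_jump_le u hs
  set s := Real.sqrt (γ / 16) with hsdef
  have hss : s ^ 2 = γ / 16 := Real.sq_sqrt (by positivity)
  have h2 : ‖jump u‖ ^ 2 ≤ 8 * ((s⁻¹ * ‖u.toL2‖) ^ 2 + (s * ‖u‖) ^ 2) := by
    have h3 : ‖jump u‖ ^ 2 ≤ (2 * (s⁻¹ * ‖u.toL2‖ + s * ‖u‖)) ^ 2 :=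
      pow_le_pow_left₀ (norm_nonneg _) h 2
    nlinarith [sq_nonneg (s⁻¹ * ‖u.toL2‖ - s * ‖u‖)]
  rw [mul_pow, mul_pow, inv_pow, hss] at h2
  calc γ⁻¹ * ‖jump u‖ ^ 2 ≤ γ⁻¹ * (8 * ((γ / 16)⁻¹ * ‖u.toL2‖ ^ 2 + γ / 16 * ‖u‖ ^ 2)) := by gcongr
    _ = _ := by field_simp; ring

/-- The shift that makes the quadratic form coercive. -/
def shift (γ : ℝ) : ℝ := 1 + 128 * γ⁻¹ ^ 2

theorem form_coercive {γ : ℝ} (hγ : 0 < γ) (u : Q) :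
    1 / 2 * ‖u‖ ^ 2 ≤ (form γ (shift γ) u u).re := by
  rw [form_self, Complex.ofReal_re, shift]
  have := inv_mul_norm_jump_sq_le hγ u
  have h2 := norm_sq_eq u
  nlinarith

/-- The energy inner product is transported to the given one by `S`, so no second norm on `Q` is
needed. -/
theorem exists_energyEquiv {γ : ℝ} (hγ : 0 < γ) :
    ∃ S : Q ≃L[ℂ] Q, ∀ u v, inner ℂ (S u) (S v) = form γ (shift γ) u v := by
  let A : Q →L[ℂ] Q := (ContinuousLinearMap.adjoint der).comp der +
    (ContinuousLinearMap.adjoint toL2).comp (((shift γ : ℝ) : ℂ) • toL2) -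
    (ContinuousLinearMap.adjoint jump).comp (((γ⁻¹ : ℝ) : ℂ) • jump)
  have hA : ∀ u v, inner ℂ u (A v) = form γ (shift γ) u v := by
    intro u v
    simp only [A, sub_apply, add_apply, smul_apply, ContinuousLinearMap.comp_apply, inner_sub_right,
      inner_add_right, inner_smul_right, ContinuousLinearMap.adjoint_inner_right, form,
      RCLike.inner_apply]
    ring
  have hA' : ∀ u v, inner ℂ (A u) v = form γ (shift γ) u v := by
    intro u v
    refine (inner_conj_symm (A u) v).symm.trans ?_
    rw [hA, conj_form]
  obtain ⟨S, hS⟩ := exists_equiv_inner_eq A (fun u v => by rw [hA, hA']) (c := 1 / 2) (by norm_num)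
    (fun u => by rw [hA']; exact form_coercive hγ u)
  exact ⟨S, fun u v => by rw [hS, hA]⟩

theorem green {g k : L2} {c d : ℂ} (h : HasPrim g k c d) (v : Q) :
    inner ℂ g (der v) + inner ℂ k v.toL2 =
      (starRingEnd ℂ) d * (traces v).2 - (starRingEnd ℂ) c * (traces v).1 := h.green (hasPrim v)

/-- A smooth function with compact support, as an element of `Q`. -/
def ofTest {φ : ℝ → ℝ} (hφ : ContDiff ℝ 1 φ) (hc : HasCompactSupport φ) : Q :=
  mk (hasPrim_ofTest hφ hc).isWeakDeriv

theorem jump_ofTest {φ : ℝ → ℝ} (hφ : ContDiff ℝ 1 φ) (hc : HasCompactSupport φ) :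
    jump (ofTest hφ hc) = 0 := by
  rw [jump_apply, traces_eq (hasPrim_ofTest hφ hc), sub_self]

theorem exists_traces_eq : (∃ v : Q, traces v = (1, 1)) ∧ ∃ v : Q, traces v = (1, 0) := by
  let b : ContDiffBump (0 : ℝ) := ⟨1, 2, one_pos, one_lt_two⟩
  have hb : ContDiff ℝ 1 b := b.contDiff
  have h := hasPrim_ofTest hb b.hasCompactSupport
  have h1 : ((b 0 : ℝ) : ℂ) = 1 := by rw [b.one_of_mem_closedBall (Metric.mem_closedBall_self b.rIn_pos.le)]; simp
  rw [h1] at h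
  exact ⟨⟨mk h.isWeakDeriv, traces_eq h⟩,
    ⟨mk h.restrictRight.isWeakDeriv, traces_eq h.restrictRight⟩⟩

/-- The graph of the Hamiltonian in terms of its quadratic form. -/
theorem mem_hamiltonianGraph_iff {γ : ℝ} (hγ : 0 < γ) (m : ℝ) (f e : L2) :
    (f, e) ∈ hamiltonianGraph γ ↔
      ∃ u : Q, u.toL2 = f ∧ ∀ v, form γ m u v = inner ℂ (e + (m : ℂ) • f) v.toL2 := by
  have hγc : (γ : ℂ) ≠ 0 := by exact_mod_cast hγ.ne'
  constructor
  · rintro ⟨g, hg, hg', a, b, c, ha, hb, hc, hc', h⟩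
    refine ⟨mk hg, rfl, fun v => ?_⟩
    obtain ⟨c₁, c₂, hp⟩ := hg'.exists_hasPrim
    obtain rfl := hp.hasRightTrace.unique hc
    obtain rfl := hp.hasLeftTrace.unique hc'
    have hj : jump (mk hg) = -(γ : ℂ) * c₂ := by
      rw [jump_apply, ← h, (hasPrim (mk hg)).hasRightTrace.unique ha,
        (hasPrim (mk hg)).hasLeftTrace.unique hb]
    have hgr := green hp v
    simp only [inner_neg_left] at hgr
    rw [form, hj, der_mk, toL2_mk, inner_add_left, inner_smul_left, Complex.conj_ofReal, jump_apply]
    simp only [map_mul, map_neg, Complex.conj_ofReal]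
    push_cast
    field_simp
    linear_combination hgr
  · rintro ⟨u, rfl, hu⟩
    have hu' : ∀ v, inner ℂ (der u) (der v) -
        (γ⁻¹ : ℝ) * ((starRingEnd ℂ) (jump u) * jump v) = inner ℂ e v.toL2 := by
      intro v
      have := hu v
      rw [form, inner_add_left, inner_smul_left, Complex.conj_ofReal] at this
      linear_combination this
    -- Test functions have no jump, so testing with them gives the equation off the origin. The
    -- boundary conditions are then read off from elements of `Q` that do not vanish at the origin.
    have hw : IsWeakDeriv (der u) (-e) := by
      rw [isWeakDeriv_iff_inner]
      intro φ hφ hc hs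
      have h1 := congrArg (starRingEnd ℂ) (hu' (ofTest (hφ.of_le (by simp)) hc))
      rw [jump_ofTest, mul_zero, mul_zero, sub_zero, inner_conj_symm, inner_conj_symm] at h1
      rw [inner_neg_right, neg_neg]
      exact h1
    obtain ⟨c, d, hp⟩ := hw.exists_hasPrim
    have key : ∀ v : Q, (starRingEnd ℂ) d * (traces v).2 - (starRingEnd ℂ) c * (traces v).1 =
        (γ⁻¹ : ℝ) * ((starRingEnd ℂ) (jump u) * ((traces v).1 - (traces v).2)) := by
      intro v
      have h1 := green hp v
      have h2 := hu' v
      rw [inner_neg_left] at h1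
      rw [jump_apply v] at h2
      linear_combination h2 - h1
    -- Traces `(1, 1)` give the continuity of the derivative, traces `(1, 0)` the jump condition.
    obtain ⟨⟨v₁, hv₁⟩, ⟨v₂, hv₂⟩⟩ := exists_traces_eq
    have k1 := key v₁
    have k2 := key v₂
    rw [hv₁] at k1
    rw [hv₂] at k2
    simp only [mul_one, sub_self, mul_zero, sub_zero, zero_sub] at k1 k2
    have hdc : d = c := by
      have := congrArg (starRingEnd ℂ) (sub_eq_zero.mp k1)
      simpa using this
    have hcj : -c = (γ⁻¹ : ℝ) * jump u := by
      have := congrArg (starRingEnd ℂ) k2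
      simpa using this
    subst hdc
    refine ⟨der u, isWeakDeriv u, hw, _, _, d, (hasPrim u).hasRightTrace,
      (hasPrim u).hasLeftTrace, hp.hasRightTrace, hp.hasLeftTrace, ?_⟩
    rw [← jump_apply, neg_mul, ← mul_neg, hcj]
    push_cast
    field_simp

/-- Density of `Q` in `L²`: orthogonality to the test functions says that `h` is a weak derivative
of `0`. -/
theorem eq_zero_of_inner_toL2_eq_zero {h : L2} (H : ∀ v : Q, inner ℂ h v.toL2 = 0) : h = 0 := by
  refine IsWeakDeriv.eq_zero (isWeakDeriv_iff_inner.mpr fun φ hφ hc _ => ?_)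
  have := congrArg (starRingEnd ℂ) (H (ofTest (hφ.of_le (by simp)) hc))
  rw [inner_conj_symm, map_zero] at this
  rw [inner_zero_right, zero_eq_neg]
  exact this

end Q

/-! ### The operators `J* J` and `J J*` and their groups -/

section Pair

variable {X Y : Type*} [NormedAddCommGroup X] [InnerProductSpace ℂ X] [CompleteSpace X]
  [NormedAddCommGroup Y] [InnerProductSpace ℂ Y] [CompleteSpace Y]

/-- The operator `J* J`. -/
def gram (J : X →L[ℂ] Y) : X →L[ℂ] X := (ContinuousLinearMap.adjoint J).comp J

/-- The operator `J J*`. -/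
def cogram (J : X →L[ℂ] Y) : Y →L[ℂ] Y := J.comp (ContinuousLinearMap.adjoint J)

theorem inner_gram_left (J : X →L[ℂ] Y) (x y : X) :
    inner ℂ (gram J x) y = inner ℂ (J x) (J y) := ContinuousLinearMap.adjoint_inner_left J y (J x)

theorem inner_gram_right (J : X →L[ℂ] Y) (x y : X) :
    inner ℂ x (gram J y) = inner ℂ (J x) (J y) := ContinuousLinearMap.adjoint_inner_right J x (J y)

theorem isSelfAdjoint_gram (J : X →L[ℂ] Y) : IsSelfAdjoint (gram J) := by
  rw [ContinuousLinearMap.isSelfAdjoint_iff_isSymmetric]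
  intro x y
  exact (inner_gram_left J x y).trans (inner_gram_right J x y).symm

theorem isSelfAdjoint_cogram (J : X →L[ℂ] Y) : IsSelfAdjoint (cogram J) := by
  rw [ContinuousLinearMap.isSelfAdjoint_iff_isSymmetric]
  intro x y
  change inner ℂ (J (ContinuousLinearMap.adjoint J x)) y =
    inner ℂ x (J (ContinuousLinearMap.adjoint J y))
  rw [← ContinuousLinearMap.adjoint_inner_right, ContinuousLinearMap.adjoint_inner_left]

theorem gram_injective {J : X →L[ℂ] Y} (hJ : Function.Injective J) :
    Function.Injective (gram J) := by
  rw [injective_iff_map_eq_zero] at hJ ⊢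
  intro x hx
  apply hJ
  rw [← inner_self_eq_zero (𝕜 := ℂ), ← inner_gram_left, hx, inner_zero_left]

theorem cogram_injective {J : X →L[ℂ] Y} (hJ : ∀ y, (∀ x, inner ℂ y (J x) = 0) → y = 0) :
    Function.Injective (cogram J) := by
  rw [injective_iff_map_eq_zero]
  intro y hy
  have h0 : ContinuousLinearMap.adjoint J y = 0 := by
    rw [← inner_self_eq_zero (𝕜 := ℂ), ContinuousLinearMap.adjoint_inner_left]
    change inner ℂ y (cogram J y) = 0
    rw [hy, inner_zero_right]
  refine hJ y fun x => ?_
  rw [← ContinuousLinearMap.adjoint_inner_left, h0, inner_zero_left]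

/-- An isometric group `U` on `X` with generator `-i((J*J)⁻¹ - m)` that a bounded operator
`J : X → Y` intertwines with an isometric group on `Y`. -/
structure IsGroupPair (m : ℝ) (J : X →L[ℂ] Y) (U : ℝ → X →L[ℂ] X) (V : ℝ → Y →L[ℂ] Y) : Prop where
  group : IsIsometricGroup U
  group' : IsIsometricGroup V
  intertwine : ∀ t x, J (U t x) = V t (J x)
  commute : ∀ t x, U t (gram J x) = gram J (U t x)
  hasDerivAt_zero : ∀ x, HasDerivAt (fun t => U t (gram J x))
    (-(Complex.I • (x - (m : ℂ) • gram J x))) 0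

/-- Since `J (J* J) = (J J*) J`, the operator `J` carries one generator to the other. Of `V` only
the derivatives on the range of `J J*` are used, so `V` may be any group with that generator, in
particular one obtained by choice. -/
theorem isGroupPair_shiftGroup (m : ℝ) {J : X →L[ℂ] Y} (hJ : Function.Injective J)
    {V : ℝ → Y →L[ℂ] Y} (hV : IsIsometricGroup V)
    (hVd : ∀ y, HasDerivAt (fun t => V t (cogram J y))
      (-(Complex.I • (y - (m : ℂ) • cogram J y))) 0) :
    IsGroupPair m J (shiftGroup m (gram J)) V := by
  have hsa := isSelfAdjoint_gram J
  have hinj := gram_injective hJ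
  have hg := isIsometricGroup_shiftGroup m hsa hinj
  refine ⟨hg, hV, ?_, shiftGroup_commute m hsa hinj, hasDerivAt_shiftGroup m hsa hinj⟩
  let B : X →L[ℂ] X := -(Complex.I • (ContinuousLinearMap.id ℂ X - (m : ℂ) • gram J))
  refine hg.intertwine hV J (R := gram J) (B := B) (denseRange_of_injective hsa hinj)
    (shiftGroup_commute m hsa hinj) (hasDerivAt_shiftGroup m hsa hinj) fun x => ?_
  have e : J (B x) = -(Complex.I • (J x - (m : ℂ) • cogram J (J x))) := by
    change J (-(Complex.I • (x - (m : ℂ) • gram J x))) = _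
    rw [map_neg, map_smul, map_sub, map_smul]
    rfl
  rw [e]
  exact hVd (J x)

end Pair

/-- The energy space with the energy inner product: an isomorphic copy of `Q` on which the
propagator acts isometrically. -/
theorem exists_isGroupPair {γ : ℝ} (hγ : 0 < γ) : ∃ (S : Q ≃L[ℂ] Q) (J : Q →L[ℂ] L2)
    (U : ℝ → Q →L[ℂ] Q), (∀ u, J (S u) = u.toL2) ∧
      (∀ u v, inner ℂ (S u) (S v) = Q.form γ (Q.shift γ) u v) ∧
      IsGroupPair (Q.shift γ) J U (propagator (hamiltonian γ)) := by
  obtain ⟨S, hS⟩ := Q.exists_energyEquiv hγ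
  set m := Q.shift γ
  let J : Q →L[ℂ] L2 := Q.toL2.comp (S.symm : Q →L[ℂ] Q)
  have hJS : ∀ u, J (S u) = u.toL2 := fun u => congrArg Q.toL2 (S.symm_apply_apply u)
  have hJ : Function.Injective J := Q.toL2_injective.comp S.symm.injective
  have hsa := isSelfAdjoint_cogram J
  have hinj : Function.Injective (cogram J) := cogram_injective fun y hy =>
    Q.eq_zero_of_inner_toL2_eq_zero fun v => by rw [← hJS]; exact hy (S v)
  -- By the Riesz representation in the energy inner product, `J J* h` is the weak solution `f` of
  -- `(H_γ + m) f = h`.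
  have hcogram : ∀ f h : L2, f = cogram J h ↔
      ∃ u : Q, u.toL2 = f ∧ ∀ v, Q.form γ m u v = inner ℂ h v.toL2 := by
    intro f h
    constructor
    · rintro rfl
      refine ⟨S.symm (ContinuousLinearMap.adjoint J h), rfl, fun v => ?_⟩
      rw [← hS, S.apply_symm_apply, ContinuousLinearMap.adjoint_inner_left, hJS]
    · rintro ⟨u, rfl, hu⟩
      have : S u = ContinuousLinearMap.adjoint J h := by
        refine ext_inner_right ℂ fun v => ?_
        obtain ⟨w, rfl⟩ := S.surjective v
        rw [hS, hu, ContinuousLinearMap.adjoint_inner_left, hJS]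
      rw [← hJS, this]
      rfl
  have hgraph : ∀ f e : L2, (f, e) ∈ (hamiltonian γ).graph ↔ f = cogram J (e + (m : ℂ) • f) := by
    intro f e
    rw [graph_hamiltonian, Q.mem_hamiltonianGraph_iff hγ m, hcogram]
  have hgen : ∀ x y : L2, HasDerivAt (fun t => shiftGroup m (cogram J) t x) y 0 ↔
      ∃ hx : x ∈ (hamiltonian γ).domain, y = -(Complex.I • (hamiltonian γ) ⟨x, hx⟩) := by
    intro x y
    refine Iff.trans (hasDerivAt_shiftGroup_iff m hsa hinj x y) ?_
    constructor
    · rintro ⟨w, hw, rfl⟩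
      have h1 : (x, w - (m : ℂ) • x) ∈ (hamiltonian γ).graph := by
        rw [hgraph, sub_add_cancel]; exact hw
      obtain ⟨z, hz1, hz2⟩ := (LinearPMap.mem_graph_iff _).mp h1
      simp only at hz1 hz2
      subst hz1
      exact ⟨z.2, by rw [← hz2]⟩
    · rintro ⟨hx, rfl⟩
      have h1 : (x, (hamiltonian γ) ⟨x, hx⟩) ∈ (hamiltonian γ).graph :=
        LinearPMap.mem_graph (hamiltonian γ) ⟨x, hx⟩
      exact ⟨_, (hgraph _ _).mp h1, by rw [add_sub_cancel_right]⟩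
  -- This selects the meaningful branch in the definition of `propagator`. The chosen group need not
  -- be identified with the constructed one, because the two have the same generator.
  have hex : ∃ U, IsUnitaryGroupOf (hamiltonian γ) U := by
    have := isIsometricGroup_shiftGroup m hsa hinj
    exact ⟨shiftGroup m (cogram J), this.map_zero, this.map_add, this.norm_map, this.continuous, hgen⟩
  have hprop : IsUnitaryGroupOf (hamiltonian γ) (propagator (hamiltonian γ)) := by
    rw [propagator, dif_pos hex]
    exact hex.choose_spec
  refine ⟨S, J, shiftGroup m (gram J), hJS, hS, isGroupPair_shiftGroup m hJ
    ⟨hprop.map_zero, hprop.map_add, hprop.norm_map, hprop.continuous⟩ fun y => ?_⟩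
  refine (hprop.generator _ _).mpr ?_
  exact (hgen _ _).mp (hasDerivAt_shiftGroup m hsa hinj y)

/-! ### Superposition operators -/

/-- A gauge invariant nonlinearity `N` of class `C¹` with bounded and uniformly continuous
derivative, which is the gradient of the potential `G`. -/
structure IsTame (N : ℂ → ℂ) (G : ℂ → ℝ) (L : NNReal) : Prop where
  contDiff : ContDiff ℝ 1 N
  norm_fderiv_le : ∀ z, ‖fderiv ℝ N z‖ ≤ L
  uniformContinuous_fderiv : UniformContinuous (fderiv ℝ N)
  gauge : ∀ z, ∃ k : ℝ, N z = k * z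
  potential_zero : G 0 = 0
  hasFDerivAt_potential : ∀ z, HasFDerivAt G (innerSL ℝ (N z)) z

namespace IsTame

variable {N : ℂ → ℂ} {G : ℂ → ℝ} {L : NNReal}

theorem map_zero (h : IsTame N G L) : N 0 = 0 := by
  obtain ⟨k, hk⟩ := h.gauge 0
  rw [hk, mul_zero]

theorem lipschitz (h : IsTame N G L) : LipschitzWith L N :=
  lipschitzWith_of_nnnorm_fderiv_le (h.contDiff.differentiable one_ne_zero) h.norm_fderiv_le

/-- Mean value inequality for `G - ⟨N z, ·⟩` on the ball around `z` through `w`, where the gradient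
`N - N z` is at most `L ‖w - z‖`. -/
theorem abs_potential_sub_le (h : IsTame N G L) (z w : ℂ) :
    |G w - G z - inner ℝ (N z) (w - z)| ≤ L * ‖w - z‖ ^ 2 := by
  have hd : ∀ y ∈ Metric.closedBall z ‖w - z‖, HasFDerivWithinAt
      (fun y => G y - innerSL ℝ (N z) y) (innerSL ℝ (N y) - innerSL ℝ (N z))
      (Metric.closedBall z ‖w - z‖) y := fun y _ =>
    ((h.hasFDerivAt_potential y).sub (innerSL ℝ (N z)).hasFDerivAt).hasFDerivWithinAt
  have hb : ∀ y ∈ Metric.closedBall z ‖w - z‖,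
      ‖innerSL ℝ (N y) - innerSL ℝ (N z)‖ ≤ L * ‖w - z‖ := by
    intro y hy
    rw [← map_sub, innerSL_apply_norm]
    refine (h.lipschitz.norm_sub_le y z).trans ?_
    gcongr
    rwa [mem_closedBall_iff_norm] at hy
  have := (convex_closedBall z ‖w - z‖).norm_image_sub_le_of_norm_hasFDerivWithin_le hd hb
    (Metric.mem_closedBall_self (norm_nonneg _)) (mem_closedBall_iff_norm.mpr le_rfl)
  rw [Real.norm_eq_abs] at this
  refine le_trans (le_of_eq ?_) (this.trans (le_of_eq (by ring)))
  congr 1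
  simp only [innerSL_apply_apply, inner_sub_right]
  ring

/-- The superposition operator on `L²`. -/
def comp (h : IsTame N G L) (f : L2) : L2 := h.lipschitz.compLp h.map_zero f

theorem coeFn_comp (h : IsTame N G L) (f : L2) : h.comp f =ᵐ[volume] fun x => N (f x) :=
  h.lipschitz.coeFn_compLp h.map_zero f

theorem lipschitz_comp (h : IsTame N G L) : LipschitzWith L h.comp :=
  h.lipschitz.lipschitzWith_compLp h.map_zero

/-- Gauge invariance makes `N(f)` a real multiple of `f` pointwise. This is the source of mass
conservation. -/
theorem re_inner_comp (h : IsTame N G L) (f : L2) :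
    (inner ℂ f (Complex.I • h.comp f) : ℂ).re = 0 := by
  have hz : ∀ z : ℂ, ((starRingEnd ℂ) z * (N z)).im = 0 := by
    intro z
    obtain ⟨k, hk⟩ := h.gauge z
    rw [hk, mul_left_comm, ← mul_comm z, Complex.mul_conj, ← Complex.ofReal_mul, Complex.ofReal_im]
  rw [inner_smul_right, L2.inner_eq, Complex.I_mul_re, neg_eq_zero]
  have h1 : ∫ x, (starRingEnd ℂ) (f x) * h.comp f x =
      ∫ x, ((((starRingEnd ℂ) (f x) * h.comp f x).re : ℝ) : ℂ) := by
    refine integral_congr_ae ?_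
    filter_upwards [h.coeFn_comp f] with x hx
    rw [hx]
    exact Complex.ext (by simp) (by rw [hz, Complex.ofReal_im])
  rw [h1, integral_complex_ofReal]
  exact Complex.ofReal_im _

theorem abs_potential_le (h : IsTame N G L) (z : ℂ) : |G z| ≤ L * ‖z‖ ^ 2 := by
  have := h.abs_potential_sub_le 0 z
  simpa [h.map_zero, h.potential_zero] using this

theorem integrable_potential (h : IsTame N G L) (f : L2) : Integrable fun x => G (f x) := by
  have hG : Continuous G :=
    continuous_iff_continuousAt.mpr fun z => (h.hasFDerivAt_potential z).continuousAt
  refine Integrable.mono' (((Lp.memLp f).integrable_norm_pow (by norm_num)).const_mul (L : ℝ))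
    (hG.comp_aestronglyMeasurable (Lp.aestronglyMeasurable f)) (Eventually.of_forall fun x => ?_)
  exact h.abs_potential_le (f x)

/-- The potential energy. -/
def energy (_ : IsTame N G L) (f : L2) : ℝ := ∫ x, G (f x)

theorem norm_sq_eq_integral (f : L2) : ‖f‖ ^ 2 = ∫ x, ‖f x‖ ^ 2 := by
  have h1 : ((‖f‖ ^ 2 : ℝ) : ℂ) = ((∫ x, ‖f x‖ ^ 2 : ℝ) : ℂ) := by
    rw [← integral_complex_ofReal]
    have := L2.inner_eq f f
    rw [inner_self_eq_norm_sq_to_K] at this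
    push_cast
    refine this.trans (integral_congr_ae (Eventually.of_forall fun x => ?_))
    simp only
    rw [mul_comm, Complex.mul_conj, Complex.normSq_eq_norm_sq]
    push_cast
    rfl
  exact_mod_cast h1

theorem abs_energy_sub_le (h : IsTame N G L) (f g : L2) :
    |h.energy g - h.energy f - (inner ℂ (h.comp f) (g - f) : ℂ).re| ≤ L * ‖g - f‖ ^ 2 := by
  have i1 := h.integrable_potential f
  have i2 := h.integrable_potential g
  have i3 := integrable_conj_mul (h.comp f) (g - f)
  have i4 : Integrable fun x => ((starRingEnd ℂ) (h.comp f x) * (g - f : L2) x).re := i3.re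
  have i5 : Integrable fun x => G (g x) - G (f x) := i2.sub i1
  have e : h.energy g - h.energy f - (inner ℂ (h.comp f) (g - f) : ℂ).re =
      ∫ x, (G (g x) - G (f x) - ((starRingEnd ℂ) (h.comp f x) * (g - f : L2) x).re) := by
    rw [L2.inner_eq, integral_sub i5 i4, integral_sub i2 i1]
    have := integral_re i3
    simp only [RCLike.re_to_complex] at this
    rw [← this]
    rfl
  rw [e, norm_sq_eq_integral, ← integral_const_mul, ← Real.norm_eq_abs]
  refine (norm_integral_le_integral_norm _).trans ?_
  refine integral_mono_ae (i5.sub i4).norm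
    (((Lp.memLp (g - f)).integrable_norm_pow (by norm_num)).const_mul (L : ℝ)) ?_
  filter_upwards [h.coeFn_comp f, Lp.coeFn_sub g f] with x h1 h2
  rw [h1, h2, Pi.sub_apply, Real.norm_eq_abs]
  have := h.abs_potential_sub_le (f x) (g x)
  rwa [Complex.inner, mul_comm] at this

/-! ### Superposition operators on the energy space -/

theorem norm_fderiv_apply_le (h : IsTame N G L) (z w : ℂ) : ‖fderiv ℝ N z w‖ ≤ L * ‖w‖ :=
  ContinuousLinearMap.le_of_opNorm_le _ (h.norm_fderiv_le z) w

theorem memLp_fderiv (h : IsTame N G L) (f g : L2) :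
    MemLp (fun x => fderiv ℝ N (f x) (g x)) 2 (volume : Measure ℝ) := by
  refine (Lp.memLp g).of_le_mul (c := L) ?_ (Eventually.of_forall fun x => ?_)
  · exact (ContinuousLinearMap.id ℝ (ℂ →L[ℝ] ℂ)).aestronglyMeasurable_comp₂
      (h.uniformContinuous_fderiv.continuous.comp_aestronglyMeasurable (Lp.aestronglyMeasurable f))
      (Lp.aestronglyMeasurable g)
  · exact h.norm_fderiv_apply_le _ _

/-- The weak derivative `N'(f) g` of `N(f)`, if `g` is the weak derivative of `f`. -/
def compDeriv (h : IsTame N G L) (f g : L2) : L2 := (h.memLp_fderiv f g).toLp _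

theorem coeFn_compDeriv (h : IsTame N G L) (f g : L2) :
    h.compDeriv f g =ᵐ[volume] fun x => fderiv ℝ N (f x) (g x) := MemLp.coeFn_toLp _

theorem hasPrim (h : IsTame N G L) {f g : L2} {a b : ℂ} (hp : HasPrim f g a b) :
    HasPrim (h.comp f) (h.compDeriv f g) (N a) (N b) := by
  have h3 : ∀ᵐ x : ℝ, x ≠ 0 := by simp [ae_iff]
  constructor
  · filter_upwards [hp.1, h.coeFn_comp f] with x hx h2 hx0
    rw [h2, hx hx0, comp_prim h.contDiff a (L2.locallyIntegrable g), prim, prim]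
    congr 1
    refine intervalIntegral.integral_congr_ae ?_
    filter_upwards [hp.1, h.coeFn_compDeriv f g] with t ht h4 hts
    rw [uIoc_of_le hx0.le] at hts
    rw [h4, ht hts.1]
  · filter_upwards [hp.2, h.coeFn_comp f] with x hx h2 hx0
    rw [h2, hx hx0, comp_prim h.contDiff b (L2.locallyIntegrable g), prim, prim]
    congr 1
    refine intervalIntegral.integral_congr_ae ?_
    filter_upwards [hp.2, h.coeFn_compDeriv f g, h3] with t ht h4 h3 hts
    rw [uIoc_comm, uIoc_of_le hx0.le] at hts
    rw [h4, ht (lt_of_le_of_ne hts.2 h3)]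

/-- The superposition operator on the energy space. -/
def compQ (h : IsTame N G L) (u : Q) : Q := Q.mk (h.hasPrim (Q.hasPrim u)).isWeakDeriv

theorem toL2_compQ (h : IsTame N G L) (u : Q) : (h.compQ u).toL2 = h.comp u.toL2 := rfl

theorem der_compQ (h : IsTame N G L) (u : Q) :
    Q.der (h.compQ u) = h.compDeriv u.toL2 (Q.der u) := rfl

theorem norm_comp_le (h : IsTame N G L) (f : L2) : ‖h.comp f‖ ≤ L * ‖f‖ :=
  h.lipschitz.norm_compLp_le h.map_zero f

theorem norm_compQ_le (h : IsTame N G L) (u : Q) : ‖h.compQ u‖ ≤ L * ‖u‖ := by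
  have h1 : ‖(h.compQ u).toL2‖ ≤ L * ‖u.toL2‖ := h.norm_comp_le u.toL2
  have h2 : ‖Q.der (h.compQ u)‖ ≤ L * ‖Q.der u‖ := by
    refine Lp.norm_le_mul_norm_of_ae_le_mul ?_
    filter_upwards [h.coeFn_compDeriv u.toL2 (Q.der u)] with x hx
    rw [der_compQ, hx]
    exact h.norm_fderiv_apply_le _ _
  have h3 := Q.norm_sq_eq (h.compQ u)
  have h4 := Q.norm_sq_eq u
  refine le_of_sq_le_sq ?_ (by positivity)
  rw [h3, mul_pow, h4, mul_add, ← mul_pow, ← mul_pow]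
  gcongr

/-- Write `N'(u)u' - N'(v)v' = N'(u)(u - v)' + (N'(u) - N'(v))v'`. The first term is Lipschitz; the
second is small by uniform continuity of `N'`, which is all that is assumed about its modulus. -/
theorem exists_norm_compQ_sub_le (h : IsTame N G L) {ε : ℝ} (hε : 0 < ε) : ∃ δ > 0, ∀ u v : Q,
    (∀ᵐ x, ‖u.toL2 x - v.toL2 x‖ ≤ δ) → ‖h.compQ u - h.compQ v‖ ≤ L * ‖u - v‖ + ε * ‖v‖ := by
  obtain ⟨δ, hδ, H⟩ := Metric.uniformContinuous_iff.mp h.uniformContinuous_fderiv ε hε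
  refine ⟨δ / 2, by positivity, fun u v huv => ?_⟩
  have h1 : ‖(h.compQ u - h.compQ v).toL2‖ ≤ L * ‖(u - v).toL2‖ := by
    rw [map_sub, map_sub]
    exact h.lipschitz_comp.norm_sub_le u.toL2 v.toL2
  have h2 : ‖Q.der (h.compQ u - h.compQ v)‖ ≤ L * ‖Q.der (u - v)‖ + ε * ‖Q.der v‖ := by
    have e : Q.der (h.compQ u - h.compQ v) = h.compDeriv u.toL2 (Q.der (u - v)) +
        (h.compDeriv u.toL2 (Q.der v) - h.compDeriv v.toL2 (Q.der v)) := by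
      rw [map_sub, der_compQ, der_compQ]
      have : h.compDeriv u.toL2 (Q.der u) =
          h.compDeriv u.toL2 (Q.der (u - v)) + h.compDeriv u.toL2 (Q.der v) := by
        refine Lp.ext ?_
        filter_upwards [h.coeFn_compDeriv u.toL2 (Q.der u), h.coeFn_compDeriv u.toL2 (Q.der v),
          h.coeFn_compDeriv u.toL2 (Q.der (u - v)), Lp.coeFn_add
          (h.compDeriv u.toL2 (Q.der (u - v))) (h.compDeriv u.toL2 (Q.der v)),
          Lp.coeFn_sub (Q.der u) (Q.der v)] with x e1 e2 e3 e4 e5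
        rw [e4, Pi.add_apply, e1, e2, e3, ← map_add, map_sub, e5, Pi.sub_apply, sub_add_cancel]
      rw [this]
      abel
    rw [e]
    refine (norm_add_le _ _).trans (add_le_add ?_ ?_)
    · refine Lp.norm_le_mul_norm_of_ae_le_mul ?_
      filter_upwards [h.coeFn_compDeriv u.toL2 (Q.der (u - v))] with x hx
      rw [hx]
      exact h.norm_fderiv_apply_le _ _
    · refine Lp.norm_le_mul_norm_of_ae_le_mul ?_
      filter_upwards [h.coeFn_compDeriv u.toL2 (Q.der v), h.coeFn_compDeriv v.toL2 (Q.der v),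
        Lp.coeFn_sub (h.compDeriv u.toL2 (Q.der v)) (h.compDeriv v.toL2 (Q.der v)), huv]
        with x e1 e2 e3 e4
      rw [e3, Pi.sub_apply, e1, e2, ← sub_apply]
      refine ContinuousLinearMap.le_of_opNorm_le _ ?_ _
      rw [← dist_eq_norm]
      refine (H ?_).le
      rw [dist_eq_norm]
      linarith
  have h3 := Q.norm_sq_eq (h.compQ u - h.compQ v)
  have h4 := Q.norm_sq_eq (u - v)
  have h6 := Q.norm_der_le v
  have h7 := Q.norm_der_le (u - v)
  have h8 : L * ‖Q.der (u - v)‖ + ε * ‖Q.der v‖ ≤ L * ‖Q.der (u - v)‖ + ε * ‖v‖ := by gcongr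
  refine le_of_sq_le_sq ?_ (by positivity)
  have h9 := pow_le_pow_left₀ (norm_nonneg _) h1 2
  have h10 := pow_le_pow_left₀ (norm_nonneg _) (h2.trans h8) 2
  have h11 : L * ‖Q.der (u - v)‖ * (ε * ‖v‖) ≤ L * ‖u - v‖ * (ε * ‖v‖) := by gcongr
  have h12 : (L : ℝ) ^ 2 * ‖u - v‖ ^ 2 = L ^ 2 * (‖(u - v).toL2‖ ^ 2 + ‖Q.der (u - v)‖ ^ 2) := by
    rw [h4]
  nlinarith

end IsTame

/-! ### An ordinary differential equation that is Lipschitz in a weaker norm -/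

section ODE

variable {X Y : Type*} [NormedAddCommGroup X] [InnerProductSpace ℂ X]
  [NormedAddCommGroup Y] [InnerProductSpace ℂ Y]

/-- A time-dependent vector field on `X` that is Lipschitz for the weaker norm `‖J x‖`, has linear
growth, and is Lipschitz for the norm of `X` up to an error that is small if `‖J (x - y)‖` is. -/
structure IsWeaklyLipschitz (J : X →L[ℂ] Y) (F : ℝ → X → X) (L : ℝ) : Prop where
  pos : 0 < L
  norm_map_sub_le : ∀ s x y, ‖J (F s x) - J (F s y)‖ ≤ L * ‖J x - J y‖
  norm_le : ∀ s x, ‖F s x‖ ≤ L * ‖x‖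
  norm_sub_le : ∀ ε > 0, ∀ M, ∃ δ > 0, ∀ s x y, ‖x‖ ≤ M → ‖y‖ ≤ M → ‖J x - J y‖ ≤ δ →
    ‖F s x - F s y‖ ≤ L * ‖x - y‖ + ε

/-- The Picard iterates. -/
def picard (F : ℝ → X → X) (x₀ : X) : ℕ → ℝ → X
  | 0 => fun _ => x₀
  | k + 1 => fun t => x₀ + ∫ s in (0 : ℝ)..t, F s (picard F x₀ k s)

/-- With the weight `e^{2Lt}`, integrating an `L`-Lipschitz field gains a factor `1/2`, so Picard
iteration contracts on every time interval at once. -/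
theorem norm_integral_le_of_exp {E : Type*} [NormedAddCommGroup E] [NormedSpace ℝ E] {g : ℝ → E}
    {L c d t : ℝ} (hL : 0 < L) (ht : 0 ≤ t) (hd : 0 ≤ d)
    (h : ∀ s ∈ Icc 0 t, ‖g s‖ ≤ c * L * Real.exp (2 * L * s) + d) :
    ‖∫ s in (0 : ℝ)..t, g s‖ ≤
      c / 2 * (Real.exp (2 * L * t) - 1) + d / (2 * L) * Real.exp (2 * L * t) := by
  have hc : Continuous fun s : ℝ => c * L * Real.exp (2 * L * s) + d := by fun_prop
  have h1 : ‖∫ s in (0 : ℝ)..t, g s‖ ≤ ∫ s in (0 : ℝ)..t, (c * L * Real.exp (2 * L * s) + d) :=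
    intervalIntegral.norm_integral_le_of_norm_le ht
      (Eventually.of_forall fun s hs => h s ⟨hs.1.le, hs.2⟩) (hc.intervalIntegrable _ _)
  have h2 : ∫ s in (0 : ℝ)..t, (c * L * Real.exp (2 * L * s) + d) =
      (c / 2 * Real.exp (2 * L * t) + d * t) - (c / 2 * Real.exp (2 * L * 0) + d * 0) := by
    refine intervalIntegral.integral_eq_sub_of_hasDerivAt
      (f := fun s => c / 2 * Real.exp (2 * L * s) + d * s) (fun s _ => ?_)
      (hc.intervalIntegrable _ _)
    have e1 : HasDerivAt (fun s : ℝ => 2 * L * s) (2 * L) s := by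
      simpa using (hasDerivAt_id s).const_mul (2 * L)
    have e2 := (e1.exp.const_mul (c / 2)).add ((hasDerivAt_id s).const_mul d)
    refine e2.congr_deriv ?_
    ring
  rw [h2] at h1
  refine h1.trans ?_
  have h3 : 2 * L * t ≤ Real.exp (2 * L * t) := by
    have := Real.add_one_le_exp (2 * L * t)
    linarith
  have h4 : d * t ≤ d / (2 * L) * Real.exp (2 * L * t) := by
    calc d * t = d / (2 * L) * (2 * L * t) := by field_simp
      _ ≤ _ := by gcongr
  simp only [mul_zero, Real.exp_zero]
  linarith

namespace IsWeaklyLipschitz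

variable {J : X →L[ℂ] Y} {F : ℝ → X → X} {L : ℝ}

theorem continuous_picard (hF : Continuous fun p : ℝ × X => F p.1 p.2) (x₀ : X) (k : ℕ) :
    Continuous (picard F x₀ k) := by
  induction k with
  | zero => exact continuous_const
  | succ k ih =>
    have : Continuous fun s => F s (picard F x₀ k s) := hF.comp (continuous_id.prodMk ih)
    exact continuous_const.add
      (intervalIntegral.continuous_primitive (fun _ _ => this.intervalIntegrable _ _) 0)

theorem norm_picard_le (h : IsWeaklyLipschitz J F L) (x₀ : X) (k : ℕ) :
    ∀ t, 0 ≤ t → ‖picard F x₀ k t‖ ≤ ‖x₀‖ * Real.exp (2 * L * t) := by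
  have hL := h.pos
  have hexp : ∀ t, 0 ≤ t → 1 ≤ Real.exp (2 * L * t) := fun t ht => Real.one_le_exp (by positivity)
  induction k with
  | zero => exact fun t ht => le_mul_of_one_le_right (norm_nonneg _) (hexp t ht)
  | succ k ih =>
    intro t ht
    have h1 := norm_integral_le_of_exp (g := fun s => F s (picard F x₀ k s)) (c := ‖x₀‖) hL ht
      le_rfl fun s hs => by
        refine (h.norm_le s _).trans ?_
        have := mul_le_mul_of_nonneg_left (ih s hs.1) hL.le
        linarith
    refine (norm_add_le _ _).trans ?_
    have h2 := mul_le_mul_of_nonneg_left (hexp t ht) (norm_nonneg x₀)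
    simp only [zero_div, zero_mul, add_zero] at h1
    linarith

theorem continuous_field_picard (hF : Continuous fun p : ℝ × X => F p.1 p.2) (x₀ : X) (k : ℕ) :
    Continuous fun s => F s (picard F x₀ k s) :=
  hF.comp (continuous_id.prodMk (continuous_picard hF x₀ k))

theorem picard_succ_sub (hF : Continuous fun p : ℝ × X => F p.1 p.2) (x₀ : X) (k l : ℕ) (t : ℝ) :
    picard F x₀ (k + 1) t - picard F x₀ (l + 1) t =
      ∫ s in (0 : ℝ)..t, (F s (picard F x₀ k s) - F s (picard F x₀ l s)) := by
  rw [intervalIntegral.integral_sub ((continuous_field_picard hF x₀ k).intervalIntegrable _ _)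
    ((continuous_field_picard hF x₀ l).intervalIntegrable _ _)]
  exact add_sub_add_left_eq_sub _ _ _

theorem norm_map_picard_sub_le [CompleteSpace X] [CompleteSpace Y] (h : IsWeaklyLipschitz J F L)
    (hF : Continuous fun p : ℝ × X => F p.1 p.2) (x₀ : X) (k n : ℕ) :
    ∀ t, 0 ≤ t → ‖J (picard F x₀ (k + n) t) - J (picard F x₀ k t)‖ ≤
      2 * ‖J‖ * ‖x₀‖ * (1 / 2) ^ k * Real.exp (2 * L * t) := by
  have hL := h.pos
  induction k with
  | zero =>
    intro t ht
    rw [← map_sub]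
    refine (J.le_opNorm _).trans ?_
    have h1 := h.norm_picard_le x₀ (0 + n) t ht
    have h2 := h.norm_picard_le x₀ 0 t ht
    have h3 := _root_.norm_sub_le (picard F x₀ (0 + n) t) (picard F x₀ 0 t)
    calc _ ≤ ‖J‖ * (‖x₀‖ * Real.exp (2 * L * t) + ‖x₀‖ * Real.exp (2 * L * t)) := by
          gcongr; linarith
      _ = _ := by ring
  | succ k ih =>
    intro t ht
    have hc : Continuous fun s => F s (picard F x₀ (k + n) s) - F s (picard F x₀ k s) :=
      (continuous_field_picard hF x₀ _).sub (continuous_field_picard hF x₀ _)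
    have e : J (picard F x₀ (k + 1 + n) t) - J (picard F x₀ (k + 1) t) =
        ∫ s in (0 : ℝ)..t, J (F s (picard F x₀ (k + n) s) - F s (picard F x₀ k s)) := by
      rw [← map_sub, show k + 1 + n = k + n + 1 by ring, picard_succ_sub hF]
      exact ((J.restrictScalars ℝ).intervalIntegral_comp_comm (hc.intervalIntegrable 0 t)).symm
    rw [e]
    refine (norm_integral_le_of_exp (c := 2 * ‖J‖ * ‖x₀‖ * (1 / 2) ^ k) hL ht le_rfl
      fun s hs => ?_).trans ?_
    · rw [map_sub]
      refine (h.norm_map_sub_le s _ _).trans ?_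
      have := mul_le_mul_of_nonneg_left (ih s hs.1) hL.le
      linarith
    · have : 0 ≤ 2 * ‖J‖ * ‖x₀‖ * (1 / 2) ^ k := by positivity
      rw [pow_succ]
      simp only [zero_div, zero_mul, add_zero]
      linarith

/-- The iterates converge geometrically in the weak norm and stay bounded in `X`. From some index on
the weak distances are below `δ`, so the field is Lipschitz in `X` up to a small error and the
contraction can be run again, now in the strong norm. -/
theorem uniformCauchySeqOn_picard [CompleteSpace X] [CompleteSpace Y] (h : IsWeaklyLipschitz J F L)
    (hF : Continuous fun p : ℝ × X => F p.1 p.2) (x₀ : X) (T : ℝ) :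
    UniformCauchySeqOn (picard F x₀) atTop (Icc 0 T) := by
  have hL := h.pos
  set E := Real.exp (2 * L * T) with hE
  have hEpos : 0 < E := Real.exp_pos _
  have hexp : ∀ t ≤ T, Real.exp (2 * L * t) ≤ E := fun t ht => by
    rw [hE]; gcongr
  have key : ∀ ε > 0, ∃ K, ∀ k ≥ K, ∀ n, ∀ t ∈ Icc 0 T,
      ‖picard F x₀ (k + n) t - picard F x₀ k t‖ ≤ ε := by
    intro ε hε
    obtain ⟨δ, hδ, H⟩ := h.norm_sub_le (ε * L / (2 * E)) (by positivity) (‖x₀‖ * E)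
    have hlim : ∀ C : ℝ, Tendsto (fun k : ℕ => C * (1 / 2) ^ k * E) atTop (𝓝 0) := by
      intro C
      have := ((tendsto_pow_atTop_nhds_zero_of_lt_one (r := (1 / 2 : ℝ)) (by norm_num)
        (by norm_num)).const_mul C).mul_const E
      simpa using this
    obtain ⟨k₀, hk₀⟩ := eventually_atTop.mp
      ((hlim (2 * ‖J‖ * ‖x₀‖)).eventually (gt_mem_nhds hδ))
    obtain ⟨j, hj⟩ := ((hlim (2 * ‖x₀‖)).eventually (gt_mem_nhds (half_pos hε))).exists
    -- Each step halves the coefficient and adds `ε / (4E)`; the summand `ε / (2E)` is the fixed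
    -- point of this recursion.
    have claim : ∀ i, ∀ k ≥ k₀ + i, ∀ n, ∀ t ∈ Icc 0 T,
        ‖picard F x₀ (k + n) t - picard F x₀ k t‖ ≤
          (2 * ‖x₀‖ * (1 / 2) ^ i + ε / (2 * E)) * Real.exp (2 * L * t) := by
      intro i
      induction i with
      | zero =>
        intro k _ n t ht
        have h1 := h.norm_picard_le x₀ (k + n) t ht.1
        have h2 := h.norm_picard_le x₀ k t ht.1
        have h3 := _root_.norm_sub_le (picard F x₀ (k + n) t) (picard F x₀ k t)
        have h4 : 0 ≤ ε / (2 * E) * Real.exp (2 * L * t) := by positivity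
        rw [pow_zero]
        linarith
      | succ i ih =>
        intro k hk n t ht
        obtain ⟨k, rfl⟩ : ∃ k', k = k' + 1 := ⟨k - 1, by omega⟩
        rw [show k + 1 + n = k + n + 1 by ring, picard_succ_sub hF]
        refine (norm_integral_le_of_exp (c := 2 * ‖x₀‖ * (1 / 2) ^ i + ε / (2 * E))
          (d := ε * L / (2 * E)) hL ht.1 (by positivity) fun s hs => ?_).trans ?_
        · have hsT : s ∈ Icc 0 T := ⟨hs.1, hs.2.trans ht.2⟩
          refine (H s _ _ ?_ ?_ ?_).trans ?_
          · exact (h.norm_picard_le x₀ _ s hs.1).trans (by gcongr; exact hexp s hsT.2)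
          · exact (h.norm_picard_le x₀ _ s hs.1).trans (by gcongr; exact hexp s hsT.2)
          · refine (h.norm_map_picard_sub_le hF x₀ k n s hs.1).trans ?_
            refine le_trans ?_ (hk₀ k (by omega)).le
            gcongr
            exact hexp s hsT.2
          · have := mul_le_mul_of_nonneg_left (ih k (by omega) n s hsT) hL.le
            linarith
        · have h5 : ε * L / (2 * E) / (2 * L) = ε / (2 * E) / 2 := by field_simp
          have h6 : 0 ≤ 2 * ‖x₀‖ * (1 / 2) ^ i + ε / (2 * E) := by positivity
          rw [h5, pow_succ]
          linarith
    refine ⟨k₀ + j, fun k hk n t ht => (claim j k hk n t ht).trans ?_⟩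
    calc _ ≤ (2 * ‖x₀‖ * (1 / 2) ^ j + ε / (2 * E)) * E := by gcongr; exact hexp t ht.2
      _ = 2 * ‖x₀‖ * (1 / 2) ^ j * E + ε / 2 := by field_simp
      _ ≤ ε := by linarith
  rw [Metric.uniformCauchySeqOn_iff]
  intro ε hε
  obtain ⟨K, hK⟩ := key (ε / 3) (by positivity)
  refine ⟨K, fun k hk l hl t ht => ?_⟩
  obtain ⟨a, rfl⟩ := Nat.exists_eq_add_of_le hk
  obtain ⟨b, rfl⟩ := Nat.exists_eq_add_of_le hl
  have h1 := hK K le_rfl a t ht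
  have h2 := hK K le_rfl b t ht
  rw [← dist_eq_norm] at h1 h2
  have := dist_triangle_right (picard F x₀ (K + a) t) (picard F x₀ (K + b) t) (picard F x₀ K t)
  linarith

/-- Global existence: the solution is continuously differentiable on the whole line, and it solves
the equation on `[0, ∞)`. -/
theorem exists_solution [CompleteSpace X] [CompleteSpace Y] (h : IsWeaklyLipschitz J F L)
    (hF : Continuous fun p : ℝ × X => F p.1 p.2) (x₀ : X) :
    ∃ w f : ℝ → X, w 0 = x₀ ∧ Continuous f ∧ (∀ t, HasDerivAt w (f t) t) ∧
      ∀ t, 0 ≤ t → f t = F t (w t) := by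
  have hL := h.pos
  have hlim : ∀ t, ∃ y, 0 ≤ t → Tendsto (fun k => picard F x₀ k t) atTop (𝓝 y) := by
    intro t
    by_cases ht : 0 ≤ t
    · obtain ⟨y, hy⟩ := cauchySeq_tendsto_of_complete
        ((h.uniformCauchySeqOn_picard hF x₀ t).cauchySeq (right_mem_Icc.mpr ht))
      exact ⟨y, fun _ => hy⟩
    · exact ⟨0, fun h => absurd h ht⟩
  choose v hv using hlim
  have hcont : ∀ T, ContinuousOn v (Icc 0 T) := fun T =>
    ((h.uniformCauchySeqOn_picard hF x₀ T).tendstoUniformlyOn_of_tendsto fun t ht =>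
      hv t ht.1).continuousOn (Eventually.of_forall fun k =>
        (continuous_picard hF x₀ k).continuousOn).frequently
  have hcv : Continuous fun t => v (max t 0) := by
    rw [continuous_iff_continuousAt]
    intro t
    have h1 : ContinuousOn (fun t => v (max t 0)) (Iio (max t 0 + 1)) := by
      refine (hcont (max t 0 + 1)).comp (by fun_prop) fun s hs => ⟨le_max_right _ _, ?_⟩
      rw [mem_Iio] at hs
      exact max_le hs.le (by positivity)
    exact h1.continuousAt (Iio_mem_nhds (lt_of_le_of_lt (le_max_left _ _) (lt_add_one _)))
  -- Freezing the field for negative times makes the solution differentiable on the whole line, so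
  -- no one-sided derivative is needed at `0`.
  let f : ℝ → X := fun t => F (max t 0) (v (max t 0))
  have hf : Continuous f := hF.comp ((continuous_id.max continuous_const).prodMk hcv)
  have heq : ∀ t, 0 ≤ t → v t = x₀ + ∫ s in (0 : ℝ)..t, f s := by
    intro t ht
    have h1 : Tendsto (fun k => ∫ s in (0 : ℝ)..t, F s (picard F x₀ k s)) atTop
        (𝓝 (∫ s in (0 : ℝ)..t, f s)) := by
      refine intervalIntegral.tendsto_integral_filter_of_dominated_convergence
        (fun _ => L * (‖x₀‖ * Real.exp (2 * L * t))) (Eventually.of_forall fun k =>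
          (continuous_field_picard hF x₀ k).aestronglyMeasurable) ?_ (by simp) ?_
      · refine Eventually.of_forall fun k => Eventually.of_forall fun s hs => ?_
        rw [uIoc_of_le ht] at hs
        refine (h.norm_le s _).trans ?_
        have := h.norm_picard_le x₀ k s hs.1.le
        have h2 : Real.exp (2 * L * s) ≤ Real.exp (2 * L * t) := by gcongr; exact hs.2
        gcongr
        exact this.trans (by gcongr)
      · refine Eventually.of_forall fun s hs => ?_
        rw [uIoc_of_le ht] at hs
        have : f s = F s (v s) := by simp only [f, max_eq_left hs.1.le]
        rw [this]
        exact (hF.tendsto (s, v s)).comp (tendsto_const_nhds.prodMk_nhds (hv s hs.1.le))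
    have h2 := (hv t ht).comp (tendsto_add_atTop_nat 1)
    exact tendsto_nhds_unique h2 (h1.const_add x₀)
  refine ⟨fun t => x₀ + ∫ s in (0 : ℝ)..t, f s, f, by simp, hf, fun t => ?_, fun t ht => ?_⟩
  · exact (hf.integral_hasStrictDerivAt 0 t).hasDerivAt.const_add x₀
  · beta_reduce
    rw [← heq t ht]
    simp only [f, max_eq_left ht]

end IsWeaklyLipschitz

end ODE

/-! ### Conservation laws -/

section Evolution

variable {X Y : Type*} [NormedAddCommGroup X] [InnerProductSpace ℂ X] [CompleteSpace X]
  [NormedAddCommGroup Y] [InnerProductSpace ℂ Y] [CompleteSpace Y]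

/-- A gauge invariant nonlinear operator `n` on `Y` with potential `e`, which lifts to an operator
`N` on the space `X`. -/
structure IsPotentialOp (J : X →L[ℂ] Y) (N : X → X) (n : Y → Y) (e : Y → ℝ) (L : ℝ) : Prop where
  pos : 0 < L
  map_apply : ∀ x, J (N x) = n (J x)
  norm_sub_le' : ∀ f g, ‖n f - n g‖ ≤ L * ‖f - g‖
  norm_le : ∀ x, ‖N x‖ ≤ L * ‖x‖
  norm_sub_le : ∀ ε > 0, ∀ M, ∃ δ > 0, ∀ x y, ‖x‖ ≤ M → ‖y‖ ≤ M → ‖J x - J y‖ ≤ δ →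
    ‖N x - N y‖ ≤ L * ‖x - y‖ + ε
  gauge : ∀ f, (inner ℂ f (Complex.I • n f) : ℂ).re = 0
  potential : ∀ f g, |e g - e f - (inner ℂ (n f) (g - f) : ℂ).re| ≤ L * ‖g - f‖ ^ 2

-- The group is only strongly continuous, but where `v` vanishes the product rule needs no
-- derivative of the group.
omit [CompleteSpace X] in
theorem IsIsometricGroup.hasDerivAt_apply_of_eq_zero {U : ℝ → X →L[ℂ] X}
    (hU : IsIsometricGroup U) {v : ℝ → X} {v' : X} {t : ℝ} (hv : HasDerivAt v v' t)
    (h0 : v t = 0) : HasDerivAt (fun s => U s (v s)) (U t v') t := by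
  rw [hasDerivAt_iff_isLittleO] at hv ⊢
  have h1 : (fun s => U s (v s - v t - (s - t) • v')) =o[𝓝 t] fun s => s - t :=
    Asymptotics.isLittleO_norm_left.mp
      ((Asymptotics.isLittleO_norm_left.mpr hv).congr_left fun s => (hU.norm_map _ _).symm)
  have h2 : (fun s => (s - t) • (U s v' - U t v')) =o[𝓝 t] fun s => s - t := by
    have h3 : (fun s => U s v' - U t v') =o[𝓝 t] fun _ => (1 : ℝ) := by
      rw [Asymptotics.isLittleO_one_iff]
      have := ((hU.continuous v').sub (continuous_const (y := U t v'))).tendsto t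
      simpa using! this
    have h4 := (Asymptotics.isBigO_refl (fun s : ℝ => s - t) (𝓝 t)).smul_isLittleO h3
    simpa using h4
  refine (h1.add h2).congr_left fun s => ?_
  have e : ∀ r : ℝ, U s (r • v') = r • U s v' := fun r => map_real_smul (U s) (U s).continuous r v'
  rw [h0, map_sub, map_sub, e, _root_.map_zero, _root_.map_zero, smul_sub]
  abel

/-- Split `gram J (w s)` into its value at time `t`, which lies in the domain of the generator, and
an increment that vanishes at `t`. -/
theorem IsGroupPair.hasDerivAt_gram {m : ℝ} {J : X →L[ℂ] Y} {U : ℝ → X →L[ℂ] X}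
    {V : ℝ → Y →L[ℂ] Y} (hp : IsGroupPair m J U V) {w : ℝ → X} {w' : X} {t : ℝ}
    (hw : HasDerivAt w w' t) :
    HasDerivAt (fun s => gram J (U s (w s)))
      (-(Complex.I • (U t (w t) - (m : ℂ) • gram J (U t (w t)))) + gram J (U t w')) t := by
  have h1 := hp.group.hasDerivAt_of_zero (hp.hasDerivAt_zero (w t)) t
  have h2 : HasDerivAt (fun s => gram J (w s) - gram J (w t)) (gram J w') t :=
    (((gram J).restrictScalars ℝ).hasFDerivAt.comp_hasDerivAt t hw).sub_const _
  have h3 := hp.group.hasDerivAt_apply_of_eq_zero h2 (sub_self _)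
  refine ((h1.add h3).congr_of_eventuallyEq (Eventually.of_forall fun s => ?_)).congr_deriv ?_
  · simp only [Pi.add_apply, map_sub, add_sub_cancel, hp.commute]
  · rw [map_neg, map_smul, map_sub, map_smul, hp.commute, hp.commute]

omit [CompleteSpace X] in
theorem hasDerivAt_norm_sq {w : ℝ → X} {w' : X} {t : ℝ} (hw : HasDerivAt w w' t) :
    HasDerivAt (fun s => ‖w s‖ ^ 2) (2 * (inner ℂ (w t) w' : ℂ).re) t := by
  have h1 := hw.inner ℂ hw
  have h2 := Complex.reCLM.hasFDerivAt.comp_hasDerivAt t h1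
  refine (h2.congr_of_eventuallyEq (Eventually.of_forall fun s => ?_)).congr_deriv ?_
  · simp only [Function.comp_apply, Complex.reCLM_apply]
    rw [inner_self_eq_norm_sq_to_K]
    norm_cast
  · simp only [Complex.reCLM_apply, Complex.add_re]
    rw [← inner_conj_symm w' (w t), Complex.conj_re]
    ring

/-- `J ψ` itself need not be differentiable. The linear term is rewritten through `gram J ψ`, and
the quadratic error equals `⟨ψ s - ψ t, gram J (ψ s - ψ t)⟩`, a product of `o(1)` and `O(s - t)`. -/
theorem IsPotentialOp.hasDerivAt_potential {J : X →L[ℂ] Y} {N : X → X} {n : Y → Y} {e : Y → ℝ}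
    {L : ℝ} (hN : IsPotentialOp J N n e L) {ψ : ℝ → X} {z' : X} {t : ℝ} (hψ : ContinuousAt ψ t)
    (hz : HasDerivAt (fun s => gram J (ψ s)) z' t) :
    HasDerivAt (fun s => e (J (ψ s))) (inner ℂ (N (ψ t)) z' : ℂ).re t := by
  have h1 : HasDerivAt (fun s => (inner ℂ (N (ψ t)) (gram J (ψ s)) : ℂ).re)
      (inner ℂ (N (ψ t)) z' : ℂ).re t := by
    have h := (hasDerivAt_const t (N (ψ t))).inner ℂ hz
    have h2 := Complex.reCLM.hasFDerivAt.comp_hasDerivAt t h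
    simpa using! h2
  rw [hasDerivAt_iff_isLittleO] at h1 ⊢
  have h2 : (fun s => L * (‖ψ s - ψ t‖ * ‖gram J (ψ s) - gram J (ψ t)‖)) =o[𝓝 t]
      fun s => s - t := by
    refine Asymptotics.IsLittleO.const_mul_left ?_ L
    have h3 : (fun s => ‖ψ s - ψ t‖) =o[𝓝 t] fun _ => (1 : ℝ) := by
      rw [Asymptotics.isLittleO_one_iff]
      have := (hψ.sub (continuousAt_const (y := ψ t))).norm
      simpa [ContinuousAt] using this
    have h4 : (fun s => ‖gram J (ψ s) - gram J (ψ t)‖) =O[𝓝 t] fun s => s - t :=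
      hz.isBigO_sub.norm_left
    simpa using h3.mul_isBigO h4
  have h5 : (fun s => e (J (ψ s)) - e (J (ψ t)) -
      (inner ℂ (n (J (ψ t))) (J (ψ s) - J (ψ t)) : ℂ).re) =o[𝓝 t] fun s => s - t := by
    refine Asymptotics.IsBigO.trans_isLittleO (Asymptotics.IsBigO.of_bound 1
      (Eventually.of_forall fun s => ?_)) h2
    rw [one_mul, Real.norm_eq_abs]
    refine (hN.potential _ _).trans ((le_abs_self _).trans' ?_)
    have h6 : ‖J (ψ s) - J (ψ t)‖ ^ 2 ≤ ‖ψ s - ψ t‖ * ‖gram J (ψ s) - gram J (ψ t)‖ := by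
      have h7 : ((‖J (ψ s) - J (ψ t)‖ ^ 2 : ℝ) : ℂ) =
          inner ℂ (ψ s - ψ t) (gram J (ψ s) - gram J (ψ t)) := by
        rw [← map_sub, ← map_sub, inner_gram_right, inner_self_eq_norm_sq_to_K]
        push_cast
        rfl
      have h8 := norm_inner_le_norm (𝕜 := ℂ) (ψ s - ψ t) (gram J (ψ s) - gram J (ψ t))
      rw [← h7, Complex.norm_real, Real.norm_eq_abs, abs_of_nonneg (by positivity)] at h8
      exact h8
    exact mul_le_mul_of_nonneg_left h6 hN.pos.le
  refine (h5.add h1).congr_left fun s => ?_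
  simp only [inner_gram_right, hN.map_apply, inner_sub_right, Complex.sub_re]
  abel

omit [CompleteSpace X] [CompleteSpace Y] in
theorem IsPotentialOp.continuous {J : X →L[ℂ] Y} {N : X → X} {n : Y → Y} {e : Y → ℝ}
    {L : ℝ} (hN : IsPotentialOp J N n e L) : Continuous N := by
  rw [continuous_iff_continuousAt]
  intro x
  rw [ContinuousAt, tendsto_iff_norm_sub_tendsto_zero, Metric.tendsto_nhds]
  intro ε hε
  obtain ⟨δ, hδ, H⟩ := hN.norm_sub_le (ε / 2) (by positivity) (‖x‖ + 1)
  have h1 : ∀ᶠ y in 𝓝 x, ‖J y - J x‖ < δ := by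
    have : Continuous fun y => ‖J y - J x‖ := by fun_prop
    exact (this.tendsto x).eventually (gt_mem_nhds (by simpa using hδ))
  have h2 : ∀ᶠ y in 𝓝 x, L * ‖y - x‖ < ε / 2 := by
    have : Continuous fun y => L * ‖y - x‖ := by fun_prop
    exact (this.tendsto x).eventually (gt_mem_nhds (by simpa using hε))
  have h3 : ∀ᶠ y in 𝓝 x, ‖y‖ < ‖x‖ + 1 :=
    (continuous_norm.tendsto x).eventually (gt_mem_nhds (by linarith))
  filter_upwards [h1, h2, h3] with y h1 h2 h3
  have := H y x h3.le (by linarith) h1.le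
  rw [dist_zero_right, norm_norm]
  linarith

/-- The vector field of the interaction picture. As `U` and `V` are isometric and intertwined, it
inherits every estimate of `N`. -/
theorem IsPotentialOp.isWeaklyLipschitz {J : X →L[ℂ] Y} {N : X → X} {n : Y → Y} {e : Y → ℝ}
    {L : ℝ} (hN : IsPotentialOp J N n e L) {m : ℝ} {U : ℝ → X →L[ℂ] X}
    {V : ℝ → Y →L[ℂ] Y} (hp : IsGroupPair m J U V) {lam : ℝ} (hlam : 0 < lam) :
    IsWeaklyLipschitz J (fun s x => U (-s) ((Complex.I * lam) • N (U s x))) (lam * L) := by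
  have hn : ‖Complex.I * (lam : ℂ)‖ = lam := by simp [abs_of_pos hlam]
  refine ⟨mul_pos hlam hN.pos, fun s x y => ?_, fun s x => ?_, fun ε hε M => ?_⟩
  · rw [hp.intertwine, hp.intertwine, ← map_sub, hp.group'.norm_map, map_smul, map_smul, ← smul_sub,
      norm_smul, hn, hN.map_apply, hN.map_apply, mul_assoc, hp.intertwine, hp.intertwine]
    refine mul_le_mul_of_nonneg_left ((hN.norm_sub_le' _ _).trans ?_) hlam.le
    rw [← map_sub, hp.group'.norm_map]
  · rw [hp.group.norm_map, norm_smul, hn, mul_assoc]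
    refine mul_le_mul_of_nonneg_left ((hN.norm_le _).trans ?_) hlam.le
    rw [hp.group.norm_map]
  · obtain ⟨δ, hδ, H⟩ := hN.norm_sub_le (ε / lam) (by positivity) M
    refine ⟨δ, hδ, fun s x y hx hy hxy => ?_⟩
    rw [← map_sub, hp.group.norm_map, ← smul_sub, norm_smul, hn]
    have := H (U s x) (U s y) (by rwa [hp.group.norm_map]) (by rwa [hp.group.norm_map])
      (by rwa [hp.intertwine, hp.intertwine, ← map_sub, hp.group'.norm_map])
    rw [← map_sub, hp.group.norm_map] at this
    calc lam * _ ≤ lam * (L * ‖x - y‖ + ε / lam) := by gcongr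
      _ = _ := by field_simp

/-- Global existence for the abstract evolution equation, with the conservation laws. -/
theorem IsPotentialOp.exists_evolution {J : X →L[ℂ] Y} {N : X → X} {n : Y → Y} {e : Y → ℝ}
    {L : ℝ} (hN : IsPotentialOp J N n e L) {m : ℝ} {U : ℝ → X →L[ℂ] X}
    {V : ℝ → Y →L[ℂ] Y} (hp : IsGroupPair m J U V) {lam : ℝ} (hlam : 0 < lam) (x₀ : X) :
    ∃ ψ : ℝ → X, Continuous ψ ∧
      (∀ t, 0 ≤ t → J (ψ t) = V t (J x₀) +
        (Complex.I * lam) • ∫ s in (0 : ℝ)..t, V (t - s) (n (J (ψ s)))) ∧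
      (∀ t, 0 ≤ t → ‖J (ψ t)‖ = ‖J x₀‖) ∧
      (∀ t, 0 ≤ t → ‖ψ t‖ ^ 2 / 2 - lam * e (J (ψ t)) = ‖x₀‖ ^ 2 / 2 - lam * e (J x₀)) ∧
      ContDiff ℝ 1 fun t => gram J (ψ t) := by
  have hF : Continuous fun p : ℝ × X => U (-p.1) ((Complex.I * lam) • N (U p.1 p.2)) :=
    hp.group.continuous_apply continuous_fst.neg
      ((hN.continuous.comp (hp.group.continuous_apply continuous_fst continuous_snd)).const_smul _)
  obtain ⟨w, f, hw0, hf, hw, hfw⟩ := (hN.isWeaklyLipschitz hp hlam).exists_solution hF x₀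
  have hwc : Continuous w := continuous_iff_continuousAt.mpr fun t => (hw t).continuousAt
  set ψ : ℝ → X := fun t => U t (w t) with hψdef
  have hψ : Continuous ψ := hp.group.continuous_apply continuous_id hwc
  have hψ0 : ψ 0 = x₀ := by
    simp only [hψdef, hp.group.map_zero, hw0]; rfl
  have hUf : ∀ t, 0 ≤ t → U t (f t) = (Complex.I * lam) • N (ψ t) := fun t ht => by
    rw [hfw t ht, hp.group.apply_neg]
  have hz : ∀ t, HasDerivAt (fun s => gram J (ψ s))
      (-(Complex.I • (ψ t - (m : ℂ) • gram J (ψ t))) + gram J (U t (f t))) t := fun t =>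
    hp.hasDerivAt_gram (hw t)
  have hre : ∀ a : Y, (inner ℂ (n a) (Complex.I • a) : ℂ).re = 0 := by
    intro a
    have := hN.gauge a
    rw [inner_smul_right, Complex.I_mul_re, neg_eq_zero] at this ⊢
    rw [← inner_conj_symm, Complex.conj_im, this, neg_zero]
  refine ⟨ψ, hψ, fun t ht => ?_, fun t ht => ?_, fun t ht => ?_, ?_⟩
  · have h1 : w t = x₀ + ∫ s in (0 : ℝ)..t, f s := by
      rw [intervalIntegral.integral_eq_sub_of_hasDerivAt (fun s _ => hw s)
        (hf.intervalIntegrable _ _), hw0]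
      abel
    have h2 : V t (J (∫ s in (0 : ℝ)..t, f s)) = ∫ s in (0 : ℝ)..t, V t (J (f s)) :=
      ((((V t).comp J).restrictScalars ℝ).intervalIntegral_comp_comm
        (hf.intervalIntegrable 0 t)).symm
    rw [hp.intertwine, h1, map_add, map_add, h2, ← intervalIntegral.integral_smul]
    congr 1
    refine intervalIntegral.integral_congr fun s hs => ?_
    rw [uIcc_of_le ht] at hs
    rw [hfw s hs.1, hp.intertwine, ← ContinuousLinearMap.comp_apply (V t), ← hp.group'.map_add,
      ← sub_eq_add_neg, map_smul, map_smul, hN.map_apply]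
  · have h1 : ∀ s, ‖J (ψ s)‖ = ‖J (w s)‖ := fun s => by
      rw [hψdef]; simp only [hp.intertwine, hp.group'.norm_map]
    have h2 : ∀ s, HasDerivAt (fun s => ‖J (w s)‖ ^ 2)
        (2 * (inner ℂ (J (w s)) (J (f s)) : ℂ).re) s := fun s =>
      hasDerivAt_norm_sq ((J.restrictScalars ℝ).hasFDerivAt.comp_hasDerivAt s (hw s))
    have h3 : ∀ s, 0 ≤ s → (inner ℂ (J (w s)) (J (f s)) : ℂ).re = 0 := by
      intro s hs
      rw [← hp.group'.inner_map s, ← hp.intertwine, ← hp.intertwine, hUf s hs, map_smul,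
        hN.map_apply, mul_comm, mul_smul, inner_smul_right, Complex.re_ofReal_mul,
        hN.gauge (J (ψ s)), mul_zero]
    have h4 := constant_of_has_deriv_right_zero (f := fun s => ‖J (w s)‖ ^ 2) (a := 0) (b := t)
      (fun s _ => (h2 s).continuousAt.continuousWithinAt) (fun s hs => by
        have := h2 s
        rw [h3 s hs.1, mul_zero] at this
        exact this.hasDerivWithinAt) t (right_mem_Icc.mpr ht)
    simp only [hw0] at h4
    rw [h1]
    exact (sq_eq_sq₀ (norm_nonneg _) (norm_nonneg _)).mp h4
  · have h1 : ∀ s, ‖ψ s‖ = ‖w s‖ := fun s => hp.group.norm_map s (w s)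
    have h2 : ∀ s, HasDerivAt (fun s => ‖w s‖ ^ 2 / 2 - lam * e (J (ψ s)))
        (2 * (inner ℂ (w s) (f s) : ℂ).re / 2 - lam * (inner ℂ (N (ψ s))
          (-(Complex.I • (ψ s - (m : ℂ) • gram J (ψ s))) + gram J (U s (f s))) : ℂ).re) s :=
      fun s => ((hasDerivAt_norm_sq (hw s)).div_const 2).sub
        ((hN.hasDerivAt_potential hψ.continuousAt (hz s)).const_mul lam)
    have h3 : ∀ s, 0 ≤ s → 2 * (inner ℂ (w s) (f s) : ℂ).re / 2 - lam * (inner ℂ (N (ψ s))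
          (-(Complex.I • (ψ s - (m : ℂ) • gram J (ψ s))) + gram J (U s (f s))) : ℂ).re = 0 := by
      intro s hs
      -- The kinetic contribution `e1` cancels against `e4`; the shift term `e2` vanishes by gauge
      -- invariance, and `e3` because `⟨n, n⟩` is real.
      have e1 : (inner ℂ (w s) (f s) : ℂ).re = -(lam * (inner ℂ (ψ s) (N (ψ s)) : ℂ).im) := by
        rw [← hp.group.inner_map s, hUf s hs, inner_smul_right, mul_comm Complex.I, mul_assoc,
          Complex.re_ofReal_mul, Complex.I_mul_re, mul_neg]
      have e2 : (inner ℂ (N (ψ s)) (Complex.I • (m : ℂ) • gram J (ψ s)) : ℂ).re = 0 := by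
        rw [smul_comm, inner_smul_right, Complex.re_ofReal_mul, ← map_smul, inner_gram_right,
          hN.map_apply, map_smul, hre, mul_zero]
      have e3 : (inner ℂ (N (ψ s)) (gram J (U s (f s))) : ℂ).re = 0 := by
        have : (inner ℂ (J (N (ψ s))) (J (N (ψ s))) : ℂ).im = 0 := inner_self_im (𝕜 := ℂ) _
        rw [hUf s hs, inner_gram_right, map_smul, inner_smul_right, mul_comm Complex.I, mul_assoc,
          Complex.re_ofReal_mul, Complex.I_mul_re, this, neg_zero, mul_zero]
      have e4 : (inner ℂ (N (ψ s)) (Complex.I • ψ s) : ℂ).re = (inner ℂ (ψ s) (N (ψ s)) : ℂ).im := by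
        rw [inner_smul_right, Complex.I_mul_re, ← inner_conj_symm, Complex.conj_im, neg_neg]
      rw [inner_add_right, inner_neg_right, smul_sub, inner_sub_right, Complex.add_re,
        Complex.neg_re, Complex.sub_re, e1, e2, e3, e4]
      ring
    have h4 := constant_of_has_deriv_right_zero
      (f := fun s => ‖w s‖ ^ 2 / 2 - lam * e (J (ψ s))) (a := 0) (b := t)
      (fun s _ => (h2 s).continuousAt.continuousWithinAt) (fun s hs => by
        have := h2 s
        rw [h3 s hs.1] at this
        exact this.hasDerivWithinAt) t (right_mem_Icc.mpr ht)
    simp only [hw0, hψ0] at h4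
    rw [h1]
    exact h4
  · rw [contDiff_one_iff_deriv]
    refine ⟨fun t => (hz t).differentiableAt, ?_⟩
    rw [funext fun t => (hz t).deriv]
    have h1 : Continuous fun t => U t (f t) := hp.group.continuous_apply continuous_id hf
    have h2 := (gram J).continuous
    exact ((hψ.sub ((h2.comp hψ).const_smul _)).const_smul _).neg.add (h2.comp h1)

end Evolution

/-! ### The truncated power nonlinearity -/

/-- The power nonlinearity `|z|^{2μ} z`. -/
def powerFun (μ : ℝ) (z : ℂ) : ℂ := ((‖z‖ ^ 2) ^ μ : ℝ) • z

theorem tendsto_norm_sq_rpow {μ : ℝ} (hμ : 0 < μ) :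
    Tendsto (fun z : ℂ => (‖z‖ ^ 2) ^ μ) (𝓝 0) (𝓝 0) := by
  have : Continuous fun z : ℂ => (‖z‖ ^ 2) ^ μ :=
    (continuous_norm.pow 2).rpow_const fun _ => Or.inr hμ.le
  have h := this.tendsto 0
  simpa [Real.zero_rpow hμ.ne'] using h

theorem hasFDerivAt_powerFun_zero {μ : ℝ} (hμ : 0 < μ) :
    HasFDerivAt (powerFun μ) (0 : ℂ →L[ℝ] ℂ) 0 := by
  rw [hasFDerivAt_iff_isLittleO]
  have h1 : (fun z : ℂ => ((‖z‖ ^ 2) ^ μ : ℝ)) =o[𝓝 0] fun _ => (1 : ℝ) := by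
    rw [Asymptotics.isLittleO_one_iff]
    exact tendsto_norm_sq_rpow hμ
  have h2 := h1.smul_isBigO (Asymptotics.isBigO_refl (fun z : ℂ => z) (𝓝 0))
  simpa [powerFun] using h2

theorem hasFDerivAt_powerFun (μ : ℝ) {z : ℂ} (hz : z ≠ 0) :
    HasFDerivAt (powerFun μ) (((‖z‖ ^ 2) ^ μ : ℝ) • ContinuousLinearMap.id ℝ ℂ +
      ((μ * (‖z‖ ^ 2) ^ (μ - 1)) • (2 • innerSL ℝ z)).smulRight z) z := by
  have h1 : HasFDerivAt (fun z : ℂ => ‖z‖ ^ 2) (2 • innerSL ℝ z) z :=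
    (hasStrictFDerivAt_norm_sq z).hasFDerivAt
  have h2 := h1.rpow_const (p := μ) (Or.inl (by positivity))
  exact h2.smul (hasFDerivAt_id z)

theorem norm_fderiv_powerFun_le {μ : ℝ} (hμ : 0 < μ) (z : ℂ) :
    ‖fderiv ℝ (powerFun μ) z‖ ≤ (1 + 2 * μ) * (‖z‖ ^ 2) ^ μ := by
  rcases eq_or_ne z 0 with rfl | hz
  · rw [(hasFDerivAt_powerFun_zero hμ).fderiv, norm_zero]
    positivity
  · rw [(hasFDerivAt_powerFun μ hz).fderiv]
    have hzn : 0 < ‖z‖ ^ 2 := by positivity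
    refine (norm_add_le _ _).trans ?_
    have h1 : ‖((‖z‖ ^ 2) ^ μ : ℝ) • ContinuousLinearMap.id ℝ ℂ‖ ≤ (‖z‖ ^ 2) ^ μ := by
      rw [norm_smul, Real.norm_of_nonneg (by positivity)]
      exact mul_le_of_le_one_right (by positivity) ContinuousLinearMap.norm_id_le
    have h2 : ‖((μ * (‖z‖ ^ 2) ^ (μ - 1)) • (2 • innerSL ℝ z)).smulRight z‖ ≤
        2 * μ * (‖z‖ ^ 2) ^ μ := by
      rw [ContinuousLinearMap.norm_smulRight_apply, norm_smul, Real.norm_of_nonneg (by positivity)]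
      have h3 : ‖2 • innerSL ℝ z‖ ≤ 2 * ‖z‖ := by
        rw [two_smul, two_mul]
        exact (norm_add_le _ _).trans (by rw [innerSL_apply_norm])
      calc μ * (‖z‖ ^ 2) ^ (μ - 1) * ‖2 • innerSL ℝ z‖ * ‖z‖
          ≤ μ * (‖z‖ ^ 2) ^ (μ - 1) * (2 * ‖z‖) * ‖z‖ := by gcongr
        _ = 2 * μ * ((‖z‖ ^ 2) ^ (μ - 1) * ‖z‖ ^ 2) := by ring
        _ = 2 * μ * (‖z‖ ^ 2) ^ μ := by
          rw [← Real.rpow_add_one hzn.ne', sub_add_cancel]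
    linarith

/-- Only the origin is delicate: there the derivative is bounded by a multiple of `|z|^{2μ}`, which
tends to `0` for every `μ > 0`. -/
theorem contDiff_powerFun {μ : ℝ} (hμ : 0 < μ) : ContDiff ℝ 1 (powerFun μ) := by
  rw [contDiff_one_iff_fderiv]
  refine ⟨fun z => ?_, continuous_iff_continuousAt.mpr fun z => ?_⟩
  · rcases eq_or_ne z 0 with rfl | hz
    · exact (hasFDerivAt_powerFun_zero hμ).differentiableAt
    · exact (hasFDerivAt_powerFun μ hz).differentiableAt
  · rcases eq_or_ne z 0 with rfl | hz
    · rw [ContinuousAt, (hasFDerivAt_powerFun_zero hμ).fderiv]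
      refine squeeze_zero_norm (norm_fderiv_powerFun_le hμ) ?_
      simpa using (tendsto_norm_sq_rpow hμ).const_mul (1 + 2 * μ)
    · have : ContDiffAt ℝ 1 (powerFun μ) z := by
        have h1 : ContDiffAt ℝ 1 (fun z : ℂ => ‖z‖ ^ 2) z := (contDiff_norm_sq ℝ).contDiffAt
        have h2 : ContDiffAt ℝ 1 (fun z : ℂ => (‖z‖ ^ 2) ^ μ) z :=
          h1.rpow_const_of_ne (by positivity)
        exact h2.smul contDiffAt_id
      exact this.continuousAt_fderiv one_ne_zero

/-- A smooth cut-off function on the half-line, equal to `1` on `[0, K²]` and to `0` on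
`[2K², ∞)`. -/
def cutoff (K s : ℝ) : ℝ := Real.smoothTransition (2 - s / K ^ 2)

/-- The power nonlinearity, truncated to `|z| ≤ √2 K`. -/
def truncFun (μ K : ℝ) (z : ℂ) : ℂ := cutoff K (‖z‖ ^ 2) • powerFun μ z

/-- The potential of the truncated power nonlinearity. -/
def truncPotential (μ K : ℝ) (z : ℂ) : ℝ :=
  (1 / 2) * ∫ s in (0 : ℝ)..(‖z‖ ^ 2), cutoff K s * s ^ μ

theorem contDiff_cutoff (K : ℝ) : ContDiff ℝ 1 (cutoff K) :=
  Real.smoothTransition.contDiff.comp (by fun_prop)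

theorem contDiff_truncFun {μ : ℝ} (hμ : 0 < μ) (K : ℝ) : ContDiff ℝ 1 (truncFun μ K) :=
  ((contDiff_cutoff K).comp (contDiff_norm_sq ℝ)).smul (contDiff_powerFun hμ)

theorem hasCompactSupport_truncFun (μ : ℝ) {K : ℝ} (hK : 0 < K) :
    HasCompactSupport (truncFun μ K) := by
  refine HasCompactSupport.intro (isCompact_closedBall (0 : ℂ) (2 * K)) fun z hz => ?_
  rw [mem_closedBall_zero_iff, not_le] at hz
  have : cutoff K (‖z‖ ^ 2) = 0 := by
    refine Real.smoothTransition.zero_of_nonpos ?_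
    rw [sub_nonpos, le_div_iff₀ (by positivity)]
    nlinarith
  rw [truncFun, this, zero_smul]

theorem exists_isTame {μ : ℝ} (hμ : 0 < μ) {K : ℝ} (hK : 0 < K) :
    ∃ L : NNReal, 0 < L ∧ IsTame (truncFun μ K) (truncPotential μ K) L := by
  have hc := contDiff_truncFun hμ K
  have hs := (hasCompactSupport_truncFun μ hK).fderiv (𝕜 := ℝ)
  have hcf := hc.continuous_fderiv one_ne_zero
  obtain ⟨C, hC⟩ := hs.exists_bound_of_continuous hcf
  -- Compact support of the derivative gives both its bound and its uniform continuity; the maximum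
  -- with `1` makes the constant positive.
  refine ⟨⟨max C 1, by positivity⟩, ?_, hc, fun z => (hC z).trans (le_max_left _ _),
    hs.uniformContinuous_of_continuous hcf, fun z => ?_, by simp [truncPotential], fun z => ?_⟩
  · exact lt_of_lt_of_le one_pos (show (1 : ℝ) ≤ max C 1 from le_max_right _ _)
  · refine ⟨cutoff K (‖z‖ ^ 2) * (‖z‖ ^ 2) ^ μ, ?_⟩
    rw [truncFun, powerFun, smul_smul]
    rfl
  · have hk : Continuous fun s : ℝ => cutoff K s * s ^ μ :=
      (contDiff_cutoff K).continuous.mul (continuous_id.rpow_const fun _ => Or.inr hμ.le)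
    have h1 : HasFDerivAt (fun z : ℂ => ‖z‖ ^ 2) (2 • innerSL ℝ z) z :=
      (hasStrictFDerivAt_norm_sq z).hasFDerivAt
    have h2 := (hk.integral_hasStrictDerivAt 0 (‖z‖ ^ 2)).hasDerivAt.comp_hasFDerivAt z h1
    refine (h2.const_mul (1 / 2)).congr_fderiv ?_
    ext w
    simp only [truncFun, powerFun, smul_smul, innerSL_apply_apply, inner_smul_left, smul_apply,
      smul_eq_mul, nsmul_eq_mul, RCLike.conj_to_real]
    push_cast
    ring

theorem truncFun_eq (μ : ℝ) {K : ℝ} (hK : 0 < K) {z : ℂ} (hz : ‖z‖ ≤ K) :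
    truncFun μ K z = (‖z‖ ^ (2 * μ) : ℝ) • z := by
  have h1 : cutoff K (‖z‖ ^ 2) = 1 := by
    refine Real.smoothTransition.one_of_one_le ?_
    have : ‖z‖ ^ 2 / K ^ 2 ≤ 1 := by
      rw [div_le_one (by positivity)]
      gcongr
    linarith
  have h2 : (‖z‖ ^ 2) ^ μ = ‖z‖ ^ (2 * μ) := by
    rw [Real.rpow_mul (norm_nonneg z), Real.rpow_two]
  rw [truncFun, h1, one_smul, powerFun, h2]

/-- The bound is free of `K`, which is what allows the truncation level to be fixed after the a
priori estimate. -/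
theorem truncPotential_le {μ : ℝ} (hμ : 0 < μ) (K : ℝ) (z : ℂ) :
    truncPotential μ K z ≤ ‖z‖ ^ (2 * μ) * ‖z‖ ^ 2 := by
  have hk : Continuous fun s : ℝ => cutoff K s * s ^ μ :=
    (contDiff_cutoff K).continuous.mul (continuous_id.rpow_const fun _ => Or.inr hμ.le)
  have h2 : (‖z‖ ^ 2) ^ μ = ‖z‖ ^ (2 * μ) := by
    rw [Real.rpow_mul (norm_nonneg z), Real.rpow_two]
  have h1 : ∫ s in (0 : ℝ)..(‖z‖ ^ 2), cutoff K s * s ^ μ ≤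
      ∫ _ in (0 : ℝ)..(‖z‖ ^ 2), (‖z‖ ^ 2) ^ μ := by
    refine intervalIntegral.integral_mono_on (by positivity) (hk.intervalIntegrable _ _) (by simp)
      fun s hs => ?_
    calc cutoff K s * s ^ μ ≤ 1 * s ^ μ := by
          gcongr
          · exact Real.rpow_nonneg hs.1 _
          · exact Real.smoothTransition.le_one _
      _ ≤ (‖z‖ ^ 2) ^ μ := by
          rw [one_mul]
          exact Real.rpow_le_rpow hs.1 hs.2 hμ.le
  rw [intervalIntegral.integral_const, smul_eq_mul, sub_zero, h2] at h1
  have h3 : 0 ≤ ‖z‖ ^ 2 * ‖z‖ ^ (2 * μ) := by positivity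
  rw [truncPotential]
  linarith

theorem truncPotential_nonneg (μ K : ℝ) (z : ℂ) : 0 ≤ truncPotential μ K z := by
  refine mul_nonneg (by norm_num) (intervalIntegral.integral_nonneg (by positivity) fun s hs => ?_)
  exact mul_nonneg (Real.smoothTransition.nonneg _) (Real.rpow_nonneg hs.1 _)

/-! ### The nonlinear Schrödinger flow -/

/-- Gagliardo–Nirenberg: `s = √β / √ρ` balances the two terms of the supremum bound. -/
theorem Q.ae_norm_le {u : Q} {β ρ : ℝ} (hβ : 0 < β) (hρ : 0 < ρ) (h1 : ‖u.toL2‖ ≤ β)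
    (h2 : ‖u‖ ≤ ρ) : ∀ᵐ x, ‖u.toL2 x‖ ≤ 2 * √(β * ρ) := by
  have hp : 0 < √β := Real.sqrt_pos.mpr hβ
  have hq : 0 < √ρ := Real.sqrt_pos.mpr hρ
  have hs : 0 < √β / √ρ := div_pos hp hq
  filter_upwards [(Q.hasPrim u).ae_norm_le hs] with x hx
  have h3 : (√β / √ρ)⁻¹ * ‖u.toL2‖ ≤ √β * √ρ := by
    calc (√β / √ρ)⁻¹ * ‖u.toL2‖ ≤ (√β / √ρ)⁻¹ * (√β * √β) := by
          rw [Real.mul_self_sqrt hβ.le]; gcongr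
      _ = √β * √ρ := by field_simp
  have h4 : √β / √ρ * ‖Q.der u‖ ≤ √β * √ρ := by
    calc √β / √ρ * ‖Q.der u‖ ≤ √β / √ρ * (√ρ * √ρ) := by
          rw [Real.mul_self_sqrt hρ.le]; gcongr; exact (Q.norm_der_le u).trans h2
      _ = √β * √ρ := by field_simp
  rw [Real.sqrt_mul hβ.le]
  linarith

/-- As `ρ^μ ≥ 1`, the constant `A` is absorbed into `A ρ^μ`, and dividing by `ρ^μ` leaves a positive
power of `ρ`. This is where subcriticality enters. -/
theorem le_rpow_of_sq_le {A B μ ρ : ℝ} (hA : 0 ≤ A) (hμ₀ : 0 < μ) (hμ : μ < 2) (h1 : 1 ≤ ρ)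
    (h : ρ ^ 2 ≤ A + B * ρ ^ μ) : ρ ≤ (A + B) ^ (2 - μ)⁻¹ := by
  have hρ : 0 < ρ := by linarith
  have h2 : 1 ≤ ρ ^ μ := Real.one_le_rpow h1 hμ₀.le
  have h3 : ρ ^ (2 - μ) * ρ ^ μ = ρ ^ 2 := by
    rw [← Real.rpow_add hρ, sub_add_cancel, Real.rpow_two]
  have h4 : ρ ^ (2 - μ) ≤ A + B := by
    refine le_of_mul_le_mul_right ?_ (by linarith : 0 < ρ ^ μ)
    rw [h3]
    nlinarith
  calc ρ = (ρ ^ (2 - μ)) ^ (2 - μ)⁻¹ := by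
        rw [← Real.rpow_mul hρ.le, mul_inv_cancel₀ (by linarith), Real.rpow_one]
    _ ≤ _ := Real.rpow_le_rpow (by positivity) h4 (inv_nonneg.mpr (by linarith))

theorem IsTame.energy_truncPotential_le {μ K k : ℝ} {L : NNReal} (hμ : 0 < μ)
    (h : IsTame (truncFun μ K) (truncPotential μ K) L) {f : L2} (hf : ∀ᵐ x, ‖f x‖ ≤ k) :
    h.energy f ≤ k ^ (2 * μ) * ‖f‖ ^ 2 := by
  rw [IsTame.energy, norm_sq_eq_integral, ← integral_const_mul]
  refine integral_mono_ae (h.integrable_potential f)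
    (((Lp.memLp f).integrable_norm_pow (by norm_num)).const_mul _) ?_
  filter_upwards [hf] with x hx
  refine (truncPotential_le hμ K (f x)).trans ?_
  gcongr

theorem IsTame.energy_truncPotential_nonneg {μ K : ℝ} {L : NNReal}
    (h : IsTame (truncFun μ K) (truncPotential μ K) L) (f : L2) : 0 ≤ h.energy f :=
  integral_nonneg fun x => truncPotential_nonneg μ K (f x)

/-- The subcritical nonlinearity is controlled by the conserved quantities. -/
theorem exists_sup_bound {γ lam μ : ℝ} (hγ : 0 < γ) (hlam : 0 < lam) (hμ₀ : 0 < μ) (hμ : μ < 2)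
    {S : Q ≃L[ℂ] Q} (hS : ∀ u v, inner ℂ (S u) (S v) = Q.form γ (Q.shift γ) u v) (ψ₀ : Q) :
    ∃ K > 0, ∀ (K' : ℝ) (L : NNReal) (h : IsTame (truncFun μ K') (truncPotential μ K') L) (φ : Q),
      ‖φ.toL2‖ = ‖ψ₀.toL2‖ →
      ‖S φ‖ ^ 2 / 2 - lam * h.energy φ.toL2 = ‖S ψ₀‖ ^ 2 / 2 - lam * h.energy ψ₀.toL2 →
      ∀ᵐ x, ‖φ.toL2 x‖ ≤ K := by
  set β : ℝ := ‖ψ₀.toL2‖ + 1 with hβdef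
  have hβ : 0 < β := by positivity
  -- Coercivity and energy conservation give `‖φ‖² ≤ 2‖S ψ₀‖² + 4 lam · energy(φ)`, once the
  -- nonnegative initial potential energy is dropped. With `ρ = ‖φ‖ + 1` and `ρ² ≤ 2‖φ‖² + 2` these
  -- constants result.
  set A : ℝ := 4 * ‖S ψ₀‖ ^ 2 + 2
  set B : ℝ := 8 * lam * (4 * β) ^ μ * β ^ 2
  set M : ℝ := (A + B) ^ (2 - μ)⁻¹
  refine ⟨2 * √(β * M) + 1, by positivity, fun K' L h φ h1 h2 => ?_⟩
  set ρ : ℝ := ‖φ‖ + 1 with hρdef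
  have hρ : 1 ≤ ρ := by linarith [norm_nonneg φ]
  have hρ0 : 0 < ρ := by linarith
  have hsup := Q.ae_norm_le (u := φ) hβ hρ0 (by linarith) (by linarith)
  have hk : (2 * √(β * ρ)) ^ (2 * μ) = (4 * β) ^ μ * ρ ^ μ := by
    rw [Real.rpow_mul (by positivity), Real.rpow_two, mul_pow, Real.sq_sqrt (by positivity),
      ← Real.mul_rpow (by positivity) (by positivity)]
    congr 1
    ring
  have he := h.energy_truncPotential_le hμ₀ hsup
  rw [hk, h1] at he
  have he' : h.energy φ.toL2 ≤ (4 * β) ^ μ * ρ ^ μ * β ^ 2 := he.trans (by gcongr; linarith)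
  have he0 := mul_nonneg hlam.le (h.energy_truncPotential_nonneg ψ₀.toL2)
  have hc := Q.form_coercive hγ φ
  have hSφ : ‖S φ‖ ^ 2 = (Q.form γ (Q.shift γ) φ φ).re := by
    rw [← hS]
    exact (inner_self_eq_norm_sq (𝕜 := ℂ) (S φ)).symm
  have h3 := mul_le_mul_of_nonneg_left he' hlam.le
  have h4 : ρ ^ 2 ≤ A + B * ρ ^ μ := by
    have : ρ ^ 2 ≤ 2 * ‖φ‖ ^ 2 + 2 := by nlinarith [sq_nonneg (‖φ‖ - 1)]
    simp only [A, B]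
    nlinarith
  have h5 : ρ ≤ M := le_rpow_of_sq_le (by positivity) hμ₀ hμ hρ h4
  filter_upwards [hsup] with x hx
  have : √(β * ρ) ≤ √(β * M) := by gcongr
  linarith

/-- On bounded sets of `Q`, closeness in `L²` implies uniform closeness by interpolation, so the
hypothesis of `exists_norm_compQ_sub_le` can be replaced by one on the weak norm. -/
theorem IsTame.exists_norm_conj_compQ_sub_le {N : ℂ → ℂ} {G : ℂ → ℝ} {L : NNReal}
    (h : IsTame N G L) {S : Q ≃L[ℂ] Q} {a b : ℝ} (ha : 0 ≤ a) (hb : 0 ≤ b)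
    (hSa : ∀ u, ‖S u‖ ≤ a * ‖u‖) (hSb : ∀ u, ‖S.symm u‖ ≤ b * ‖u‖) {ε : ℝ} (hε : 0 < ε) (M : ℝ) :
    ∃ δ > 0, ∀ x y, ‖x‖ ≤ M → ‖y‖ ≤ M → ‖(S.symm x).toL2 - (S.symm y).toL2‖ ≤ δ →
      ‖S (h.compQ (S.symm x)) - S (h.compQ (S.symm y))‖ ≤ L * (1 + a * b) * ‖x - y‖ + ε := by
  have hM : 0 ≤ a * b * |M| := by positivity
  set ε' : ℝ := ε / (a * b * |M| + 1) with hε'def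
  have hε' : 0 < ε' := by positivity
  have h7 : a * (ε' * (b * |M|)) ≤ ε := by
    have : a * (ε' * (b * |M|)) = ε * ((a * b * |M|) / (a * b * |M| + 1)) := by
      rw [hε'def]
      ring
    rw [this]
    exact mul_le_of_le_one_right hε.le ((div_le_one (by positivity)).mpr (by linarith))
  obtain ⟨δ, hδ, H⟩ := h.exists_norm_compQ_sub_le hε'
  set ρ : ℝ := 2 * (b * |M|) + 1 with hρdef
  have hρ : 0 < ρ := by positivity
  -- The `L²` threshold `δ² / (4ρ)` is the one for which interpolation returns exactly `δ`.
  have h4 : 2 * √(δ ^ 2 / (4 * ρ) * ρ) = δ := by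
    have : δ ^ 2 / (4 * ρ) * ρ = (δ / 2) ^ 2 := by field_simp; norm_num
    rw [this, Real.sqrt_sq (by positivity)]
    ring
  refine ⟨δ ^ 2 / (4 * ρ), by positivity, fun x y hx hy hxy => ?_⟩
  have hx' : ‖S.symm x‖ ≤ b * |M| :=
    (hSb x).trans (mul_le_mul_of_nonneg_left (hx.trans (le_abs_self M)) hb)
  have hy' : ‖S.symm y‖ ≤ b * |M| :=
    (hSb y).trans (mul_le_mul_of_nonneg_left (hy.trans (le_abs_self M)) hb)
  rw [← map_sub] at hxy
  have h2 : ‖S.symm x - S.symm y‖ ≤ ρ := (_root_.norm_sub_le _ _).trans (by linarith)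
  have h3 := Q.ae_norm_le (by positivity) hρ hxy h2
  rw [h4] at h3
  have h5 := H (S.symm x) (S.symm y) <| by
    filter_upwards [h3, Lp.coeFn_sub (S.symm x).toL2 (S.symm y).toL2] with z hz hz'
    rw [map_sub, hz'] at hz
    exact hz
  have h6 : ‖S.symm x - S.symm y‖ ≤ b * ‖x - y‖ := by
    rw [← map_sub]; exact hSb _
  have hL : (0 : ℝ) ≤ L := L.2
  have h8 : (L : ℝ) * ‖S.symm x - S.symm y‖ + ε' * ‖S.symm y‖ ≤
      L * (b * ‖x - y‖) + ε' * (b * |M|) :=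
    add_le_add (mul_le_mul_of_nonneg_left h6 hL) (mul_le_mul_of_nonneg_left hy' hε'.le)
  have h9 : ‖S (h.compQ (S.symm x)) - S (h.compQ (S.symm y))‖ ≤
      a * (L * (b * ‖x - y‖) + ε' * (b * |M|)) := by
    rw [← map_sub]
    exact (hSa _).trans (mul_le_mul_of_nonneg_left (h5.trans h8) ha)
  have h10 := mul_nonneg hL (norm_nonneg (x - y))
  linarith

theorem IsTame.isPotentialOp {N : ℂ → ℂ} {G : ℂ → ℝ} {L : NNReal} (hL : 0 < L)
    (h : IsTame N G L) {S : Q ≃L[ℂ] Q} {J : Q →L[ℂ] L2} (hJ : ∀ u, J (S u) = u.toL2) :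
    IsPotentialOp J (fun x => S (h.compQ (S.symm x))) h.comp h.energy
      (L * (1 + ‖(S : Q →L[ℂ] Q)‖ * ‖(S.symm : Q →L[ℂ] Q)‖)) := by
  set a := ‖(S : Q →L[ℂ] Q)‖
  set b := ‖(S.symm : Q →L[ℂ] Q)‖
  have ha : 0 ≤ a := (S : Q →L[ℂ] Q).opNorm_nonneg
  have hb : 0 ≤ b := (S.symm : Q →L[ℂ] Q).opNorm_nonneg
  have hL' : (0 : ℝ) < L := hL
  have hSa : ∀ u, ‖S u‖ ≤ a * ‖u‖ := fun u => (S : Q →L[ℂ] Q).le_opNorm u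
  have hSb : ∀ u, ‖S.symm u‖ ≤ b * ‖u‖ := fun u => (S.symm : Q →L[ℂ] Q).le_opNorm u
  have hJ' : ∀ x, J x = (S.symm x).toL2 := fun x => by rw [← hJ, S.apply_symm_apply]
  have hLL : (L : ℝ) ≤ L * (1 + a * b) := le_mul_of_one_le_right hL'.le (by nlinarith)
  refine ⟨by positivity, fun x => ?_, fun f g => ?_, fun x => ?_, fun ε hε M => ?_,
    h.re_inner_comp, fun f g => ?_⟩
  · rw [hJ, h.toL2_compQ, hJ']
  · exact (h.lipschitz_comp.norm_sub_le f g).trans (by gcongr)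
  · calc ‖S (h.compQ (S.symm x))‖ ≤ a * (L * (b * ‖x‖)) := by
          refine (hSa _).trans (mul_le_mul_of_nonneg_left ((h.norm_compQ_le _).trans ?_) ha)
          exact mul_le_mul_of_nonneg_left (hSb x) hL'.le
      _ ≤ L * (1 + a * b) * ‖x‖ := by nlinarith [mul_nonneg hL'.le (norm_nonneg x)]
  · simp only [hJ']
    exact h.exists_norm_conj_compQ_sub_le ha hb hSa hSb hε M
  · exact (h.abs_energy_sub_le f g).trans (by gcongr)

/-- Below `K` the cut-off equals `1`. Membership of the power in `L²` comes for free from the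
truncated operator, which settles the case distinction in `nonlinearity`. -/
theorem nonlinearity_eq_comp {μ K : ℝ} {L : NNReal} (hK : 0 < K)
    (h : IsTame (truncFun μ K) (truncPotential μ K) L) {f : L2} (hf : ∀ᵐ x, ‖f x‖ ≤ K) :
    nonlinearity μ f = h.comp f := by
  have h1 : h.comp f =ᵐ[volume] fun x => (‖f x‖ ^ (2 * μ) : ℝ) • f x := by
    filter_upwards [hf, h.coeFn_comp f] with x hx h2
    rw [h2, truncFun_eq μ hK hx]
  have h2 := (memLp_congr_ae h1).mp (Lp.memLp (h.comp f))
  rw [nonlinearity, dif_pos h2]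
  exact Lp.ext (h2.coeFn_toLp.trans h1.symm)

theorem contDiff_innerSL_comp {X Z : Type*} [NormedAddCommGroup X] [InnerProductSpace ℂ X]
    [NormedAddCommGroup Z] [NormedSpace ℂ Z] (A : Z →L[ℂ] X) {f : ℝ → X} (hf : ContDiff ℝ 1 f) :
    ContDiff ℝ 1 fun t => (innerSL ℂ (f t)).comp A := by
  have h : IsBoundedLinearMap ℝ fun x : X => (innerSL ℂ x).comp A := by
    refine IsLinearMap.with_bound ⟨fun x y => ?_, fun c x => ?_⟩ ‖A‖ fun x => ?_
    · ext z
      simp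
    · ext z
      change inner ℂ (c • x) (A z) = c • inner ℂ x (A z)
      rw [← Complex.coe_smul, inner_smul_left, Complex.conj_ofReal]
      rfl
    · refine ((innerSL ℂ x).opNorm_comp_le A).trans ?_
      rw [innerSL_apply_norm, mul_comm]
  have h' : ContDiff ℝ 1 fun x : X => (innerSL ℂ x).comp A := h.contDiff
  exact h'.comp hf

theorem exists_global_solution {γ lam μ : ℝ} (hγ : 0 < γ) (hlam : 0 < lam) (hμ₀ : 0 < μ)
    (hμ : μ < 2) (ψ₀ : Q) : ∃ Ψ : ℝ → Q, IsWeakSolution γ lam μ ψ₀ ⊤ Ψ ∧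
      ContDiff ℝ 1 fun t => Q.toDual (Ψ t) := by
  obtain ⟨S, J, U, hJ, hS, hp⟩ := exists_isGroupPair hγ
  obtain ⟨K, hK, hbd⟩ := exists_sup_bound hγ hlam hμ₀ hμ hS ψ₀
  obtain ⟨L, hL, h⟩ := exists_isTame hμ₀ hK
  obtain ⟨ψ, hψ, hd, hm, he, hg⟩ := (h.isPotentialOp hL hJ).exists_evolution hp hlam (S ψ₀)
  have hJ' : ∀ x, J x = (S.symm x).toL2 := fun x => by rw [← hJ, S.apply_symm_apply]
  simp only [hJ] at hd hm he
  simp only [hJ'] at hd hm he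
  have hsup : ∀ t, 0 ≤ t → ∀ᵐ x, ‖(S.symm (ψ t)).toL2 x‖ ≤ K := fun t ht =>
    hbd K L h _ (hm t ht) (by rw [S.apply_symm_apply]; exact he t ht)
  refine ⟨fun t => S.symm (ψ t), ⟨EReal.coe_lt_top 0,
    (S.symm.continuous.comp hψ).continuousOn, fun t ht => ?_⟩, ?_⟩
  · refine (hd t ht.1).trans (congrArg _ (congrArg _ ?_))
    refine intervalIntegral.integral_congr fun s hs => ?_
    rw [uIcc_of_le ht.1] at hs
    exact congrArg _ (nonlinearity_eq_comp hK h (hsup s hs.1)).symm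
  -- In the energy inner product the embedding into `Q*` is represented by `gram J`, so `C¹` in `Q*`
  -- follows from `C¹` of `gram J ψ`.
  · have e : (fun t => Q.toDual (S.symm (ψ t))) =
        fun t => ((innerSL ℂ (gram J (ψ t))).comp (S : Q →L[ℂ] Q)) := by
      funext t
      ext v
      change inner ℂ (S.symm (ψ t)).toL2 v.toL2 = inner ℂ (gram J (ψ t)) (S v)
      rw [inner_gram_left, hJ, hJ']
    rw [e]
    exact contDiff_innerSL_comp (S : Q →L[ℂ] Q) hg

/-! ### Uniqueness of weak solutions -/

theorem eqOn_of_duhamel {Y : Type*} [NormedAddCommGroup Y] [InnerProductSpace ℂ Y]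
    [CompleteSpace Y] {V : ℝ → Y →L[ℂ] Y} (hV : IsIsometricGroup V) {n : Y → Y} {L : NNReal}
    (hn : LipschitzWith L n) (c : ℂ) (y₀ : Y) {f g : ℝ → Y} {t : ℝ} (ht : 0 ≤ t)
    (hf : ContinuousOn f (Icc 0 t)) (hg : ContinuousOn g (Icc 0 t))
    (hfd : ∀ s ∈ Icc 0 t, f s = V s y₀ + c • ∫ r in (0 : ℝ)..s, V (s - r) (n (f r)))
    (hgd : ∀ s ∈ Icc 0 t, g s = V s y₀ + c • ∫ r in (0 : ℝ)..s, V (s - r) (n (g r))) :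
    EqOn f g (Icc 0 t) := by
  -- Gronwall's inequality is applied to the primitive of `d`, as `d` itself is only continuous. The
  -- constant extension beyond `[0, t]` makes that primitive differentiable everywhere.
  set d : ℝ → ℝ := IccExtend ht ((Icc 0 t).domRestrict fun s => ‖f s - g s‖)
  have hd : Continuous d := (hf.sub hg).norm.domRestrict.Icc_extend'
  have hde : ∀ s ∈ Icc 0 t, d s = ‖f s - g s‖ := fun s hs => IccExtend_of_mem _ _ hs
  have hd0 : ∀ s, 0 ≤ d s := fun s => norm_nonneg _
  have hD : ∀ s, HasDerivAt (fun s => ∫ r in (0 : ℝ)..s, d r) (d s) s := fun s =>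
    hd.integral_hasStrictDerivAt 0 s |>.hasDerivAt
  have hle : ∀ s ∈ Icc 0 t, d s ≤ ‖c‖ * L * ∫ r in (0 : ℝ)..s, d r := by
    intro s hs
    have hsub : Icc 0 s ⊆ Icc 0 t := Icc_subset_Icc_right hs.2
    have hi : ∀ {k : ℝ → Y}, ContinuousOn k (Icc 0 t) →
        IntervalIntegrable (fun r => V (s - r) (n (k r))) volume 0 s := fun hk => by
      refine ContinuousOn.intervalIntegrable_of_Icc hs.1 ?_
      exact hV.continuousOn_apply (continuousOn_const.sub continuousOn_id)
        (hn.continuous.comp_continuousOn (hk.mono hsub))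
    rw [hde s hs, hfd s hs, hgd s hs, add_sub_add_left_eq_sub, ← smul_sub,
      ← intervalIntegral.integral_sub (hi hf) (hi hg), norm_smul, mul_assoc,
      ← intervalIntegral.integral_const_mul]
    refine mul_le_mul_of_nonneg_left ?_ (norm_nonneg c)
    refine intervalIntegral.norm_integral_le_of_norm_le hs.1 ?_
      ((hd.const_mul _).intervalIntegrable _ _)
    refine Eventually.of_forall fun r hr => ?_
    rw [← map_sub, hV.norm_map, hde r (hsub ⟨hr.1.le, hr.2⟩)]
    exact hn.norm_sub_le _ _
  have hD0 : ∀ s, 0 ≤ s → 0 ≤ ∫ r in (0 : ℝ)..s, d r := fun s hs =>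
    intervalIntegral.integral_nonneg hs fun r _ => hd0 r
  intro s hs
  have h1 := norm_le_gronwallBound_of_norm_deriv_right_le (f := fun s => ∫ r in (0 : ℝ)..s, d r)
    (f' := d) (δ := 0) (K := ‖c‖ * L) (ε := 0) (a := 0) (b := t)
    (fun s _ => (hD s).continuousAt.continuousWithinAt) (fun s _ => (hD s).hasDerivWithinAt)
    (by simp) (fun s hs => by
      rw [Real.norm_of_nonneg (hd0 s), Real.norm_of_nonneg (hD0 s hs.1), add_zero]
      exact hle s ⟨hs.1, hs.2.le⟩) s hs
  rw [gronwallBound_ε0, zero_mul, norm_le_zero_iff] at h1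
  have h2 := hle s hs
  simp only [h1, mul_zero] at h2
  rw [hde s hs, norm_le_zero_iff, sub_eq_zero] at h2
  exact h2

/-- On `[0, t]` both solutions are bounded in `Q`, hence in the supremum norm, so a truncation above
both, at a level depending on `t`, makes the nonlinearity Lipschitz in `L²`. -/
theorem IsWeakSolution.eqOn {γ lam μ : ℝ} (hγ : 0 < γ) (hμ₀ : 0 < μ) {ψ₀ : Q} {T T' : EReal}
    {ψ Ψ : ℝ → Q} (h : IsWeakSolution γ lam μ ψ₀ T ψ) (h' : IsWeakSolution γ lam μ ψ₀ T' Ψ)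
    (hT : T ≤ T') : EqOn ψ Ψ (timeInterval T) := by
  intro t ht
  obtain ⟨S, J, U, hJ, hS, hp⟩ := exists_isGroupPair hγ
  have hsub : Icc 0 t ⊆ timeInterval T := fun s hs =>
    ⟨hs.1, lt_of_le_of_lt (EReal.coe_le_coe_iff.mpr hs.2) ht.2⟩
  have hsub' : Icc 0 t ⊆ timeInterval T' := fun s hs =>
    ⟨hs.1, (hsub hs).2.trans_le hT⟩
  have hc := h.continuousOn.mono hsub
  have hc' := h'.continuousOn.mono hsub'
  obtain ⟨C, hC⟩ := isCompact_Icc.exists_bound_of_continuousOn hc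
  obtain ⟨C', hC'⟩ := isCompact_Icc.exists_bound_of_continuousOn hc'
  set M : ℝ := max C C' + 1
  have hM : 0 < M := by
    have := (norm_nonneg _).trans (hC t ⟨ht.1, le_rfl⟩)
    have := le_max_left C C'
    simp only [M]
    linarith
  set K : ℝ := 2 * √(M * M)
  have hK : 0 < K := by positivity
  obtain ⟨L, -, hL⟩ := exists_isTame hμ₀ hK
  have hsup : ∀ u : Q, ‖u‖ ≤ max C C' → nonlinearity μ u.toL2 = hL.comp u.toL2 := fun u hu =>
    nonlinearity_eq_comp hK hL (Q.ae_norm_le hM hM ((Q.norm_toL2_le u).trans (by simp only [M]; linarith))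
      (by simp only [M]; linarith))
  refine Q.toL2_injective ?_
  refine eqOn_of_duhamel hp.group' hL.lipschitz_comp (Complex.I * lam) ψ₀.toL2 ht.1
    (f := fun s => (ψ s).toL2) (g := fun s => (Ψ s).toL2)
    (Q.toL2.continuous.comp_continuousOn hc) (Q.toL2.continuous.comp_continuousOn hc')
    (fun s hs => ?_) (fun s hs => ?_) ⟨ht.1, le_rfl⟩
  · refine (h.duhamel s (hsub hs)).trans (congrArg _ (congrArg _ ?_))
    refine intervalIntegral.integral_congr fun r hr => ?_
    rw [uIcc_of_le hs.1] at hr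
    exact congrArg _ (hsup _ ((hC r ⟨hr.1, hr.2.trans hs.2⟩).trans (le_max_left _ _)))
  · refine (h'.duhamel s (hsub' hs)).trans (congrArg _ (congrArg _ ?_))
    refine intervalIntegral.integral_congr fun r hr => ?_
    rw [uIcc_of_le hs.1] at hr
    exact congrArg _ (hsup _ ((hC' r ⟨hr.1, hr.2.trans hs.2⟩).trans (le_max_right _ _)))

end

end DeltaPrimeNLS

open DeltaPrimeNLS in
theorem mainTheorem12 (γ lam μ : ℝ) (hγ : 0 < γ) (hlam : 0 < lam) (hμ₀ : 0 < μ) (hμ : μ < 2)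
    (ψ₀ : Q) :
    (∀ (T : EReal) (ψ : ℝ → Q), IsMaximalWeakSolution γ lam μ ψ₀ T ψ → T = ⊤) ∧
    ∃ Ψ : ℝ → Q,
      IsWeakSolution γ lam μ ψ₀ ⊤ Ψ ∧
      ContDiffOn ℝ 1 (fun t => Q.toDual (Ψ t)) (Set.Ici 0) ∧
      ∀ (T : EReal) (ψ : ℝ → Q), IsWeakSolution γ lam μ ψ₀ T ψ →
        Set.EqOn ψ Ψ (timeInterval T) := by
  obtain ⟨Ψ, h, hd⟩ := exists_global_solution hγ hlam hμ₀ hμ ψ₀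
  refine ⟨fun T ψ hψ => ?_, Ψ, h, hd.contDiffOn, fun T ψ hψ => hψ.eqOn hγ hμ₀ h le_top⟩
  exact top_le_iff.mp (hψ.maximal ⊤ Ψ h (hψ.isWeakSolution.eqOn hγ hμ₀ h le_top).symm)
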